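/- **Setting.** Let $d\gamma(z)=\frac1\pi\,d^2z$ on $\mathbb C$. For $N\ge 1$ (real), let $\mathcal B_N=\{u\in L^2(\mathbb C,\gamma):\ u(z)=g(z)e^{-N|z|^2/2},\ g \text{ entire}\}$, and let $P_N$ be the orthogonal projection of $L^2(\mathbb C,\gamma)$ onto $\mathcal B_N$, with integral kernel $P_N(x,z)=N e^{N(x\bar z-|x|^2/2-|z|^2/2)}$. Let $V:\mathbb C\to\mathbb R$ be continuous and $\mu\in\mathbb R$, and suppose that for some $\delta_0>0$: (a) $\{V\le\mu+\delta_0\}$ is compact and $\log(V-\mu)$ is Lipschitz on $\{V\ge\mu+\delta_0\}$; (b) $V$ is $C^\infty$ on $\{V<\mu+\delta_0\}$; (c) $\{V=\mu\}$ is non-empty and connected, and $\nabla V\ne0$ on it (so it is a smooth connected curve). Let $H_N=P_NVP_N$ be the associated self-adjoint Berezin–Toeplitz operator on $\mathcal B_N$ (the operator of the quadratic form $u\mapsto\int V|u|^2d\gamma$), let $\Pi_N=\mathbf 1\{H_N\le\mu\}$ be its spectral projection, with continuous integral kernel $\Pi_N(x,z)$, let $\mathcal N=\mathcal N(\mu)=\operatorname{tr}\Pi_N$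 (it depends on $N$), and let $\mathcal D=\{V<\mu\}$. Let $\mathbb P_N$ be the law of the determinantal point process of $\Pi_N$: the probability measure on $\mathbb C^{\mathcal N}$ with density $\frac1{\mathcal N!}\det[\Pi_N(x_i,x_j)]_{i,j=1}^{\mathcal N}$ with respect to $\gamma^{\otimes\mathcal N}$. For $f:\mathbb C\to\mathbb R$ put $\mathbf X(f)=f(x_1)+\dots+f(x_{\mathcal N})$. **Proposition.** For every $N\ge1$ these objects are well defined: the spectral projection exists (as the unique orthogonal projection commuting with $H_N$ such that $H_N\le\mu$ on its range and $H_N>\mu$ on the orthogonal complement), it has finite rank, and $\mathbb P_N$ is a probability measure. Moreover, as $N\to+\infty$: 1. For every $x\in\mathbb C$ with $V(x)\neq\mu$, $N^{-1}\Pi_N(x,x)\to\mathbf 1\{V(x)<\mu\}$. 2. For every $\delta>0$ and every $\alpha>0$ there are $C$ and $N_0$ such that for all $N\ge N_0$ and all $x\in\mathbb C$ with $|V(x)-\mu|\ge\delta$, $$\bigl|\Pi_N(x,x)-N\,\mathbf 1\{V(x)<\mu\}\bigr|\le C e^{-\alpha\sqrt N}.$$ 3. $\mathcal N(\mu)\sim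 N\gamma(\mathcal D)$, that is, the ratio tends to $1$. 4. For every measurable $f:\mathbb C\to[0,\infty)$ with $f(x)\le e^{C|x|}$ for all $x$ and some $C\ge0$, $N^{-1}\mathbf X(f)\to\int_{\mathcal D}f\,d\gamma$ in $L^2$, that is, $$\mathbb E_{\mathbb P_N}\Bigl[\Bigl|N^{-1}\mathbf X(f)-\int_{\mathcal D}f\,d\gamma\Bigr|^2\Bigr]\to0 .$$ -/

import Mathlib

open MeasureTheory Filter Topology Asymptotics
open scoped ENNReal NNReal ContDiff ComplexConjugate

noncomputable section

namespace BerezinToeplitz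

/-- The reference measure on `ℂ`: Lebesgue measure divided by `π`. -/
def gam : Measure ℂ := ENNReal.ofReal (Real.pi⁻¹) • (volume : Measure ℂ)

/-- The hypotheses on the potential `V` and the energy `μ`, all with the same `δ > 0`.
Since `V` is smooth near the level set `{V = μ}` and its differential does not vanish there, that
level set is automatically a smooth embedded one-dimensional submanifold; `connected_level`
says that it is non-empty and connected. -/
structure PotentialAssumption (V : ℂ → ℝ) (μ δ : ℝ) : Prop where
  continuous : Continuous V
  pos : 0 < δ
  compact_sublevel : IsCompact {z : ℂ | V z ≤ μ + δ}
  log_lipschitz : ∃ K : ℝ≥0,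
    LipschitzOnWith K (fun z => Real.log (V z - μ)) {z : ℂ | μ + δ ≤ V z}
  smooth : ContDiffOn ℝ ∞ V {z : ℂ | V z < μ + δ}
  connected_level : IsConnected {z : ℂ | V z = μ}
  regular_level : ∀ z : ℂ, V z = μ → fderiv ℝ V z ≠ 0

/-- The droplet `{V < μ}`. -/
def droplet (V : ℂ → ℝ) (μ : ℝ) : Set ℂ := {z | V z < μ}

/-! ### The Fock-Bargmann space and its projection kernel -/

/-- The Gaussian weight `exp (-N |z|² / 2)`. -/
def gaussWeight (N : ℝ) (z : ℂ) : ℂ := (Real.exp (-(N * ‖z‖ ^ 2 / 2)) : ℂ)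

theorem gaussWeight_continuous (N : ℝ) : Continuous (gaussWeight N) := by
  unfold gaussWeight; fun_prop

/-- The Fock-Bargmann space: the classes in `L²(ℂ, gam)` of the form
`g(z) exp (-N |z|² / 2)` with `g` entire. It inherits the inner product of `L²`. -/
def fock (N : ℝ) : Submodule ℂ (Lp ℂ 2 gam) where
  carrier := {u | ∃ g : ℂ → ℂ, Differentiable ℂ g ∧ ⇑u =ᵐ[gam] fun z => g z * gaussWeight N z}
  zero_mem' := by
    refine ⟨fun _ => 0, by fun_prop, ?_⟩
    filter_upwards [Lp.coeFn_zero ℂ 2 gam] with z hz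
    exact hz.trans (by simp)
  add_mem' := by
    rintro u v ⟨g, hg, hu⟩ ⟨h, hh, hv⟩
    refine ⟨fun z => g z + h z, by fun_prop, ?_⟩
    filter_upwards [Lp.coeFn_add u v, hu, hv] with z h1 h2 h3
    refine h1.trans ?_
    simp [h2, h3, add_mul]
  smul_mem' := by
    rintro c u ⟨g, hg, hu⟩
    refine ⟨fun z => c * g z, by fun_prop, ?_⟩
    filter_upwards [Lp.coeFn_smul c u, hu] with z h1 h2
    refine h1.trans ?_
    simp [h2, mul_assoc]

/-- The continuous representative of an element of the Fock-Bargmann space. -/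
def val {N : ℝ} (u : fock N) (z : ℂ) : ℂ := u.2.choose z * gaussWeight N z

theorem val_ae {N : ℝ} (u : fock N) : ⇑(u : Lp ℂ 2 gam) =ᵐ[gam] val u := u.2.choose_spec.2

theorem val_continuous {N : ℝ} (u : fock N) : Continuous (val u) :=
  u.2.choose_spec.1.continuous.mul (gaussWeight_continuous N)

instance gam_isOpenPosMeasure : gam.IsOpenPosMeasure :=
  Measure.isOpenPosMeasure_smul _ (by simpa using Real.pi_pos)

theorem val_unique {N : ℝ} (u : fock N) {h : ℂ → ℂ} (hc : Continuous h)
    (hu : ⇑(u : Lp ℂ 2 gam) =ᵐ[gam] h) : val u = h :=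
  ((val_continuous u).ae_eq_iff_eq gam hc).1 ((val_ae u).symm.trans hu)

theorem val_injective {N : ℝ} {u v : fock N} (h : val u = val v) : u = v :=
  Subtype.ext (Lp.ext ((val_ae u).trans (h ▸ (val_ae v).symm)))

theorem val_add {N : ℝ} (u v : fock N) : val (u + v) = fun z => val u z + val v z := by
  refine val_unique _ ((val_continuous u).add (val_continuous v)) ?_
  filter_upwards [Lp.coeFn_add (u : Lp ℂ 2 gam) v, val_ae u, val_ae v] with z h1 h2 h3
  refine h1.trans ?_
  simp [h2, h3]

theorem val_smul {N : ℝ} (c : ℂ) (u : fock N) : val (c • u) = fun z => c * val u z := by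
  refine val_unique _ (continuous_const.mul (val_continuous u)) ?_
  filter_upwards [Lp.coeFn_smul c (u : Lp ℂ 2 gam), val_ae u] with z h1 h2
  refine h1.trans ?_
  simp [h2]

theorem val_zero {N : ℝ} : val (0 : fock N) = fun _ => 0 := by
  have h := val_smul (0 : ℂ) (0 : fock N)
  simpa using h

/-- The integral kernel `P_N(x, z) = N exp (N (x z̄ - |x|² / 2 - |z|² / 2))` of the orthogonal
projection `P_N` of `L²(ℂ, gam)` onto the Fock-Bargmann space. -/
def bargmannKernel (N : ℝ) (x z : ℂ) : ℂ :=
  N * Complex.exp (N * (x * conj z - (‖x‖ ^ 2 / 2 : ℝ) - (‖z‖ ^ 2 / 2 : ℝ)))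

/-! ### The Berezin-Toeplitz operator and its spectral projection -/

/-- The domain of `P_N V P_N` (an unbounded operator in general): the `u` in the Fock-Bargmann
space with `∫ |V| |u|² < ∞` (the form domain) such that `P_N (V u)`, given by an absolutely
convergent integral, is in the Fock-Bargmann space. -/
def toeplitzDomain (N : ℝ) (V : ℂ → ℝ) : Submodule ℂ (fock N) where
  carrier := {u | MemLp (fun z => (Real.sqrt |V z| : ℂ) * val u z) 2 gam ∧
    (∀ x, Integrable (fun z => bargmannKernel N x z * (V z * val u z)) gam) ∧
    ∃ w : fock N, ∀ x, val w x = ∫ z, bargmannKernel N x z * (V z * val u z) ∂gam}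
  zero_mem' := by
    refine ⟨by simp [val_zero], by simp [val_zero], 0, by simp [val_zero]⟩
  add_mem' := by
    rintro u v ⟨hu1, hu2, w, hw⟩ ⟨hv1, hv2, w', hw'⟩
    refine ⟨?_, fun x => ?_, w + w', fun x => ?_⟩
    · simp only [val_add, mul_add]
      exact hu1.add hv1
    · simp only [val_add, mul_add]
      exact (hu2 x).add (hv2 x)
    · simp only [val_add, mul_add]
      rw [integral_add (hu2 x) (hv2 x), hw, hw']
  smul_mem' := by
    rintro c u ⟨hu1, hu2, w, hw⟩
    have e : ∀ a b d : ℂ, a * (b * (c * d)) = c * (a * (b * d)) := fun a b d => by ring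
    have e' : ∀ a d : ℂ, a * (c * d) = c * (a * d) := fun a d => by ring
    refine ⟨?_, fun x => ?_, c • w, fun x => ?_⟩
    · simpa only [val_smul, e'] using hu1.const_mul c
    · simpa only [val_smul, e] using (hu2 x).const_mul c
    · simp only [val_smul, e]
      rw [integral_const_mul, hw]

theorem toeplitz_spec {N : ℝ} {V : ℂ → ℝ} (u : toeplitzDomain N V) :
    ∃ w : fock N, ∀ x, val w x = ∫ z, bargmannKernel N x z * (V z * val (u : fock N) z) ∂gam :=
  u.2.2.2

/-- The Berezin-Toeplitz operator `H_N = P_N V P_N` on the Fock-Bargmann space: `u` is mapped to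
`P_N (V u)`. -/
def toeplitz (N : ℝ) (V : ℂ → ℝ) : fock N →ₗ.[ℂ] fock N where
  domain := toeplitzDomain N V
  toFun :=
    { toFun := fun u => (toeplitz_spec u).choose
      map_add' := by
        intro u v
        refine val_injective (funext fun x => ?_)
        rw [(toeplitz_spec (u + v)).choose_spec x]
        simp only [val_add, Submodule.coe_add, mul_add]
        rw [(toeplitz_spec u).choose_spec x, (toeplitz_spec v).choose_spec x]
        exact integral_add (u.2.2.1 x) (v.2.2.1 x)
      map_smul' := by
        intro c u
        have e : ∀ a b d : ℂ, a * (b * (c * d)) = c * (a * (b * d)) := fun a b d => by ring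
        refine val_injective (funext fun x => ?_)
        rw [(toeplitz_spec (c • u)).choose_spec x]
        simp only [val_smul, Submodule.coe_smul, RingHom.id_apply, e]
        rw [(toeplitz_spec u).choose_spec x]
        exact integral_const_mul _ _ }

/-- `P` is the spectral projection `1{T ≤ μ}` of the self-adjoint operator `T`: the orthogonal
projection that commutes with `T` and such that `T ≤ μ` on the range of `P` and `T > μ` on its
orthogonal complement (for a self-adjoint `T`, the spectral projection is the only operator with
these properties). -/
structure IsSpectralProjection {H : Type*} [NormedAddCommGroup H] [InnerProductSpace ℂ H]
    (T : H →ₗ.[ℂ] H) (μ : ℝ) (P : H →L[ℂ] H) : Prop where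
  projection : (P : H →ₗ[ℂ] H).IsSymmetricProjection
  commutes : ∀ u : T.domain, ∃ h : P u ∈ T.domain, T ⟨P u, h⟩ = P (T u)
  le_on_range : ∀ u : T.domain, P u = u →
    (inner ℂ (u : H) (T u)).re ≤ μ * ‖(u : H)‖ ^ 2
  gt_on_ker : ∀ u : T.domain, P u = 0 → (u : H) ≠ 0 →
    μ * ‖(u : H)‖ ^ 2 < (inner ℂ (u : H) (T u)).re

open Classical in
/-- The spectral projection `1{T ≤ μ}`. -/
def spectralProjection {H : Type*} [NormedAddCommGroup H] [InnerProductSpace ℂ H]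
    (T : H →ₗ.[ℂ] H) (μ : ℝ) : H →L[ℂ] H :=
  if h : ∃ P, IsSpectralProjection T μ P then h.choose else 0

/-- `Π_N = 1{P_N V P_N ≤ μ}`. -/
def fermiProjection (V : ℂ → ℝ) (μ N : ℝ) : fock N →L[ℂ] fock N :=
  spectralProjection (toeplitz N V) μ

/-- The range of `Π_N`. -/
def fermiSpace (V : ℂ → ℝ) (μ N : ℝ) : Submodule ℂ (fock N) :=
  LinearMap.range (fermiProjection V μ N : fock N →ₗ[ℂ] fock N)

/-- The particle number, the trace (that is, the rank) of `Π_N`. -/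
def particleNumber (V : ℂ → ℝ) (μ N : ℝ) : ℕ := Module.finrank ℂ (fermiSpace V μ N)

open Classical in
/-- The (continuous) integral kernel `Π_N(x, z) = ∑ₖ φₖ(x) conj (φₖ(z))` of `Π_N`, for an
orthonormal basis `φ` of its range (finite-dimensional; the value does not depend on the basis). -/
def fermiKernel (V : ℂ → ℝ) (μ N : ℝ) (x z : ℂ) : ℂ :=
  if _h : FiniteDimensional ℂ (fermiSpace V μ N) then
    ∑ k, val (stdOrthonormalBasis ℂ (fermiSpace V μ N) k : fock N) x *
      conj (val (stdOrthonormalBasis ℂ (fermiSpace V μ N) k : fock N) z)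
  else 0

/-! ### The determinantal point process -/

/-- The law of the determinantal point process associated with `Π_N`, as a law of
(exchangeable) configurations `(x₁, …, x_𝒩)`: its density with respect to `gam^{⊗ 𝒩}` is
`det [Π_N(xᵢ, xⱼ)] / 𝒩!`. -/
def processLaw (V : ℂ → ℝ) (μ N : ℝ) : Measure (Fin (particleNumber V μ N) → ℂ) :=
  (Measure.pi fun _ => gam).withDensity fun x =>
    ENNReal.ofReal ((Matrix.of fun i j => fermiKernel V μ N (x i) (x j)).det.re /
      (particleNumber V μ N).factorial)

/-- The linear statistic `X(f) = f(x₁) + ⋯ + f(xₙ)`. -/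
def linearStatistic {n : ℕ} (f : ℂ → ℝ) (x : Fin n → ℂ) : ℝ := ∑ i, f (x i)

end BerezinToeplitz

end

open MeasureTheory Filter Topology Asymptotics
open scoped ENNReal NNReal ContDiff ComplexConjugate

noncomputable section

namespace BerezinToeplitz

section

/-! ### The reference measure -/

/-! Coherent states translate the spectral problem into pointwise estimates. With `k_x = P_N(·, x)`
the reproducing property gives `⟨k_x, u⟩ = u(x)`, hence `Π_N(x, x) = ‖Π_N k_x‖²`, `‖k_x‖² = N` and
`N - Π_N(x, x) = ‖(1 - Π_N) k_x‖²`. It is therefore enough to show that `‖R k_x‖` is exponentially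
small when `R = Π_N` and `V(x) > μ`, or `R = 1 - Π_N` and `V(x) < μ`.

The decay is an Agmon-type estimate (`mul_norm_apply_coherent_le`, `norm_apply_coherent_le`). Since
`R` commutes with `H_N`, `⟨R k_x, H_N R k_x⟩ = ⟨R k_x, V k_x⟩`. Freezing `V` at `x` and using that
`H_N` is on one side of `μ` on the range of `R` gives `|V(x) - μ| ρ(x) ≤ ∫ |V(z) - V(x)| |P_N(x, z)|
ρ(z)` for `ρ(z) = ‖R k_z‖`. The kernel lives at scale `N^{-1/2}`, where `V` oscillates by a small
fraction of `|V(x) - μ|`; the log-Lipschitz hypothesis makes this uniform at infinity. The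
inequality survives a weight `exp (β √N dist)` for every `β`, and comparing suprema yields decay
`exp (-β √N dist)` from the region where the sign of `V - μ` is favourable or `|V - μ|` is small.

Existence of `Π_N` rests on the splitting `V - μ = truncation - well`, with `truncation ≥ δ` and
`well` continuous, compactly supported and non-negative. A space of non-positive energy has
dimension at most `N ∫ well / δ` (`mul_finrank_le`). On the complement of an invariant low-energy
space, the direct method gives an eigenvector whenever the energy is not positive
(`exists_eigenvector`). An invariant low-energy space of maximal dimension is then the range of
`Π_N`.

For the process, the Andréief identity expresses correlations as averages of minors of the Hermitian
matrix of multiplication by `f` in the orbitals. For `f ≥ 0`, the `2 × 2` minors are at most the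
products of their diagonal entries, so the variance of `X(f)` is at most `∫ f² Π_N(x, x)`, which is
of order at most `N`. Dominated convergence, with a majorant decaying faster than the growth of `f`
and a null level set, gives the limit of the mean and of the particle number. -/

instance gam_isAddHaarMeasure : gam.IsAddHaarMeasure :=
  Measure.IsAddHaarMeasure.smul _ (by simpa using Real.pi_pos) ENNReal.ofReal_ne_top

theorem integral_gam {E : Type*} [NormedAddCommGroup E] [NormedSpace ℝ E] (f : ℂ → E) :
    ∫ z, f z ∂gam = Real.pi⁻¹ • ∫ z, f z := by
  rw [gam, integral_smul_measure, ENNReal.toReal_ofReal (inv_nonneg.2 Real.pi_pos.le)]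

theorem integrable_gam {E : Type*} [NormedAddCommGroup E] {f : ℂ → E}
    (hf : Integrable f volume) : Integrable f gam :=
  hf.smul_measure ENNReal.ofReal_ne_top

theorem integrable_gaussian {b : ℝ} (hb : 0 < b) :
    Integrable (fun z : ℂ => Real.exp (-(b * ‖z‖ ^ 2))) gam := by
  refine integrable_gam ?_
  have h := (GaussianFourier.integrable_cexp_neg_mul_sq_norm_add (V := ℂ) (b := (b : ℂ))
    (by simpa using hb) 0 0).norm
  refine h.congr (Eventually.of_forall fun z => ?_)
  simp only [Complex.norm_exp]
  norm_num
  exact Or.inl (by norm_cast)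

theorem integral_gaussian {b : ℝ} (hb : 0 < b) :
    ∫ z : ℂ, Real.exp (-(b * ‖z‖ ^ 2)) ∂gam = b⁻¹ := by
  have h := GaussianFourier.integral_rexp_neg_mul_sq_norm (V := ℂ) hb
  simp only [neg_mul] at h
  rw [integral_gam, h, Complex.finrank_real_complex]
  have := Real.pi_pos.ne'
  norm_num
  field_simp

/-- Completing the square trades half of the Gaussian for the linear term. This absorbs every
exponential weight met later. -/
theorem integrable_exp_linear_sub_sq (a : ℝ) {b : ℝ} (hb : 0 < b) :
    Integrable (fun z : ℂ => Real.exp (a * ‖z‖ - b * ‖z‖ ^ 2)) gam := by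
  refine ((integrable_gaussian (half_pos hb)).const_mul (Real.exp (a ^ 2 / (2 * b)))).mono'
    (by fun_prop) (Eventually.of_forall fun z => ?_)
  rw [Real.norm_eq_abs, abs_of_pos (Real.exp_pos _), ← Real.exp_add]
  refine Real.exp_le_exp.2 ?_
  have : a ^ 2 / (2 * b) + -(b / 2 * ‖z‖ ^ 2) - (a * ‖z‖ - b * ‖z‖ ^ 2)
      = (a - b * ‖z‖) ^ 2 / (2 * b) := by field_simp; ring
  have h2 : 0 ≤ (a - b * ‖z‖) ^ 2 / (2 * b) := by positivity
  linarith

/-! ### The Gaussian mean value property -/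

theorem integral_rotation {E : Type*} [NormedAddCommGroup E] [NormedSpace ℝ E] (f : ℂ → E)
    (c : Circle) : ∫ z, f (c * z) ∂gam = ∫ z, f z ∂gam := by
  have h := (rotation c).measurePreserving.integral_comp
    (rotation c).toHomeomorph.measurableEmbedding f
  simp only [integral_gam]
  rw [← h]
  simp [rotation_apply]

theorem integrable_rotation {E : Type*} [NormedAddCommGroup E] {f : ℂ → E}
    (hf : Integrable f gam) (c : Circle) : Integrable (fun z => f (c * z)) gam := by
  have hf' : Integrable f volume := by
    refine (integrable_smul_measure ?_ ENNReal.ofReal_ne_top).1 hf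
    simpa using Real.pi_pos
  exact integrable_gam (((rotation c).measurePreserving.integrable_comp_emb
    (rotation c).toHomeomorph.measurableEmbedding).2 hf')

/-- The measure and the Gaussian are rotation invariant, so the integral equals its average over
rotations. Fubini moves the average onto `g`, where the mean value property on circles replaces it
by `g 0`. -/
theorem integral_entire_mul_gaussian {b : ℝ} (hb : 0 < b) {g : ℂ → ℂ} (hg : Differentiable ℂ g)
    (hi : Integrable (fun z => g z * (Real.exp (-(b * ‖z‖ ^ 2)) : ℂ)) gam) :
    ∫ z, g z * (Real.exp (-(b * ‖z‖ ^ 2)) : ℂ) ∂gam = g 0 * (b : ℂ)⁻¹ := by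
  set h : ℂ → ℂ := fun z => g z * (Real.exp (-(b * ‖z‖ ^ 2)) : ℂ) with hh
  have hc : Continuous h := hg.continuous.mul (by fun_prop)
  set F : ℝ × ℂ → ℂ := fun p => h (Complex.exp (p.1 * Complex.I) * p.2) with hFdef
  have hF : ∀ θ : ℝ, ∫ z, F (θ, z) ∂gam = ∫ z, h z ∂gam := fun θ =>
    integral_rotation h (Circle.exp θ)
  have hFn : ∀ θ : ℝ, ∫ z, ‖F (θ, z)‖ ∂gam = ∫ z, ‖h z‖ ∂gam := fun θ =>
    integral_rotation (fun z => ‖h z‖) (Circle.exp θ)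
  have hFi : ∀ θ : ℝ, Integrable (fun z => F (θ, z)) gam := fun θ =>
    integrable_rotation hi (Circle.exp θ)
  have hcF : Continuous F := by fun_prop
  -- Each slice in `θ` has the same `L¹` norm, by rotation invariance, and the range of angles is
  -- bounded.
  have hint : Integrable F ((volume.restrict (Set.uIoc 0 (2 * Real.pi))).prod gam) := by
    refine (integrable_prod_iff hcF.aestronglyMeasurable).2 ⟨Eventually.of_forall hFi, ?_⟩
    simp only [hFn]
    rw [Set.uIoc_of_le (by positivity)]
    exact integrable_const _
  have hswap := intervalIntegral_integral_swap (f := fun θ z => F (θ, z)) hint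
  have hin : ∀ z, ∫ θ in (0:ℝ)..(2 * Real.pi), F (θ, z)
      = (2 * Real.pi : ℝ) * (g 0 * (Real.exp (-(b * ‖z‖ ^ 2)) : ℂ)) := by
    intro z
    have hm := DiffContOnCl.circleAverage (f := fun w => g (w * z)) (c := 0) (R := 1)
      (hg.comp (by fun_prop : Differentiable ℂ fun w : ℂ => w * z)).diffContOnCl
    rw [Real.circleAverage_def] at hm
    have e : ∀ θ : ℝ, F (θ, z)
        = g (circleMap 0 1 θ * z) * (Real.exp (-(b * ‖z‖ ^ 2)) : ℂ) := by
      intro θ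
      simp [hh, hFdef, circleMap, Complex.norm_exp_ofReal_mul_I]
    simp only [e, intervalIntegral.integral_mul_const]
    rw [zero_mul, inv_smul_eq_iff₀ (by positivity)] at hm
    rw [hm, Complex.real_smul, mul_assoc]
  simp only [hF, hin] at hswap
  rw [intervalIntegral.integral_const, integral_const_mul, integral_const_mul,
    integral_complex_ofReal, integral_gaussian hb, sub_zero, Complex.real_smul] at hswap
  have h2 : ((2 * Real.pi : ℝ) : ℂ) ≠ 0 := by exact_mod_cast (by positivity : (2 * Real.pi) ≠ 0)
  simpa using mul_left_cancel₀ h2 hswap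

end

section

/-- A shortcut instance, found before the inner product that comes from the C⋆-module structure of a
complex Hilbert space. -/
@[reducible] instance innerOfInnerProductSpace (H : Type*) [NormedAddCommGroup H]
    [InnerProductSpace ℂ H] : Inner ℂ H := InnerProductSpace.toInner

theorem inner_smul_fock {N : ℝ} (u v : fock N) (c : ℂ) : inner ℂ u (c • v) = c * inner ℂ u v :=
  inner_smul_right (𝕜 := ℂ) u v c

/-! ### Coherent states and the reproducing property -/

/-- The real part of the exponent is `-N |x - z|² / 2`: the kernel is concentrated at distance
`N^{-1/2}` from the diagonal. -/
theorem norm_bargmannKernel {N : ℝ} (hN : 0 ≤ N) (x z : ℂ) :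
    ‖bargmannKernel N x z‖ = N * Real.exp (-(N / 2 * ‖x - z‖ ^ 2)) := by
  rw [bargmannKernel, norm_mul, Complex.norm_real, Real.norm_of_nonneg hN, Complex.norm_exp]
  congr 2
  simp only [Complex.sq_norm, Complex.normSq_apply, Complex.mul_re, Complex.sub_re, Complex.sub_im,
    Complex.ofReal_re, Complex.ofReal_im, Complex.conj_re, Complex.conj_im]
  ring

theorem conj_bargmannKernel (N : ℝ) (x z : ℂ) :
    conj (bargmannKernel N x z) = bargmannKernel N z x := by
  simp only [bargmannKernel, map_mul, ← Complex.exp_conj, map_sub, Complex.conj_ofReal,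
    Complex.conj_conj]
  congr 2
  ring

theorem continuous_bargmannKernel (N : ℝ) :
    Continuous fun p : ℂ × ℂ => bargmannKernel N p.1 p.2 := by
  unfold bargmannKernel
  fun_prop

theorem continuous_bargmannKernel_left (N : ℝ) (x : ℂ) :
    Continuous fun z => bargmannKernel N z x := by
  unfold bargmannKernel
  fun_prop

theorem bargmannKernel_eq (N : ℝ) (z x : ℂ) : bargmannKernel N z x =
    (N * Complex.exp (N * (z * conj x - (‖x‖ ^ 2 / 2 : ℝ)))) * gaussWeight N z := by
  rw [bargmannKernel, gaussWeight, mul_assoc, Complex.ofReal_exp, ← Complex.exp_add]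
  congr 2
  push_cast
  ring

theorem integrable_exp_translate (a : ℝ) {b : ℝ} (hb : 0 < b) (x : ℂ) :
    Integrable (fun z : ℂ => Real.exp (a * ‖x - z‖ - b * ‖x - z‖ ^ 2)) gam :=
  (integrable_exp_linear_sub_sq a hb).comp_sub_left x

theorem memLp_bargmannKernel {N : ℝ} (hN : 0 < N) (x : ℂ) :
    MemLp (fun z => bargmannKernel N z x) 2 gam := by
  refine (memLp_two_iff_integrable_sq_norm
    (continuous_bargmannKernel_left N x).aestronglyMeasurable).2 ?_
  have e : ∀ z, ‖bargmannKernel N z x‖ ^ 2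
      = N ^ 2 * Real.exp (0 * ‖x - z‖ - N * ‖x - z‖ ^ 2) := fun z => by
    rw [norm_bargmannKernel hN.le, mul_pow, ← Real.exp_nat_mul, norm_sub_rev z x]
    congr 2
    push_cast
    ring
  simp only [e]
  exact (integrable_exp_translate 0 hN x).const_mul (N ^ 2)

theorem toLp_bargmannKernel_mem_fock {N : ℝ} (hN : 0 < N) (x : ℂ) :
    (memLp_bargmannKernel hN x).toLp _ ∈ fock N := by
  refine ⟨fun z => N * Complex.exp (N * (z * conj x - (‖x‖ ^ 2 / 2 : ℝ))), by fun_prop, ?_⟩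
  filter_upwards [(memLp_bargmannKernel hN x).coeFn_toLp] with z hz
  rw [hz, bargmannKernel_eq]

/-- The coherent state at `x`, with continuous representative `z ↦ P_N(z, x)`. -/
def coherent {N : ℝ} (hN : 0 < N) (x : ℂ) : fock N :=
  ⟨(memLp_bargmannKernel hN x).toLp _, toLp_bargmannKernel_mem_fock hN x⟩

theorem val_coherent {N : ℝ} (hN : 0 < N) (x : ℂ) :
    val (coherent hN x) = fun z => bargmannKernel N z x :=
  val_unique _ (continuous_bargmannKernel_left N x) (memLp_bargmannKernel hN x).coeFn_toLp

theorem val_neg {N : ℝ} (u : fock N) : val (-u) = fun z => -val u z := by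
  simpa using val_smul (-1) u

theorem val_sub {N : ℝ} (u v : fock N) : val (u - v) = fun z => val u z - val v z := by
  rw [sub_eq_add_neg, val_add, val_neg]
  rfl

theorem memLp_val {N : ℝ} (u : fock N) : MemLp (val u) 2 gam :=
  (memLp_congr_ae (val_ae u)).1 (Lp.memLp (u : Lp ℂ 2 gam))

theorem inner_eq_integral {N : ℝ} (u v : fock N) :
    inner ℂ u v = ∫ z, conj (val u z) * val v z ∂gam := by
  rw [Submodule.coe_inner, L2.inner_def]
  refine integral_congr_ae ?_
  filter_upwards [val_ae u, val_ae v] with z h1 h2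
  rw [h1, h2, RCLike.inner_apply, mul_comm]

theorem integrable_conj_mul {f g : ℂ → ℂ} (hf : MemLp f 2 gam) (hg : MemLp g 2 gam) :
    Integrable (fun z => conj (f z) * g z) gam :=
  hf.star.integrable_mul hg

theorem re_inner_self {H : Type*} [NormedAddCommGroup H] [InnerProductSpace ℂ H] (u : H) :
    (inner ℂ u u).re = ‖u‖ ^ 2 :=
  inner_self_eq_norm_sq (𝕜 := ℂ) u

theorem norm_sq_eq_integral {N : ℝ} (u : fock N) :
    ‖u‖ ^ 2 = ∫ z, ‖val u z‖ ^ 2 ∂gam := by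
  have e : ∀ z, conj (val u z) * val u z = ((‖val u z‖ ^ 2 : ℝ) : ℂ) := fun z => by
    rw [Complex.conj_mul']; push_cast; rfl
  rw [← re_inner_self, inner_eq_integral]
  simp only [e, integral_complex_ofReal, Complex.ofReal_re]

theorem inner_coherent_eq_integral {N : ℝ} (hN : 0 < N) (x : ℂ) (u : fock N) :
    inner ℂ (coherent hN x) u = ∫ z, bargmannKernel N x z * val u z ∂gam := by
  simp only [inner_eq_integral, val_coherent, conj_bargmannKernel]

theorem integrable_bargmannKernel_mul {N : ℝ} (hN : 0 < N) (x : ℂ) {f : ℂ → ℂ}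
    (hf : MemLp f 2 gam) : Integrable (fun z => bargmannKernel N x z * f z) gam := by
  simpa only [conj_bargmannKernel] using integrable_conj_mul (memLp_bargmannKernel hN x) hf

/-- The reproducing property. After the translation `z = x + y`, the antiholomorphic factors cancel
and the integrand is an entire function of `y` times `exp (-N |y|²)`, so
`integral_entire_mul_gaussian` evaluates it at `y = 0`. -/
theorem inner_coherent {N : ℝ} (hN : 0 < N) (x : ℂ) (u : fock N) :
    inner ℂ (coherent hN x) u = val u x := by
  have hi := integrable_bargmannKernel_mul hN x (memLp_val u)
  rw [inner_coherent_eq_integral, ← integral_add_left_eq_self _ x]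
  have hi' := hi.comp_add_left x
  obtain ⟨hg, -⟩ := u.2.choose_spec
  set g := u.2.choose with hgdef
  set G : ℂ → ℂ := fun y => N * g (x + y) * Complex.exp (-(N * (conj x * y)))
    * Complex.exp (-(N * ‖x‖ ^ 2 / 2 : ℝ)) with hG
  have e : ∀ y, bargmannKernel N x (x + y) * val u (x + y)
      = G y * (Real.exp (-(N * ‖y‖ ^ 2)) : ℂ) := by
    intro y
    have e1 : val u (x + y) = g (x + y) * gaussWeight N (x + y) := rfl
    rw [e1, hG, bargmannKernel, gaussWeight]
    simp only [Complex.ofReal_exp]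
    have e2 : Complex.exp (N * (x * conj (x + y) - (‖x‖ ^ 2 / 2 : ℝ) - (‖x + y‖ ^ 2 / 2 : ℝ)))
        * Complex.exp (-(N * ‖x + y‖ ^ 2 / 2) : ℝ) = Complex.exp (-(N * (conj x * y)))
        * Complex.exp (-(N * ‖x‖ ^ 2 / 2 : ℝ)) * Complex.exp (-(N * ‖y‖ ^ 2) : ℝ) := by
      simp only [← Complex.exp_add]
      congr 1
      push_cast
      simp only [← Complex.mul_conj', map_add]
      ring
    linear_combination (N * g (x + y)) * e2
  simp only [e] at hi' ⊢
  have hGd : Differentiable ℂ G := by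
    have : Differentiable ℂ fun y => g (x + y) := hg.comp (by fun_prop)
    fun_prop
  rw [integral_entire_mul_gaussian hN hGd hi']
  have hN' : (N : ℂ) ≠ 0 := by exact_mod_cast hN.ne'
  have e3 : val u x = g x * gaussWeight N x := rfl
  rw [e3, gaussWeight, hG, Complex.ofReal_exp, Complex.ofReal_neg]
  simp only [add_zero, mul_zero, neg_zero, Complex.exp_zero, mul_one]
  field_simp

theorem integral_bargmannKernel_mul_val {N : ℝ} (hN : 0 < N) (x : ℂ) (u : fock N) :
    ∫ z, bargmannKernel N x z * val u z ∂gam = val u x := by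
  rw [← inner_coherent_eq_integral hN, inner_coherent]

theorem bargmannKernel_self (N : ℝ) (x : ℂ) : bargmannKernel N x x = N := by
  rw [bargmannKernel, Complex.mul_conj']
  have : (N : ℂ) * (‖x‖ ^ 2 - (‖x‖ ^ 2 / 2 : ℝ) - (‖x‖ ^ 2 / 2 : ℝ)) = 0 := by push_cast; ring
  rw [this, Complex.exp_zero, mul_one]

theorem norm_sq_coherent {N : ℝ} (hN : 0 < N) (x : ℂ) : ‖coherent hN x‖ ^ 2 = N := by
  rw [← re_inner_self, inner_coherent hN x, val_coherent]
  simp only [bargmannKernel_self, Complex.ofReal_re]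

theorem norm_coherent {N : ℝ} (hN : 0 < N) (x : ℂ) : ‖coherent hN x‖ = Real.sqrt N := by
  exact (Real.sqrt_eq_iff_mul_self_eq (by positivity) (by positivity)).2
    (by rw [← sq, norm_sq_coherent]) |>.symm

theorem norm_val_le {N : ℝ} (hN : 0 < N) (u : fock N) (x : ℂ) :
    ‖val u x‖ ≤ Real.sqrt N * ‖u‖ := by
  rw [← inner_coherent hN, ← norm_coherent hN x]
  exact norm_inner_le_norm (𝕜 := ℂ) (coherent hN x) u

theorem eq_zero_of_inner_coherent {N : ℝ} (hN : 0 < N) {u : fock N}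
    (h : ∀ x, inner ℂ (coherent hN x) u = 0) : u = 0 :=
  val_injective (funext fun x => by rw [← inner_coherent hN, h x, val_zero])

end

section

/-! ### Completeness of the Fock-Bargmann space -/

theorem gaussWeight_ne_zero (N : ℝ) (z : ℂ) : gaussWeight N z ≠ 0 := by
  rw [gaussWeight]
  exact_mod_cast (Real.exp_pos _).ne'

/-- Evaluation at a point is pairing with a vector of norm `√N`, so `L²` convergence forces uniform
convergence of the continuous representatives. The entire factors then converge locally uniformly,
and their limit is entire. -/
theorem isClosed_fock {N : ℝ} (hN : 0 < N) : IsClosed (fock N : Set (Lp ℂ 2 gam)) := by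
  have : Fact ((1 : ℝ≥0∞) ≤ 2) := ⟨by norm_num⟩
  refine IsSeqClosed.isClosed fun u f hu hf => ?_
  lift u to ℕ → fock N using hu
  -- The candidate representative of the limit: this pairing makes sense in `L²` before `f` is known
  -- to belong to the Fock space.
  set F : ℂ → ℂ := fun x => inner ℂ (coherent hN x : Lp ℂ 2 gam) f with hF
  have hval : ∀ n x, val (u n) x = inner ℂ (coherent hN x : Lp ℂ 2 gam) (u n : Lp ℂ 2 gam) :=
    fun n x => (inner_coherent hN x (u n)).symm
  have hb : ∀ n x, ‖F x - val (u n) x‖ ≤ Real.sqrt N * ‖f - (u n : Lp ℂ 2 gam)‖ := by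
    intro n x
    rw [hval, hF, ← inner_sub_right, ← norm_coherent hN x]
    exact norm_inner_le_norm (𝕜 := ℂ) (coherent hN x : Lp ℂ 2 gam) _
  have h0 : Tendsto (fun n => ‖f - (u n : Lp ℂ 2 gam)‖) atTop (𝓝 0) := by
    simpa using ((tendsto_const_nhds (x := f)).sub hf).norm
  refine ⟨fun z => F z * (gaussWeight N z)⁻¹, ?_, ?_⟩
  · have key : ∀ R : ℝ, DifferentiableOn ℂ (fun z => F z * (gaussWeight N z)⁻¹)
        (Metric.ball 0 R) := by
      intro R
      refine TendstoLocallyUniformlyOn.differentiableOn (φ := atTop)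
        (F := fun n z => (u n).2.choose z) ?_
        (Eventually.of_forall fun n => (u n).2.choose_spec.1.differentiableOn) Metric.isOpen_ball
      refine TendstoUniformlyOn.tendstoLocallyUniformlyOn ?_
      rw [Metric.tendstoUniformlyOn_iff]
      intro ε hε
      have h1 : Tendsto (fun n => Real.sqrt N * ‖f - (u n : Lp ℂ 2 gam)‖
          * Real.exp (N * R ^ 2 / 2)) atTop (𝓝 0) := by
        simpa using (h0.const_mul (Real.sqrt N)).mul_const (Real.exp (N * R ^ 2 / 2))
      filter_upwards [h1.eventually_lt_const hε] with n hn z hz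
      have e : (u n).2.choose z = val (u n) z * (gaussWeight N z)⁻¹ := by
        rw [val, mul_inv_cancel_right₀ (gaussWeight_ne_zero N z)]
      rw [e, dist_eq_norm, ← sub_mul, norm_mul]
      refine lt_of_le_of_lt (mul_le_mul (hb n z) ?_ (norm_nonneg _) (by positivity)) hn
      rw [gaussWeight, norm_inv, Complex.norm_real, Real.norm_of_nonneg (Real.exp_pos _).le,
        ← Real.exp_neg, neg_neg]
      have hz' : ‖z‖ < R := by simpa using hz
      gcongr
    intro z
    exact (key (‖z‖ + 1)).differentiableAt
      (Metric.isOpen_ball.mem_nhds (by simp))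
  · obtain ⟨ns, hns', hns⟩ := (tendstoInMeasure_of_tendsto_Lp hf).exists_seq_tendsto_ae
    have hall : ∀ᵐ z ∂gam, ∀ n, (u n : Lp ℂ 2 gam) z = val (u n) z :=
      ae_all_iff.2 fun n => val_ae (u n)
    filter_upwards [hns, hall] with z hz hz2
    rw [inv_mul_cancel_right₀ (gaussWeight_ne_zero N z)]
    refine tendsto_nhds_unique hz ?_
    simp only [hz2]
    refine tendsto_iff_norm_sub_tendsto_zero.2 ?_
    refine squeeze_zero (fun _ => norm_nonneg _) (fun i => ?_)
      (by simpa using (h0.const_mul (Real.sqrt N)).comp hns'.tendsto_atTop)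
    rw [norm_sub_rev]
    exact hb _ _

theorem completeSpace_fock {N : ℝ} (hN : 0 < N) : CompleteSpace (fock N) :=
  (isClosed_fock hN).completeSpace_coe

instance separableSpace_fock (N : ℝ) : TopologicalSpace.SeparableSpace (fock N) := by
  have : Fact ((1 : ℝ≥0∞) ≤ 2) := ⟨by norm_num⟩
  have : Fact ((2 : ℝ≥0∞) ≠ ⊤) := ⟨by norm_num⟩
  infer_instance

/-- The orthogonal projection of a square-integrable function on the Fock-Bargmann space. -/
theorem exists_fock_projection {N : ℝ} (hN : 0 < N) {f : ℂ → ℂ} (hf : MemLp f 2 gam) :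
    ∃ w : fock N, (∀ u : fock N, inner ℂ u w = ∫ z, conj (val u z) * f z ∂gam) ∧
      ∀ x, val w x = ∫ z, bargmannKernel N x z * f z ∂gam := by
  have := completeSpace_fock hN
  have h : ∀ u : fock N, inner ℂ u ((fock N).orthogonalProjectionOnto (hf.toLp f))
      = ∫ z, conj (val u z) * f z ∂gam := by
    intro u
    rw [Submodule.inner_orthogonalProjectionOnto_eq_of_mem_left, L2.inner_def]
    refine integral_congr_ae ?_
    filter_upwards [val_ae u, hf.coeFn_toLp] with z h1 h2
    rw [h1, h2, RCLike.inner_apply, mul_comm]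
  refine ⟨_, h, fun x => ?_⟩
  rw [← inner_coherent hN, h]
  simp only [val_coherent, conj_bargmannKernel]

/-- Every bounded sequence of a separable Hilbert space has a weakly convergent subsequence. -/
theorem exists_weak_limit {H : Type*} [NormedAddCommGroup H] [InnerProductSpace ℂ H]
    [CompleteSpace H] [TopologicalSpace.SeparableSpace H] {u : ℕ → H} {B : ℝ}
    (hu : ∀ n, ‖u n‖ ≤ B) :
    ∃ (w : H) (φ : ℕ → ℕ), StrictMono φ ∧ ‖w‖ ≤ B ∧
      ∀ v : H, Tendsto (fun n => inner ℂ v (u (φ n))) atTop (𝓝 (inner ℂ v w)) := by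
  have hs := WeakDual.isSeqCompact_closedBall ℂ H (0 : StrongDual ℂ H) B
  obtain ⟨l, hl, φ, hφ, hlim⟩ := hs (x := fun n => StrongDual.toWeakDual
    (InnerProductSpace.toDual ℂ H (u n))) (fun n => by
      rw [Set.mem_preimage, mem_closedBall_zero_iff]
      exact ((InnerProductSpace.toDual ℂ H).norm_map (u n)).trans_le (hu n))
  obtain ⟨w, hw⟩ := (InnerProductSpace.toDual ℂ H).surjective (WeakDual.toStrongDual l)
  refine ⟨w, φ, hφ, ?_, fun v => ?_⟩
  · rw [Set.mem_preimage, mem_closedBall_zero_iff, ← hw] at hl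
    exact ((InnerProductSpace.toDual ℂ H).norm_map w).symm.trans_le hl
  · have h := ((WeakDual.eval_continuous v).tendsto l).comp hlim
    have h2 := (Complex.continuous_conj.tendsto _).comp h
    have e : inner ℂ v w = conj (l v) := by
      rw [← inner_conj_symm, ← InnerProductSpace.toDual_apply_apply (𝕜 := ℂ), hw]
      rfl
    rw [e]
    exact h2.congr fun n => inner_conj_symm (𝕜 := ℂ) v (u (φ n))

/-- Point values are pairings with coherent states. Weak limits are thus pointwise limits, which
opens the way to dominated convergence and Fatou's lemma. -/
theorem tendsto_val_of_weak {N : ℝ} (hN : 0 < N) {u : ℕ → fock N} {w : fock N}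
    (h : ∀ v : fock N, Tendsto (fun n => inner ℂ v (u n)) atTop (𝓝 (inner ℂ v w))) (x : ℂ) :
    Tendsto (fun n => val (u n) x) atTop (𝓝 (val w x)) := by
  simpa only [inner_coherent] using h (coherent hN x)

end

section

/-! ### The potential -/

/-- The potential `V - μ` truncated from below at `δ`. -/
def truncation (V : ℂ → ℝ) (μ δ : ℝ) (z : ℂ) : ℝ := max (V z - μ) δ

/-- The difference of the truncated potential and `V - μ`, a non-negative function with compact
support. -/
def well (V : ℂ → ℝ) (μ δ : ℝ) (z : ℂ) : ℝ := truncation V μ δ z - (V z - μ)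

variable {V : ℂ → ℝ} {μ δ : ℝ}

theorem le_truncation (z : ℂ) : δ ≤ truncation V μ δ z := le_max_right _ _

theorem well_nonneg (z : ℂ) : 0 ≤ well V μ δ z := sub_nonneg.2 (le_max_left _ _)

namespace PotentialAssumption

theorem truncation_pos (hV : PotentialAssumption V μ δ) (z : ℂ) : 0 < truncation V μ δ z :=
  hV.pos.trans_le (le_truncation z)

theorem continuous_truncation (hV : PotentialAssumption V μ δ) :
    Continuous (truncation V μ δ) :=
  (hV.continuous.sub continuous_const).max continuous_const

theorem continuous_well (hV : PotentialAssumption V μ δ) : Continuous (well V μ δ) :=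
  hV.continuous_truncation.sub (hV.continuous.sub continuous_const)

theorem hasCompactSupport_well (hV : PotentialAssumption V μ δ) :
    HasCompactSupport (well V μ δ) := by
  refine HasCompactSupport.intro hV.compact_sublevel fun z hz => ?_
  simp only [Set.mem_ofPred_eq, not_le] at hz
  rw [well, truncation, max_eq_left (by linarith), sub_self]

theorem integrable_well (hV : PotentialAssumption V μ δ) : Integrable (well V μ δ) gam :=
  hV.continuous_well.integrable_of_hasCompactSupport hV.hasCompactSupport_well

theorem exists_well_le (hV : PotentialAssumption V μ δ) : ∃ B, 0 ≤ B ∧ ∀ z, well V μ δ z ≤ B := by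
  obtain ⟨B, hB⟩ := hV.hasCompactSupport_well.exists_bound_of_continuous hV.continuous_well
  exact ⟨B, (norm_nonneg _).trans (hB 0), fun z => (le_abs_self _).trans (hB z)⟩

/-- The log-Lipschitz bound extends to the whole plane because the truncated potential is constant,
equal to `δ`, where `V ≤ μ + δ`. A segment from outside to inside is cut where it meets `{V = μ +
δ}`. -/
theorem log_truncation_le (hV : PotentialAssumption V μ δ) : ∃ K : ℝ, 0 ≤ K ∧ ∀ x z,
    Real.log (truncation V μ δ z) ≤ Real.log (truncation V μ δ x) + K * ‖x - z‖ := by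
  obtain ⟨K, hK⟩ := hV.log_lipschitz
  have key : ∀ x z, μ + δ ≤ V x → μ + δ ≤ V z →
      |Real.log (truncation V μ δ x) - Real.log (truncation V μ δ z)| ≤ K * ‖x - z‖ := by
    intro x z hx hz
    have h := hK.dist_le_mul x hx z hz
    rw [Real.dist_eq, dist_eq_norm] at h
    rwa [truncation, truncation, max_eq_left (by linarith), max_eq_left (by linarith)]
  have mixed : ∀ x z, μ + δ ≤ V x → V z < μ + δ →
      |Real.log (truncation V μ δ x) - Real.log (truncation V μ δ z)| ≤ K * ‖x - z‖ := by
    intro x z hx hz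
    have hc : ContinuousOn (fun t : ℝ => V (AffineMap.lineMap x z t)) (Set.Icc 0 1) :=
      (hV.continuous.comp AffineMap.lineMap_continuous).continuousOn
    obtain ⟨t, ht, htV⟩ := intermediate_value_Icc' zero_le_one hc
      (show μ + δ ∈ Set.Icc _ _ by simp [hx, hz.le])
    simp only at htV
    set b : ℂ := AffineMap.lineMap x z t with hb
    have e : truncation V μ δ z = truncation V μ δ b := by
      rw [truncation, truncation, htV, max_eq_right (by linarith), max_eq_right (by linarith)]
    rw [e]
    refine (key x b hx htV.ge).trans ?_
    have hn : ‖x - b‖ = t * ‖x - z‖ := by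
      rw [← dist_eq_norm, ← dist_eq_norm, hb, dist_left_lineMap, Real.norm_of_nonneg ht.1]
    rw [hn]
    exact mul_le_mul_of_nonneg_left (mul_le_of_le_one_left (norm_nonneg _) ht.2) K.2
  refine ⟨K, K.2, fun x z => ?_⟩
  rcases le_or_gt (μ + δ) (V x) with hx | hx <;> rcases le_or_gt (μ + δ) (V z) with hz | hz
  · linarith [(abs_le.1 (key x z hx hz)).1]
  · linarith [(abs_le.1 (mixed x z hx hz)).1]
  · have h := (abs_le.1 (mixed z x hz hx)).2
    rw [norm_sub_rev] at h
    linarith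
  · rw [truncation, truncation, max_eq_right (by linarith), max_eq_right (by linarith)]
    have : (0 : ℝ) ≤ K * ‖x - z‖ := mul_nonneg K.2 (norm_nonneg _)
    linarith

/-- The usable form of the growth condition: the potential varies at most exponentially in the
distance, which the Gaussian kernel absorbs. -/
theorem truncation_le_mul_exp (hV : PotentialAssumption V μ δ) : ∃ K : ℝ, 0 ≤ K ∧ ∀ x z,
    truncation V μ δ z ≤ truncation V μ δ x * Real.exp (K * ‖x - z‖) := by
  obtain ⟨K, hK0, hK⟩ := hV.log_truncation_le
  refine ⟨K, hK0, fun x z => ?_⟩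
  have h := Real.exp_le_exp.2 (hK x z)
  rwa [Real.exp_add, Real.exp_log (hV.truncation_pos z), Real.exp_log (hV.truncation_pos x)] at h

theorem abs_le_mul_truncation (hV : PotentialAssumption V μ δ) : ∃ C : ℝ, 0 ≤ C ∧ ∀ z,
    |V z| ≤ C * truncation V μ δ z := by
  obtain ⟨B, hB0, hB⟩ := hV.exists_well_le
  refine ⟨1 + (B + |μ|) / δ, by have := hV.pos; positivity, fun z => ?_⟩
  have h1 : V z = truncation V μ δ z - well V μ δ z + μ := by rw [well]; ring
  have h2 : |V z| ≤ truncation V μ δ z + B + |μ| := by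
    rw [h1]
    refine (abs_add_le _ _).trans (add_le_add_left ((abs_sub _ _).trans ?_) _)
    rw [abs_of_pos (hV.truncation_pos z), abs_of_nonneg (well_nonneg z)]
    exact add_le_add_right (hB z) _
  have h3 : B + |μ| ≤ (B + |μ|) / δ * truncation V μ δ z := by
    rw [div_mul_eq_mul_div, le_div_iff₀ hV.pos]
    exact mul_le_mul_of_nonneg_left (le_truncation z) (by positivity)
  linarith

/-- A modulus of continuity for the potential. -/
theorem exists_modulus (hV : PotentialAssumption V μ δ) : ∃ K : ℝ, 0 ≤ K ∧ ∀ ε : ℝ, 0 < ε →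
    ∃ C : ℝ, 0 ≤ C ∧ ∀ x z, |V x - V z| ≤
      truncation V μ δ x * (K * ‖x - z‖ * Real.exp (K * ‖x - z‖)) + ε + C * ‖x - z‖ := by
  obtain ⟨K, hK0, hK⟩ := hV.truncation_le_mul_exp
  obtain ⟨B, hB0, hB⟩ := hV.exists_well_le
  refine ⟨K, hK0, fun ε hε => ?_⟩
  have huc := hV.hasCompactSupport_well.uniformContinuous_of_continuous hV.continuous_well
  obtain ⟨r, hr, hrw⟩ := Metric.uniformContinuous_iff.1 huc ε hε
  have hexp : ∀ t : ℝ, 0 ≤ t → Real.exp t - 1 ≤ t * Real.exp t := by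
    intro t _
    have := Real.add_one_le_exp (-t)
    have h2 : Real.exp (-t) * Real.exp t = 1 := by rw [← Real.exp_add]; simp
    nlinarith [Real.exp_pos t]
  have hW : ∀ x z, truncation V μ δ z - truncation V μ δ x
      ≤ truncation V μ δ x * (K * ‖x - z‖ * Real.exp (K * ‖x - z‖)) := by
    intro x z
    have h1 := hexp (K * ‖x - z‖) (by positivity)
    have h2 := mul_le_mul_of_nonneg_left h1 (hV.truncation_pos x).le
    linarith [hK x z]
  have hW' : ∀ x z, truncation V μ δ x - truncation V μ δ z
      ≤ truncation V μ δ x * (K * ‖x - z‖ * Real.exp (K * ‖x - z‖)) := by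
    intro x z
    have h1 := hK z x
    rw [norm_sub_rev] at h1
    set t := K * ‖x - z‖ with ht
    have ht0 : 0 ≤ t := by positivity
    have h2 : truncation V μ δ x * Real.exp (-t) ≤ truncation V μ δ z := by
      rw [Real.exp_neg, ← div_eq_mul_inv, div_le_iff₀ (Real.exp_pos _)]
      exact h1
    have h3 := Real.add_one_le_exp (-t)
    have h4 : t ≤ t * Real.exp t := le_mul_of_one_le_right ht0 (Real.one_le_exp ht0)
    have h5 := mul_le_mul_of_nonneg_left h3 (hV.truncation_pos x).le
    have h6 := mul_le_mul_of_nonneg_left h4 (hV.truncation_pos x).le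
    linarith
  -- Beyond the uniform continuity radius `r`, the oscillation of the well is at most `B ≤ (B / r)
  -- ‖x - z‖`.
  refine ⟨B / r, by positivity, fun x z => ?_⟩
  have hwell : |well V μ δ x - well V μ δ z| ≤ ε + B / r * ‖x - z‖ := by
    rcases lt_or_ge (dist x z) r with h | h
    · have h1 := (hrw h).le
      rw [Real.dist_eq] at h1
      have : 0 ≤ B / r * ‖x - z‖ := by positivity
      linarith
    · rw [dist_eq_norm] at h
      have h1 : B ≤ B / r * ‖x - z‖ := by
        rw [div_mul_eq_mul_div, le_div_iff₀ hr]
        exact mul_le_mul_of_nonneg_left h hB0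
      have h2 : |well V μ δ x - well V μ δ z| ≤ B := abs_sub_le_of_nonneg_of_le
        (well_nonneg x) (hB x) (well_nonneg z) (hB z)
      linarith
  have e : V x - V z = (truncation V μ δ x - truncation V μ δ z)
      - (well V μ δ x - well V μ δ z) := by rw [well, well]; ring
  rw [e]
  have habs := abs_sub (truncation V μ δ x - truncation V μ δ z) (well V μ δ x - well V μ δ z)
  have : |truncation V μ δ x - truncation V μ δ z|
      ≤ truncation V μ δ x * (K * ‖x - z‖ * Real.exp (K * ‖x - z‖)) :=
    abs_le.2 ⟨by linarith [hW x z], hW' x z⟩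
  linarith

end PotentialAssumption

end

section

/-! ### The quadratic form and the Berezin-Toeplitz operator -/

variable {V : ℂ → ℝ} {μ δ N : ℝ}

theorem continuous_val_mul {u v : fock N} : Continuous fun z => ‖val u z‖ * ‖val v z‖ :=
  (val_continuous u).norm.mul (val_continuous v).norm

/-- The domain of the quadratic form `∫ V |u|²`. -/
def formDomain (V : ℂ → ℝ) (μ δ N : ℝ) : Submodule ℂ (fock N) where
  carrier := {u | MemLp (fun z => (Real.sqrt (truncation V μ δ z) : ℂ) * val u z) 2 gam}
  zero_mem' := by simp [val_zero]
  add_mem' := by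
    intro u v hu hv
    simp only [Set.mem_ofPred_eq, val_add, mul_add] at *
    exact hu.add hv
  smul_mem' := by
    intro c u hu
    have e' : ∀ a d : ℂ, a * (c * d) = c * (a * d) := fun a d => by ring
    simp only [Set.mem_ofPred_eq, val_smul, e'] at *
    exact hu.const_mul c

theorem toeplitz_apply (u : (toeplitz N V).domain) (x : ℂ) :
    val (toeplitz N V u) x = ∫ z, bargmannKernel N x z * (V z * val (u : fock N) z) ∂gam :=
  (toeplitz_spec u).choose_spec x

namespace PotentialAssumption

theorem mem_formDomain_iff (hV : PotentialAssumption V μ δ) {u : fock N} :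
    u ∈ formDomain V μ δ N ↔ Integrable (fun z => truncation V μ δ z * ‖val u z‖ ^ 2) gam := by
  have hc : Continuous fun z => (Real.sqrt (truncation V μ δ z) : ℂ) * val u z :=
    (Complex.continuous_ofReal.comp hV.continuous_truncation.sqrt).mul (val_continuous u)
  have h := memLp_two_iff_integrable_sq_norm (μ := gam) hc.aestronglyMeasurable
  have e : ∀ z, ‖(Real.sqrt (truncation V μ δ z) : ℂ) * val u z‖ ^ 2
      = truncation V μ δ z * ‖val u z‖ ^ 2 := fun z => by
    rw [norm_mul, mul_pow, Complex.norm_real, Real.norm_eq_abs, sq_abs,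
      Real.sq_sqrt (hV.truncation_pos z).le]
  simp only [e] at h
  exact h

theorem integrable_truncation_mul (hV : PotentialAssumption V μ δ) {u v : fock N}
    (hu : u ∈ formDomain V μ δ N) (hv : v ∈ formDomain V μ δ N) :
    Integrable (fun z => truncation V μ δ z * (‖val u z‖ * ‖val v z‖)) gam := by
  rw [hV.mem_formDomain_iff] at hu hv
  refine (hu.add hv).mono' (hV.continuous_truncation.mul continuous_val_mul).aestronglyMeasurable
    (Eventually.of_forall fun z => ?_)
  have hp := hV.truncation_pos z
  rw [Real.norm_of_nonneg (by positivity), Pi.add_apply, ← mul_add]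
  refine mul_le_mul_of_nonneg_left ?_ hp.le
  nlinarith [two_mul_le_add_sq ‖val u z‖ ‖val v z‖, norm_nonneg (val u z), norm_nonneg (val v z)]

/-- Multiplication of form domain elements by a weight dominated by the potential. -/
theorem integrable_weight_mul (hV : PotentialAssumption V μ δ) {G : ℂ → ℝ} (hG : Continuous G)
    {C : ℝ} (hC : ∀ z, |G z| ≤ C * truncation V μ δ z) {u v : fock N}
    (hu : u ∈ formDomain V μ δ N) (hv : v ∈ formDomain V μ δ N) :
    Integrable (fun z => conj (val u z) * (G z * val v z)) gam := by
  have hc : Continuous fun z => conj (val u z) * (G z * val v z) :=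
    (Complex.continuous_conj.comp (val_continuous u)).mul
      ((Complex.continuous_ofReal.comp hG).mul (val_continuous v))
  refine ((hV.integrable_truncation_mul hu hv).const_mul C).mono' hc.aestronglyMeasurable
    (Eventually.of_forall fun z => ?_)
  rw [norm_mul, norm_mul, RCLike.norm_conj, Complex.norm_real, Real.norm_eq_abs]
  calc ‖val u z‖ * (|G z| * ‖val v z‖) = |G z| * (‖val u z‖ * ‖val v z‖) := by ring
    _ ≤ C * truncation V μ δ z * (‖val u z‖ * ‖val v z‖) :=
      mul_le_mul_of_nonneg_right (hC z) (by positivity)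
    _ = _ := by ring

theorem coherent_mem_formDomain (hV : PotentialAssumption V μ δ) (hN : 0 < N) (x : ℂ) :
    coherent hN x ∈ formDomain V μ δ N := by
  obtain ⟨K, hK0, hK⟩ := hV.truncation_le_mul_exp
  rw [hV.mem_formDomain_iff, val_coherent]
  refine ((integrable_exp_translate K hN x).const_mul (truncation V μ δ x * N ^ 2)).mono'
    (hV.continuous_truncation.mul
      ((continuous_bargmannKernel_left N x).norm.pow 2)).aestronglyMeasurable
    (Eventually.of_forall fun z => ?_)
  have hp := hV.truncation_pos z
  rw [Real.norm_of_nonneg (by positivity), norm_bargmannKernel hN.le, mul_pow,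
    ← Real.exp_nat_mul, sub_eq_add_neg (_ * _) (_ * _), Real.exp_add, norm_sub_rev z x]
  have e : ((2 : ℕ) : ℝ) * -(N / 2 * ‖x - z‖ ^ 2) = -(N * ‖x - z‖ ^ 2) := by push_cast; ring
  rw [e]
  calc _ ≤ (truncation V μ δ x * Real.exp (K * ‖x - z‖))
        * (N ^ 2 * Real.exp (-(N * ‖x - z‖ ^ 2))) :=
      mul_le_mul_of_nonneg_right (hK x z) (by positivity)
    _ = _ := by ring

theorem memLp_mul_coherent (hV : PotentialAssumption V μ δ) (hN : 0 < N) (x : ℂ) :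
    MemLp (fun z => (V z : ℂ) * bargmannKernel N z x) 2 gam := by
  obtain ⟨K, hK0, hK⟩ := hV.truncation_le_mul_exp
  obtain ⟨C, hC0, hC⟩ := hV.abs_le_mul_truncation
  have hc : Continuous fun z => (V z : ℂ) * bargmannKernel N z x :=
    (Complex.continuous_ofReal.comp hV.continuous).mul (continuous_bargmannKernel_left N x)
  refine (memLp_two_iff_integrable_sq_norm hc.aestronglyMeasurable).2 ?_
  refine ((integrable_exp_translate (2 * K) hN x).const_mul
    ((C * truncation V μ δ x) ^ 2 * N ^ 2)).mono' (hc.norm.pow 2).aestronglyMeasurable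
    (Eventually.of_forall fun z => ?_)
  have hp := hV.truncation_pos z
  rw [Real.norm_of_nonneg (by positivity), norm_mul, norm_bargmannKernel hN.le, mul_pow, mul_pow,
    ← Real.exp_nat_mul, sub_eq_add_neg (_ * _) (_ * _), Real.exp_add, norm_sub_rev z x, Complex.norm_real,
    Real.norm_eq_abs]
  have e : ((2 : ℕ) : ℝ) * -(N / 2 * ‖x - z‖ ^ 2) = -(N * ‖x - z‖ ^ 2) := by push_cast; ring
  have e2 : Real.exp (2 * K * ‖x - z‖) = Real.exp (K * ‖x - z‖) ^ 2 := by
    rw [← Real.exp_nat_mul]; congr 1; push_cast; ring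
  rw [e, e2]
  have h1 : |V z| ≤ C * (truncation V μ δ x * Real.exp (K * ‖x - z‖)) :=
    (hC z).trans (mul_le_mul_of_nonneg_left (hK x z) hC0)
  calc _ ≤ (C * (truncation V μ δ x * Real.exp (K * ‖x - z‖))) ^ 2
        * (N ^ 2 * Real.exp (-(N * ‖x - z‖ ^ 2))) :=
      mul_le_mul_of_nonneg_right (pow_le_pow_left₀ (abs_nonneg _) h1 2) (by positivity)
    _ = _ := by ring

theorem abs_le_truncation_add (hV : PotentialAssumption V μ δ) (c : ℝ) :
    ∃ C : ℝ, ∀ z, |V z - c| ≤ C * truncation V μ δ z := by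
  obtain ⟨C, hC0, hC⟩ := hV.abs_le_mul_truncation
  refine ⟨C + |c| / δ, fun z => (abs_sub _ _).trans ?_⟩
  rw [add_mul]
  refine add_le_add (hC z) ?_
  rw [div_mul_eq_mul_div, le_div_iff₀ hV.pos]
  exact mul_le_mul_of_nonneg_left (le_truncation z) (abs_nonneg _)

theorem memLp_sqrt_abs (hV : PotentialAssumption V μ δ) {u : fock N}
    (hu : u ∈ formDomain V μ δ N) : MemLp (fun z => (Real.sqrt |V z| : ℂ) * val u z) 2 gam := by
  obtain ⟨C, hC0, hC⟩ := hV.abs_le_mul_truncation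
  have hc : Continuous fun z => (Real.sqrt |V z| : ℂ) * val u z :=
    (Complex.continuous_ofReal.comp hV.continuous.abs.sqrt).mul (val_continuous u)
  refine (memLp_two_iff_integrable_sq_norm hc.aestronglyMeasurable).2 ?_
  refine ((hV.mem_formDomain_iff.1 hu).const_mul C).mono' (hc.norm.pow 2).aestronglyMeasurable
    (Eventually.of_forall fun z => ?_)
  rw [Real.norm_of_nonneg (by positivity), norm_mul, mul_pow, Complex.norm_real,
    Real.norm_eq_abs, sq_abs, Real.sq_sqrt (abs_nonneg _), ← mul_assoc]
  exact mul_le_mul_of_nonneg_right (hC z) (by positivity)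

/-- The operator domain is defined with the weight `|V|` and the form domain with the truncated
potential; they are comparable, since `truncation ≤ |V| + |μ| + B` where `B` bounds the well. -/
theorem domain_le_formDomain (hV : PotentialAssumption V μ δ) {u : fock N}
    (hu : u ∈ (toeplitz N V).domain) : u ∈ formDomain V μ δ N := by
  obtain ⟨B, hB0, hB⟩ := hV.exists_well_le
  have hc : Continuous fun z => (Real.sqrt |V z| : ℂ) * val u z :=
    (Complex.continuous_ofReal.comp hV.continuous.abs.sqrt).mul (val_continuous u)
  have h1 := (memLp_two_iff_integrable_sq_norm hc.aestronglyMeasurable).1 hu.1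
  have h2 := (memLp_two_iff_integrable_sq_norm (val_continuous u).aestronglyMeasurable).1
    (memLp_val u)
  rw [hV.mem_formDomain_iff]
  refine (h1.add (h2.const_mul (|μ| + B))).mono'
    (hV.continuous_truncation.mul ((val_continuous u).norm.pow 2)).aestronglyMeasurable
    (Eventually.of_forall fun z => ?_)
  have hp := hV.truncation_pos z
  rw [Real.norm_of_nonneg (by positivity), Pi.add_apply, norm_mul, mul_pow, Complex.norm_real,
    Real.norm_eq_abs, sq_abs, Real.sq_sqrt (abs_nonneg _), ← add_mul]
  refine mul_le_mul_of_nonneg_right ?_ (by positivity)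
  have h3 := hB z
  rw [well] at h3
  linarith [le_abs_self (V z), neg_abs_le μ]

/-- A weak form of membership to the operator domain. -/
theorem mem_domain_of_formDomain (hV : PotentialAssumption V μ δ) (hN : 0 < N) {u w : fock N}
    (hu : u ∈ formDomain V μ δ N)
    (hw : ∀ x, val w x = ∫ z, bargmannKernel N x z * (V z * val u z) ∂gam) :
    ∃ h : u ∈ (toeplitz N V).domain, toeplitz N V ⟨u, h⟩ = w := by
  obtain ⟨C, hC0, hC⟩ := hV.abs_le_mul_truncation
  have h : u ∈ (toeplitz N V).domain := by
    refine ⟨hV.memLp_sqrt_abs hu, fun x => ?_, w, hw⟩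
    have := hV.integrable_weight_mul hV.continuous hC (hV.coherent_mem_formDomain hN x) hu
    simpa only [val_coherent, conj_bargmannKernel] using this
  refine ⟨h, val_injective (funext fun x => ?_)⟩
  rw [toeplitz_apply, hw]

/-- `V k_x` is square-integrable, so its orthogonal projection on the Fock space serves as `H_N
k_x`. The pairing formula then holds against every `u`, without a form domain condition. -/
theorem coherent_mem_domain (hV : PotentialAssumption V μ δ) (hN : 0 < N) (x : ℂ) :
    ∃ h : coherent hN x ∈ (toeplitz N V).domain, ∀ u : fock N,
      inner ℂ u (toeplitz N V ⟨coherent hN x, h⟩)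
        = ∫ z, conj (val u z) * (V z * bargmannKernel N z x) ∂gam := by
  obtain ⟨w, hw, hw'⟩ := exists_fock_projection hN (hV.memLp_mul_coherent hN x)
  obtain ⟨h, e⟩ := hV.mem_domain_of_formDomain hN (hV.coherent_mem_formDomain hN x) (w := w)
    (by simpa only [val_coherent] using hw')
  refine ⟨h, fun u => ?_⟩
  rw [e, hw]

/-- The absolute convergence that permits Fubini in `inner_toeplitz`. Splitting `|u(x)| |v(z)|` into
squares and moving the truncated potential from `z` to `x` at the cost of `exp (K ‖x - z‖)` leaves
two convolution integrands of integrable functions. -/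
theorem integrable_kernel_prod (hV : PotentialAssumption V μ δ) (hN : 0 < N) {u v : fock N}
    (hu : u ∈ formDomain V μ δ N) (hv : v ∈ formDomain V μ δ N) :
    Integrable (fun p : ℂ × ℂ => conj (val u p.1) *
      (bargmannKernel N p.1 p.2 * (V p.2 * val v p.2))) (gam.prod gam) := by
  obtain ⟨K, hK0, hK⟩ := hV.truncation_le_mul_exp
  obtain ⟨C, hC0, hC⟩ := hV.abs_le_mul_truncation
  have hk := integrable_exp_linear_sub_sq K (half_pos hN)
  have h1 := ((hV.mem_formDomain_iff.1 hu).convolution_integrand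
    (ContinuousLinearMap.mul ℝ ℝ) hk).swap
  have h2 := (hV.mem_formDomain_iff.1 hv).convolution_integrand (ContinuousLinearMap.mul ℝ ℝ) hk
  have hc : Continuous fun p : ℂ × ℂ => conj (val u p.1) *
      (bargmannKernel N p.1 p.2 * (V p.2 * val v p.2)) := by
    have h3 := (val_continuous u).comp continuous_fst (X := ℂ × ℂ)
    have h4 := (val_continuous v).comp continuous_snd (X := ℂ × ℂ)
    have h5 := hV.continuous.comp continuous_snd (X := ℂ × ℂ)
    exact (Complex.continuous_conj.comp h3).mul ((continuous_bargmannKernel N).mul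
      ((Complex.continuous_ofReal.comp h5).mul h4))
  refine ((h1.add h2).const_mul (N * C)).mono' hc.aestronglyMeasurable
    (Eventually.of_forall fun ⟨x, z⟩ => ?_)
  simp only [Pi.add_apply, Function.comp_apply, Prod.fst_swap, Prod.snd_swap,
    ContinuousLinearMap.mul_apply']
  rw [norm_mul, norm_mul, norm_mul, RCLike.norm_conj, norm_bargmannKernel hN.le,
    Complex.norm_real, Real.norm_eq_abs, norm_sub_rev z x]
  set a := ‖val u x‖ with ha
  set b := ‖val v z‖ with hb
  set t := ‖x - z‖ with ht
  have ha0 : 0 ≤ a := norm_nonneg _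
  have hb0 : 0 ≤ b := norm_nonneg _
  have hWx := (hV.truncation_pos x).le
  have hWz := (hV.truncation_pos z).le
  have e1 : Real.exp (K * t - N / 2 * t ^ 2)
      = Real.exp (K * t) * Real.exp (-(N / 2 * t ^ 2)) := by rw [← Real.exp_add, sub_eq_add_neg]
  rw [e1]
  set E := Real.exp (-(N / 2 * t ^ 2))
  have hE : 0 < E := Real.exp_pos _
  have hexp : 1 ≤ Real.exp (K * t) := Real.one_le_exp (mul_nonneg hK0 (norm_nonneg _))
  have h6 : truncation V μ δ z * (a * b) ≤
      truncation V μ δ x * a ^ 2 * Real.exp (K * t) + truncation V μ δ z * b ^ 2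
        * Real.exp (K * t) := by
    have h7 : a * b ≤ a ^ 2 + b ^ 2 := by nlinarith [two_mul_le_add_sq a b]
    have h8 := mul_le_mul_of_nonneg_left h7 hWz
    have h9 := mul_le_mul_of_nonneg_right (hK x z) (sq_nonneg a)
    have h10 := mul_le_mul_of_nonneg_left hexp (mul_nonneg hWz (sq_nonneg b))
    linarith
  calc a * (N * E * (|V z| * b)) = N * E * (a * b) * |V z| := by ring
    _ ≤ N * E * (a * b) * (C * truncation V μ δ z) :=
      mul_le_mul_of_nonneg_left (hC z) (by positivity)
    _ = N * C * E * (truncation V μ δ z * (a * b)) := by ring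
    _ ≤ N * C * E * (truncation V μ δ x * a ^ 2 * Real.exp (K * t)
        + truncation V μ δ z * b ^ 2 * Real.exp (K * t)) :=
      mul_le_mul_of_nonneg_left h6 (by positivity)
    _ = _ := by ring

/-- The Berezin-Toeplitz operator is the operator of the quadratic form `∫ V |u|²`. -/
theorem inner_toeplitz (hV : PotentialAssumption V μ δ) (hN : 0 < N) {u : fock N}
    (hu : u ∈ formDomain V μ δ N) (v : (toeplitz N V).domain) :
    inner ℂ u (toeplitz N V v) = ∫ z, conj (val u z) * (V z * val (v : fock N) z) ∂gam := by
  have hi := hV.integrable_kernel_prod hN hu (hV.domain_le_formDomain v.2)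
  rw [inner_eq_integral]
  simp only [toeplitz_apply, ← integral_const_mul]
  rw [integral_integral_swap (f := fun x z => conj (val u x) *
      (bargmannKernel N x z * (V z * val (v : fock N) z))) hi]
  refine integral_congr_ae (Eventually.of_forall fun z => ?_)
  simp only
  have e : ∀ x, conj (val u x) * (bargmannKernel N x z * (V z * val (v : fock N) z))
      = conj (bargmannKernel N z x * val u x) * (V z * val (v : fock N) z) := fun x => by
    rw [map_mul, conj_bargmannKernel]; ring
  simp only [e, integral_mul_const, integral_conj, integral_bargmannKernel_mul_val hN]

theorem toeplitz_symmetric (hV : PotentialAssumption V μ δ) (hN : 0 < N)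
    (u v : (toeplitz N V).domain) :
    inner ℂ (u : fock N) (toeplitz N V v) = inner ℂ (toeplitz N V u) (v : fock N) := by
  rw [← inner_conj_symm (toeplitz N V u), hV.inner_toeplitz hN (hV.domain_le_formDomain u.2) v,
    hV.inner_toeplitz hN (hV.domain_le_formDomain v.2) u, ← integral_conj]
  refine integral_congr_ae (Eventually.of_forall fun z => ?_)
  simp only [map_mul, Complex.conj_conj, Complex.conj_ofReal]
  ring

/-- The domain contains all coherent states, and a vector orthogonal to them vanishes at every
point. -/
theorem dense_domain (hV : PotentialAssumption V μ δ) (hN : 0 < N) :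
    Dense ((toeplitz N V).domain : Set (fock N)) := by
  have := completeSpace_fock hN
  rw [Submodule.dense_iff_topologicalClosure_eq_top, Submodule.topologicalClosure_eq_top_iff,
    Submodule.eq_bot_iff]
  intro u hu
  exact eq_zero_of_inner_coherent hN fun x => hu _ (hV.coherent_mem_domain hN x).1

end PotentialAssumption

end

section

/-! ### Spectral projections of finite rank -/

section Abstract

variable {H : Type*} [NormedAddCommGroup H] [InnerProductSpace ℂ H] {T : H →ₗ.[ℂ] H} {μ : ℝ}

/-- An invariant subspace of the domain of `T` on which `T ≤ μ`. -/
def IsLowSubspace (T : H →ₗ.[ℂ] H) (μ : ℝ) (E : Submodule ℂ H) : Prop :=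
  ∀ u ∈ E, ∃ h : u ∈ T.domain, T ⟨u, h⟩ ∈ E ∧ (inner ℂ u (T ⟨u, h⟩)).re ≤ μ * ‖u‖ ^ 2

theorem isLowSubspace_bot : IsLowSubspace T μ ⊥ := by
  intro u hu
  rw [Submodule.mem_bot] at hu
  subst hu
  refine ⟨T.domain.zero_mem, ?_, by simp⟩
  rw [Submodule.mem_bot]
  exact T.map_zero

/-- Invariance of `E` and the eigenvalue equation make all cross terms between `E` and `u` vanish,
so both the form and the squared norm are additive. -/
theorem IsLowSubspace.sup_span {E : Submodule ℂ H} (hE : IsLowSubspace T μ E)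
    {u : H} (hu : u ∈ T.domain) (hort : ∀ e ∈ E, inner ℂ e u = 0) {l : ℝ} (hl : l ≤ μ)
    (hTu : T ⟨u, hu⟩ = (l : ℂ) • u) : IsLowSubspace T μ (E ⊔ ℂ ∙ u) := by
  intro v hv
  obtain ⟨e, he, w, hw, rfl⟩ := Submodule.mem_sup.1 hv
  obtain ⟨c, rfl⟩ := Submodule.mem_span_singleton.1 hw
  obtain ⟨hed, heE, hele⟩ := hE e he
  have hcd := T.domain.smul_mem c hu
  have hadd : T ⟨e + c • u, T.domain.add_mem hed hcd⟩ = T ⟨e, hed⟩ + (c * l) • u := by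
    have h1 := T.map_add ⟨e, hed⟩ (c • ⟨u, hu⟩)
    rw [T.map_smul, hTu, smul_smul] at h1
    exact h1
  refine ⟨T.domain.add_mem hed hcd, ?_, ?_⟩
  · rw [hadd]
    exact Submodule.add_mem_sup heE (Submodule.smul_mem _ _ (Submodule.mem_span_singleton_self u))
  · have h1 : inner ℂ e u = 0 := hort e he
    have h2 : inner ℂ u e = 0 := inner_eq_zero_symm.1 h1
    have h3 : inner ℂ u (T ⟨e, hed⟩) = 0 := inner_eq_zero_symm.1 (hort _ heE)
    have h4 : ‖e + c • u‖ ^ 2 = ‖e‖ ^ 2 + ‖c‖ ^ 2 * ‖u‖ ^ 2 := by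
      have := norm_add_sq_eq_norm_sq_add_norm_sq_of_inner_eq_zero e (c • u)
        (by rw [inner_smul_right, h1, mul_zero] : inner ℂ e (c • u) = 0)
      rw [sq, this, norm_smul]
      ring
    have h5 : inner ℂ (e + c • u) (T ⟨e, hed⟩ + (c * l) • u)
        = inner ℂ e (T ⟨e, hed⟩) + ((l * (‖c‖ ^ 2 * ‖u‖ ^ 2) : ℝ) : ℂ) := by
      simp only [inner_add_left, inner_add_right, inner_smul_left, inner_smul_right, h1, h3,
        inner_self_eq_norm_sq_to_K]
      push_cast
      rw [← Complex.conj_mul']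
      simp only [Complex.coe_algebraMap]
      ring
    rw [hadd, h5, h4, Complex.add_re, Complex.ofReal_re]
    have : l * (‖c‖ ^ 2 * ‖u‖ ^ 2) ≤ μ * (‖c‖ ^ 2 * ‖u‖ ^ 2) :=
      mul_le_mul_of_nonneg_right hl (by positivity)
    linarith

/-- Existence of the spectral projection, if the invariant subspaces on which `T ≤ μ` have bounded
dimension, and if the quadratic form of `T` cannot go below `μ` on the orthogonal complement of
such a subspace unless there is an eigenvector in this complement. -/
theorem exists_isSpectralProjection
    (hsym : ∀ u v : T.domain, inner ℂ (u : H) (T v) = inner ℂ (T u) (v : H))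
    {n : ℕ} (hdim : ∀ E : Submodule ℂ H, FiniteDimensional ℂ E → IsLowSubspace T μ E →
      Module.finrank ℂ E ≤ n)
    (hmin : ∀ E : Submodule ℂ H, FiniteDimensional ℂ E → IsLowSubspace T μ E →
      ∀ u : T.domain, (u : H) ≠ 0 → (∀ e ∈ E, inner ℂ e (u : H) = 0) →
      (inner ℂ (u : H) (T u)).re ≤ μ * ‖(u : H)‖ ^ 2 →
      ∃ w : T.domain, (w : H) ≠ 0 ∧ (∀ e ∈ E, inner ℂ e (w : H) = 0) ∧
        ∃ l : ℝ, l ≤ μ ∧ T w = (l : ℂ) • (w : H)) :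
    ∃ P : H →L[ℂ] H, IsSpectralProjection T μ P ∧ ∃ E : Submodule ℂ H,
      FiniteDimensional ℂ E ∧ IsLowSubspace T μ E ∧ LinearMap.range (P : H →ₗ[ℂ] H) = E := by
  set S : Set ℕ := {d | ∃ E : Submodule ℂ H, FiniteDimensional ℂ E ∧ IsLowSubspace T μ E ∧
    Module.finrank ℂ E = d} with hS
  have hSne : S.Nonempty := ⟨_, ⊥, inferInstance, isLowSubspace_bot, rfl⟩
  have hSb : BddAbove S := ⟨n, by rintro d ⟨E, h1, h2, rfl⟩; exact hdim E h1 h2⟩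
  -- A low subspace of maximal dimension; an eigenvector in its complement with eigenvalue at most
  -- `μ` could be adjoined to it.
  obtain ⟨E, hEfd, hE, hEd⟩ := Nat.sSup_mem hSne hSb
  refine ⟨E.starProjection, ⟨E.isSymmetricProjection_starProjection, fun u => ?_, fun u hu => ?_,
    fun u hu hu0 => ?_⟩, E, hEfd, hE, E.range_starProjection⟩
  · obtain ⟨hd, hTE, -⟩ := hE _ (E.starProjection_apply_mem u)
    refine ⟨hd, ?_⟩
    -- By symmetry, `T (u - P u)` is orthogonal to `e` because `T e` stays in `E` and `u - P u` is
    -- orthogonal to `E`.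
    refine E.eq_starProjection_of_mem_of_inner_eq_zero hTE (fun e he => ?_) |>.symm
    obtain ⟨hed, heE, -⟩ := hE e he
    have h1 := T.map_sub u ⟨_, hd⟩
    rw [← h1, ← inner_conj_symm, hsym ⟨e, hed⟩, ← inner_conj_symm, RCLike.conj_conj]
    simpa using E.starProjection_inner_eq_zero (u : H) _ heE
  · exact (hE u (E.starProjection_eq_self_iff.1 hu)).2.2
  · by_contra hcon
    rw [not_lt] at hcon
    have hort : ∀ e ∈ E, inner ℂ e (u : H) = 0 := fun e he =>
      (E.starProjection_apply_eq_zero_iff.1 hu) e he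
    obtain ⟨w, hw0, hwE, l, hl, hTw⟩ := hmin E hEfd hE u hu0 hort hcon
    have hlow := hE.sup_span w.2 hwE hl hTw
    have hlt : E < E ⊔ ℂ ∙ (w : H) := by
      refine lt_of_le_of_ne le_sup_left fun h => hw0 ?_
      have hwm : (w : H) ∈ E := by
        rw [h]; exact Submodule.mem_sup_right (Submodule.mem_span_singleton_self _)
      exact inner_self_eq_zero.1 (hwE _ hwm)
    have h1 := Submodule.finrank_lt_finrank_of_lt hlt
    have h2 : Module.finrank ℂ ↥(E ⊔ ℂ ∙ (w : H)) ≤ sSup S :=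
      le_csSup hSb ⟨_, inferInstance, hlow, rfl⟩
    omega

theorem IsSpectralProjection.apply_apply {P : H →L[ℂ] H} (hP : IsSpectralProjection T μ P)
    (u : H) : P (P u) = P u :=
  LinearMap.congr_fun hP.projection.isIdempotentElem u

theorem IsSpectralProjection.inner_apply {P : H →L[ℂ] H} (hP : IsSpectralProjection T μ P)
    (u v : H) : inner ℂ (P u) v = inner ℂ u (P v) :=
  hP.projection.isSymmetric u v

/-- The complement of a spectral projection commutes with the operator. -/
theorem IsSpectralProjection.sub_commutes {P : H →L[ℂ] H} (hP : IsSpectralProjection T μ P)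
    (u : T.domain) : ∃ h : (u : H) - P u ∈ T.domain, T ⟨u - P u, h⟩ = T u - P (T u) := by
  obtain ⟨h, e⟩ := hP.commutes u
  refine ⟨T.domain.sub_mem u.2 h, ?_⟩
  rw [← e]
  exact T.map_sub u ⟨_, h⟩

/-- Uniqueness of a spectral projection of finite rank. -/
theorem IsSpectralProjection.unique (hd : Dense (T.domain : Set H)) {P P' : H →L[ℂ] H}
    (hP : IsSpectralProjection T μ P) (hP' : IsSpectralProjection T μ P') {E : Submodule ℂ H}
    [FiniteDimensional ℂ E] (hE : IsLowSubspace T μ E)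
    (hPE : LinearMap.range (P : H →ₗ[ℂ] H) = E) : P' = P := by
  have hPmem : ∀ u, P u ∈ E := fun u => hPE ▸ LinearMap.mem_range_self (P : H →ₗ[ℂ] H) u
  have hPfix : ∀ e ∈ E, P e = e := by
    intro e he
    rw [← hPE] at he
    obtain ⟨u, rfl⟩ := he
    exact hP.apply_apply u
  set Q : H →ₗ[ℂ] H := LinearMap.id - (P' : H →ₗ[ℂ] H) with hQ
  have hQu : ∀ u, Q u = u - P' u := fun u => rfl
  have hP'Q : ∀ u, P' (Q u) = 0 := fun u => by
    rw [hQu, map_sub, hP'.apply_apply, sub_self]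
  have hQcomm : ∀ u : T.domain, ∃ h : Q u ∈ T.domain, T ⟨Q u, h⟩ = Q (T u) :=
    fun u => hP'.sub_commutes u
  -- The image of `E` under `Q = 1 - P'` is finite-dimensional and `T`-invariant. If non-zero, it
  -- contains an eigenvector `f`, whose eigenvalue exceeds `μ` because `P' f = 0`. Then `P f = 0`,
  -- as `P f` would otherwise be an eigenvector with the same eigenvalue in the low range. Hence `f
  -- = e - P' e` is orthogonal both to `e` and to `P' e`, so `f = 0`.
  have hEQ : E.map Q = ⊥ := by
    by_contra hne
    have hnt : Nontrivial (E.map Q) := (Submodule.nontrivial_iff_ne_bot).2 hne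
    have hdom : E.map Q ≤ T.domain := by
      rintro _ ⟨e, he, rfl⟩
      exact (hQcomm ⟨e, (hE e he).1⟩).1
    set S : Module.End ℂ (E.map Q) := LinearMap.codRestrict (E.map Q)
      (T.toFun ∘ₗ Submodule.inclusion hdom) (by
        rintro ⟨_, e, he, rfl⟩
        obtain ⟨h, hT⟩ := hQcomm ⟨e, (hE e he).1⟩
        change T ⟨Q e, h⟩ ∈ _
        rw [hT]
        exact Submodule.mem_map_of_mem (hE e he).2.1) with hSdef
    obtain ⟨c, hc⟩ := Module.End.exists_eigenvalue S
    obtain ⟨f, hf⟩ := hc.exists_hasEigenvector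
    have hf0 : (f : H) ≠ 0 := fun h => hf.2 (Subtype.ext h)
    have hTf : T ⟨f, hdom f.2⟩ = c • (f : H) := congrArg Subtype.val hf.apply_eq_smul
    have hP'f : P' (f : H) = 0 := by
      obtain ⟨e, he, h⟩ := f.2
      rw [← h, hP'Q]
    have hgt := hP'.gt_on_ker ⟨f, hdom f.2⟩ hP'f hf0
    rw [hTf, inner_smul_right, inner_self_eq_norm_sq_to_K] at hgt
    have hcr : ∀ v : H, (c * ((‖v‖ : ℝ) : ℂ) ^ 2).re = c.re * ‖v‖ ^ 2 := fun v => by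
      rw [← Complex.ofReal_pow, Complex.re_mul_ofReal]
    have hμc : μ < c.re := by
      have h1 : μ * ‖(f : H)‖ ^ 2 < c.re * ‖(f : H)‖ ^ 2 := by
        rw [← hcr]; exact hgt
      exact lt_of_mul_lt_mul_right h1 (by positivity)
    have hPf : P (f : H) = 0 := by
      by_contra hPf0
      obtain ⟨h, hT⟩ := hP.commutes ⟨f, hdom f.2⟩
      have hle := hP.le_on_range ⟨P f, h⟩ (hP.apply_apply f)
      simp only at hle hT
      rw [hT, hTf, map_smul, inner_smul_right, inner_self_eq_norm_sq_to_K] at hle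
      have h1 : c.re * ‖P (f : H)‖ ^ 2 ≤ μ * ‖P (f : H)‖ ^ 2 := by
        rw [← hcr]; exact hle
      have h2 : 0 < ‖P (f : H)‖ ^ 2 := by have := norm_pos_iff.2 hPf0; positivity
      have := le_of_mul_le_mul_right h1 h2
      linarith
    refine hf0 ?_
    obtain ⟨e, he, h⟩ := f.2
    have h1 : inner ℂ (f : H) e = 0 := by
      rw [← hPfix e he, ← hP.inner_apply, hPf, inner_zero_left]
    have h2 : inner ℂ (f : H) (P' e) = 0 := by
      rw [← hP'.inner_apply, hP'f, inner_zero_left]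
    have h3 : inner ℂ (f : H) (Q e) = 0 := by rw [hQu, inner_sub_right, h1, h2, sub_zero]
    rw [h] at h3
    exact inner_self_eq_zero.1 h3
  have hP'fix : ∀ e ∈ E, P' e = e := by
    intro e he
    have h : Q e ∈ E.map Q := Submodule.mem_map_of_mem he
    rw [hEQ, Submodule.mem_bot, hQu, sub_eq_zero] at h
    exact h.symm
  -- Since `P'` fixes `E`, `P u = 0` implies `P P' u = 0`. A non-zero `P' u` would then have energy
  -- both above `μ` (kernel of `P`) and at most `μ` (range of `P'`).
  have hzero : ∀ u : T.domain, P (u : H) = 0 → P' (u : H) = 0 := by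
    intro u hu
    obtain ⟨h, hT⟩ := hP'.commutes u
    have hPP' : P (P' (u : H)) = 0 := by
      have h1 : inner ℂ (P (P' (u : H))) (P (P' (u : H))) = 0 := by
        rw [← hP.inner_apply, hP.apply_apply, ← hP'.inner_apply, hP'fix _ (hPmem _),
          hP.inner_apply, hu, inner_zero_right]
      exact inner_self_eq_zero.1 h1
    by_contra hne
    have h1 := hP.gt_on_ker ⟨P' u, h⟩ hPP' hne
    have h2 := hP'.le_on_range ⟨P' u, h⟩ (hP'.apply_apply _)
    exact absurd h1 (not_lt.2 h2)
  -- On the dense domain, `u = P u + (u - P u)`: `P'` fixes the first part and kills the second.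
  refine ContinuousLinearMap.ext_on (s := (T.domain : Set H)) ?_ ?_
  · rw [Submodule.span_eq]
    exact hd
  · intro u hu
    obtain ⟨h, -⟩ := hP.sub_commutes ⟨u, hu⟩
    have h1 := hzero ⟨u - P u, h⟩ (by simp [hP.apply_apply])
    rw [map_sub, hP'fix _ (hPmem u), sub_eq_zero] at h1
    exact h1

end Abstract

end

section

/-! ### The quadratic form near the bottom of the spectrum -/

variable {V : ℂ → ℝ} {μ δ N : ℝ}

/-- The quadratic form of `H_N - μ`. -/
def energy (V : ℂ → ℝ) (μ : ℝ) (u : fock N) : ℝ := ∫ z, (V z - μ) * ‖val u z‖ ^ 2 ∂gam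

theorem energy_smul (c : ℂ) (u : fock N) : energy V μ (c • u) = ‖c‖ ^ 2 * energy V μ u := by
  rw [energy, energy, ← integral_const_mul]
  refine integral_congr_ae (Eventually.of_forall fun z => ?_)
  simp only [val_smul, norm_mul]
  ring

theorem re_integral_eq_energy (c : ℝ) (u : fock N) :
    (∫ z, conj (val u z) * ((V z - c : ℝ) * val u z) ∂gam).re = energy V c u := by
  have e : ∀ z, conj (val u z) * ((V z - c : ℝ) * val u z)
      = (((V z - c) * ‖val u z‖ ^ 2 : ℝ) : ℂ) := fun z => by
    push_cast
    rw [← Complex.conj_mul']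
    ring
  simp only [e, integral_complex_ofReal, Complex.ofReal_re, energy]

namespace PotentialAssumption

theorem integrable_well_mul (hV : PotentialAssumption V μ δ) (u : fock N) :
    Integrable (fun z => well V μ δ z * ‖val u z‖ ^ 2) gam :=
  (hV.continuous_well.mul ((val_continuous u).norm.pow 2)).integrable_of_hasCompactSupport
    hV.hasCompactSupport_well.mul_right

theorem energy_eq (hV : PotentialAssumption V μ δ) {u : fock N} (hu : u ∈ formDomain V μ δ N) :
    energy V μ u = ∫ z, truncation V μ δ z * ‖val u z‖ ^ 2 ∂gam
      - ∫ z, well V μ δ z * ‖val u z‖ ^ 2 ∂gam := by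
  rw [← integral_sub (hV.mem_formDomain_iff.1 hu) (hV.integrable_well_mul u), energy]
  refine integral_congr_ae (Eventually.of_forall fun z => ?_)
  simp only [well]
  ring

theorem norm_sq_le_integral_truncation (hV : PotentialAssumption V μ δ) {u : fock N}
    (hu : u ∈ formDomain V μ δ N) :
    δ * ‖u‖ ^ 2 ≤ ∫ z, truncation V μ δ z * ‖val u z‖ ^ 2 ∂gam := by
  rw [norm_sq_eq_integral, ← integral_const_mul]
  have h2 := (memLp_two_iff_integrable_sq_norm (val_continuous u).aestronglyMeasurable).1
    (memLp_val u)
  exact integral_mono (h2.const_mul δ) (hV.mem_formDomain_iff.1 hu) fun z =>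
    mul_le_mul_of_nonneg_right (le_truncation z) (by positivity)

theorem inner_sub_eq (hV : PotentialAssumption V μ δ) (hN : 0 < N) {u : fock N}
    (hu : u ∈ formDomain V μ δ N) (v : (toeplitz N V).domain) (c : ℝ) :
    inner ℂ u (toeplitz N V v) - c * inner ℂ u (v : fock N)
      = ∫ z, conj (val u z) * ((V z - c : ℝ) * val (v : fock N) z) ∂gam := by
  obtain ⟨C, hC0, hC⟩ := hV.abs_le_mul_truncation
  have hi := hV.integrable_weight_mul hV.continuous hC hu (hV.domain_le_formDomain v.2)
  rw [hV.inner_toeplitz hN hu, inner_eq_integral, ← integral_const_mul, ← integral_sub hi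
    ((integrable_conj_mul (memLp_val u) (memLp_val (v : fock N))).const_mul _)]
  refine integral_congr_ae (Eventually.of_forall fun z => ?_)
  push_cast
  ring

theorem re_inner_toeplitz (hV : PotentialAssumption V μ δ) (hN : 0 < N)
    (u : (toeplitz N V).domain) (c : ℝ) :
    (inner ℂ (u : fock N) (toeplitz N V u)).re - c * ‖(u : fock N)‖ ^ 2
      = energy V c (u : fock N) := by
  rw [← re_integral_eq_energy, ← hV.inner_sub_eq hN (hV.domain_le_formDomain u.2) u c,
    Complex.sub_re, Complex.re_ofReal_mul, re_inner_self]

/-- The dimension of a subspace on which the energy is non-positive is bounded. -/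
theorem mul_finrank_le (hV : PotentialAssumption V μ δ) (hN : 0 < N) {E : Submodule ℂ (fock N)}
    (hfd : FiniteDimensional ℂ E) (hE : E ≤ formDomain V μ δ N)
    (hle : ∀ u ∈ E, energy V μ u ≤ 0) :
    δ * Module.finrank ℂ E ≤ N * ∫ z, well V μ δ z ∂gam := by
  set b := stdOrthonormalBasis ℂ E
  have hon : Orthonormal ℂ fun k => (b k : fock N) :=
    b.orthonormal.comp_linearIsometry E.subtypeₗᵢ
  -- For a unit vector the truncated potential contributes at least `δ`; non-positive energy means
  -- that the well compensates it.
  have h1 : ∀ k, δ ≤ ∫ z, well V μ δ z * ‖val (b k : fock N) z‖ ^ 2 ∂gam := by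
    intro k
    have h2 := hV.norm_sq_le_integral_truncation (hE (b k).2)
    have h3 := hle _ (b k).2
    rw [hV.energy_eq (hE (b k).2)] at h3
    rw [hon.1 k] at h2
    linarith
  have h4 : ∑ k, δ ≤ ∑ k, ∫ z, well V μ δ z * ‖val (b k : fock N) z‖ ^ 2 ∂gam :=
    Finset.sum_le_sum fun k _ => h1 k
  rw [← integral_finsetSum _ fun k _ => hV.integrable_well_mul _, Finset.sum_const,
    Finset.card_univ, Fintype.card_fin, nsmul_eq_mul, mul_comm] at h4
  refine h4.trans ?_
  rw [← integral_const_mul]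
  refine integral_mono (integrable_finsetSum _ fun k _ => hV.integrable_well_mul _)
    (hV.integrable_well.const_mul N) fun z => ?_
  simp only
  rw [← Finset.mul_sum, mul_comm N]
  refine mul_le_mul_of_nonneg_left ?_ (well_nonneg z)
  -- Bessel's inequality for the coherent state: `∑ₖ |bₖ(z)|² ≤ ‖k_z‖² = N`.
  have h5 := hon.sum_inner_products_le (coherent hN z) (s := Finset.univ)
  rw [norm_sq_coherent] at h5
  refine le_trans (le_of_eq (Finset.sum_congr rfl fun k _ => ?_)) h5
  rw [← inner_coherent hN, norm_inner_symm]

/-- Lower semicontinuity of the energy along weakly convergent sequences. -/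
theorem energy_weak_limit (hV : PotentialAssumption V μ δ) (hN : 0 < N) {u : ℕ → fock N}
    {w : fock N} (hu : ∀ n, u n ∈ formDomain V μ δ N) (hu1 : ∀ n, ‖u n‖ = 1)
    (hw : ∀ v : fock N, Tendsto (fun n => inner ℂ v (u n)) atTop (𝓝 (inner ℂ v w))) {m : ℝ}
    (hm : Tendsto (fun n => energy V μ (u n)) atTop (𝓝 m)) :
    w ∈ formDomain V μ δ N ∧ energy V μ w ≤ m ∧
      δ ≤ m + ∫ z, well V μ δ z * ‖val w z‖ ^ 2 ∂gam := by
  have hpt := tendsto_val_of_weak hN hw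
  -- The well term is weakly continuous: `|u_n(z)|² ≤ N` for unit vectors, and the well is
  -- integrable. The truncated part is only lower semicontinuous, by Fatou's lemma below.
  have h1 : Tendsto (fun n => ∫ z, well V μ δ z * ‖val (u n) z‖ ^ 2 ∂gam) atTop
      (𝓝 (∫ z, well V μ δ z * ‖val w z‖ ^ 2 ∂gam)) := by
    refine tendsto_integral_of_dominated_convergence (fun z => N * well V μ δ z)
      (fun n => (hV.integrable_well_mul (u n)).aestronglyMeasurable)
      (hV.integrable_well.const_mul N) (fun n => Eventually.of_forall fun z => ?_)
      (Eventually.of_forall fun z => ((hpt z).norm.pow 2).const_mul _)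
    have hw0 := well_nonneg (V := V) (μ := μ) (δ := δ) z
    rw [Real.norm_of_nonneg (by positivity), mul_comm]
    refine mul_le_mul_of_nonneg_right ?_ hw0
    have h2 := norm_val_le hN (u n) z
    rw [hu1, mul_one] at h2
    calc _ ≤ Real.sqrt N ^ 2 := pow_le_pow_left₀ (norm_nonneg _) h2 2
      _ = N := Real.sq_sqrt hN.le
  have h2 : Tendsto (fun n => ∫ z, truncation V μ δ z * ‖val (u n) z‖ ^ 2 ∂gam) atTop
      (𝓝 (m + ∫ z, well V μ δ z * ‖val w z‖ ^ 2 ∂gam)) := by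
    refine (hm.add h1).congr fun n => ?_
    rw [hV.energy_eq (hu n)]
    ring
  have hnn : ∀ (v : fock N) z, 0 ≤ truncation V μ δ z * ‖val v z‖ ^ 2 := fun v z =>
    mul_nonneg (hV.truncation_pos z).le (by positivity)
  have hcont : ∀ v : fock N, Continuous fun z => truncation V μ δ z * ‖val v z‖ ^ 2 := fun v =>
    hV.continuous_truncation.mul ((val_continuous v).norm.pow 2)
  have h3 : ∫⁻ z, ENNReal.ofReal (truncation V μ δ z * ‖val w z‖ ^ 2) ∂gam
      ≤ ENNReal.ofReal (m + ∫ z, well V μ δ z * ‖val w z‖ ^ 2 ∂gam) := by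
    have h4 := lintegral_liminf_le (μ := gam) (u := atTop)
      (f := fun n z => ENNReal.ofReal (truncation V μ δ z * ‖val (u n) z‖ ^ 2))
      (fun n => (ENNReal.continuous_ofReal.comp (hcont (u n))).measurable)
    have e1 : ∀ z, liminf (fun n => ENNReal.ofReal (truncation V μ δ z * ‖val (u n) z‖ ^ 2)) atTop
        = ENNReal.ofReal (truncation V μ δ z * ‖val w z‖ ^ 2) := fun z =>
      (ENNReal.tendsto_ofReal (((hpt z).norm.pow 2).const_mul _)).liminf_eq
    have e2 : ∀ n, ∫⁻ z, ENNReal.ofReal (truncation V μ δ z * ‖val (u n) z‖ ^ 2) ∂gam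
        = ENNReal.ofReal (∫ z, truncation V μ δ z * ‖val (u n) z‖ ^ 2 ∂gam) := fun n =>
      (ofReal_integral_eq_lintegral_ofReal (hV.mem_formDomain_iff.1 (hu n))
        (Eventually.of_forall (hnn (u n)))).symm
    simp only [e1, e2, (ENNReal.tendsto_ofReal h2).liminf_eq] at h4
    exact h4
  -- This excludes a vanishing weak limit when `m ≤ 0`: no mass that matters escapes to infinity.
  have hδ : δ ≤ m + ∫ z, well V μ δ z * ‖val w z‖ ^ 2 ∂gam := by
    refine ge_of_tendsto' h2 fun n => ?_
    have := hV.norm_sq_le_integral_truncation (hu n)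
    rwa [hu1, one_pow, mul_one] at this
  have hwF : w ∈ formDomain V μ δ N := by
    rw [hV.mem_formDomain_iff]
    refine ⟨(hcont w).aestronglyMeasurable, ?_⟩
    rw [hasFiniteIntegral_iff_ofReal (Eventually.of_forall (hnn w))]
    exact h3.trans_lt ENNReal.ofReal_lt_top
  refine ⟨hwF, ?_, hδ⟩
  rw [← ofReal_integral_eq_lintegral_ofReal (hV.mem_formDomain_iff.1 hwF)
    (Eventually.of_forall (hnn w)), ENNReal.ofReal_le_ofReal_iff (hV.pos.le.trans hδ)] at h3
  rw [hV.energy_eq hwF]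
  linarith

end PotentialAssumption

end

section

/-! ### Existence and uniqueness of the spectral projection -/

variable {V : ℂ → ℝ} {μ δ N : ℝ}

/-- If `q (w + c v)` is non-negative for all `c` and `q w ≤ 0` then the polar form of `q` vanishes
at `(v, w)`. -/
theorem eq_zero_of_quadratic_nonneg {a d : ℝ} {β : ℂ} (ha : a ≤ 0)
    (h : ∀ t : ℝ, 0 ≤ a - 2 * t * ‖β‖ ^ 2 + t ^ 2 * ‖β‖ ^ 2 * d) : β = 0 := by
  by_contra hβ
  have hβ' : 0 < ‖β‖ ^ 2 := by have := norm_pos_iff.2 hβ; positivity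
  -- Small enough for the quadratic term to be at most half of the linear one.
  set t : ℝ := (|d| + 1)⁻¹ with ht
  have ht0 : 0 < t := by positivity
  have h1 := h t
  have h2 : t * d ≤ 1 := by
    rw [ht, inv_mul_le_iff₀ (by positivity)]
    linarith [le_abs_self d]
  have h3 : t ^ 2 * ‖β‖ ^ 2 * d ≤ t * ‖β‖ ^ 2 := by
    calc t ^ 2 * ‖β‖ ^ 2 * d = t * ‖β‖ ^ 2 * (t * d) := by ring
      _ ≤ t * ‖β‖ ^ 2 * 1 := mul_le_mul_of_nonneg_left h2 (by positivity)
      _ = _ := mul_one _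
  have h4 : 0 < t * ‖β‖ ^ 2 := by positivity
  linarith

namespace PotentialAssumption

/-- The energy of `w + c v`. -/
theorem energy_add_smul (hV : PotentialAssumption V μ δ) {w v : fock N}
    (hw : w ∈ formDomain V μ δ N) (hv : v ∈ formDomain V μ δ N) (a t : ℝ) {β : ℂ}
    (hβ : ∫ z, conj (val v z) * ((V z - a : ℝ) * val w z) ∂gam = β) :
    energy V a (w + (-(t * β)) • v)
      = energy V a w - 2 * t * ‖β‖ ^ 2 + t ^ 2 * ‖β‖ ^ 2 * energy V a v := by
  obtain ⟨C, hC⟩ := hV.abs_le_truncation_add a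
  have hcont : Continuous fun z => V z - a := hV.continuous.sub continuous_const
  have hi : ∀ u ∈ formDomain V μ δ N, ∀ u' ∈ formDomain V μ δ N,
      Integrable (fun z => conj (val u z) * ((V z - a : ℝ) * val u' z)) gam :=
    fun u hu u' hu' => hV.integrable_weight_mul hcont hC hu hu'
  have hβ' : ∫ z, conj (val w z) * ((V z - a : ℝ) * val v z) ∂gam = conj β := by
    rw [← hβ, ← integral_conj]
    refine integral_congr_ae (Eventually.of_forall fun z => ?_)
    simp only [map_mul, Complex.conj_conj, Complex.conj_ofReal]
    ring
  set c : ℂ := -(t * β) with hc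
  have e : ∀ z, conj (val (w + c • v) z) * ((V z - a : ℝ) * val (w + c • v) z)
      = (conj (val w z) * ((V z - a : ℝ) * val w z) + c * (conj (val w z) * ((V z - a : ℝ)
        * val v z))) + (conj c * (conj (val v z) * ((V z - a : ℝ) * val w z))
        + (conj c * c) * (conj (val v z) * ((V z - a : ℝ) * val v z))) := fun z => by
    simp only [val_add, val_smul, map_add, map_mul]
    ring
  rw [← re_integral_eq_energy]
  simp only [e]
  have hadd1 := integral_add (hi w hw w hw) ((hi w hw v hv).const_mul c)
  have hadd2 := integral_add ((hi v hv w hw).const_mul (conj c))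
    ((hi v hv v hv).const_mul (conj c * c))
  have hadd := integral_add ((hi w hw w hw).add ((hi w hw v hv).const_mul c))
    (((hi v hv w hw).const_mul (conj c)).add ((hi v hv v hv).const_mul (conj c * c)))
  simp only [Pi.add_apply] at hadd
  rw [hadd, hadd1, hadd2,
    integral_const_mul, integral_const_mul, integral_const_mul, hβ, hβ', Complex.add_re,
    Complex.add_re, Complex.add_re, re_integral_eq_energy]
  have e1 : c * conj β = ((-(t * ‖β‖ ^ 2) : ℝ) : ℂ) := by
    rw [hc, neg_mul, mul_assoc, Complex.mul_conj']; push_cast; rfl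
  have e2 : conj c * β = ((-(t * ‖β‖ ^ 2) : ℝ) : ℂ) := by
    rw [hc, map_neg, map_mul, Complex.conj_ofReal, neg_mul, mul_assoc, Complex.conj_mul']
    push_cast; rfl
  have e3 : conj c * c = ((t ^ 2 * ‖β‖ ^ 2 : ℝ) : ℂ) := by
    rw [Complex.conj_mul', hc, norm_neg, norm_mul, Complex.norm_real]
    push_cast
    rw [mul_pow, ← Complex.ofReal_pow ‖t‖, Real.norm_eq_abs, sq_abs]
    push_cast; rfl
  rw [e1, e2, e3, Complex.re_ofReal_mul, re_integral_eq_energy, Complex.ofReal_re]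
  ring

theorem energy_eq_sub (hV : PotentialAssumption V μ δ) {u : fock N}
    (hu : u ∈ formDomain V μ δ N) (m : ℝ) :
    energy V (μ + m) u = energy V μ u - m * ‖u‖ ^ 2 := by
  have h2 := (memLp_two_iff_integrable_sq_norm (val_continuous u).aestronglyMeasurable).1
    (memLp_val u)
  have h1 : Integrable (fun z => (V z - μ) * ‖val u z‖ ^ 2) gam := by
    refine ((hV.mem_formDomain_iff.1 hu).sub (hV.integrable_well_mul u)).congr
      (Eventually.of_forall fun z => ?_)
    simp only [Pi.sub_apply, well]
    ring
  rw [norm_sq_eq_integral, ← integral_const_mul, energy, energy, ← integral_sub h1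
    (h2.const_mul m)]
  refine integral_congr_ae (Eventually.of_forall fun z => ?_)
  simp only
  ring

/-- If the energy takes non-positive values on the orthogonal complement of an invariant subspace
then there is an eigenvector in this complement. -/
theorem exists_eigenvector (hV : PotentialAssumption V μ δ) (hN : 0 < N)
    {E : Submodule ℂ (fock N)} (hfd : FiniteDimensional ℂ E)
    (hE : IsLowSubspace (toeplitz N V) μ E) {u₀ : fock N} (hu₀ : u₀ ∈ formDomain V μ δ N)
    (hne : u₀ ≠ 0) (hort : ∀ e ∈ E, inner ℂ e u₀ = 0) (hle : energy V μ u₀ ≤ 0) :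
    ∃ w : (toeplitz N V).domain, (w : fock N) ≠ 0 ∧ (∀ e ∈ E, inner ℂ e (w : fock N) = 0) ∧
      ∃ l : ℝ, l ≤ μ ∧ toeplitz N V w = (l : ℂ) • (w : fock N) := by
  have := completeSpace_fock hN
  obtain ⟨B, hB0, hB⟩ := hV.exists_well_le
  have hEF : ∀ e ∈ E, e ∈ formDomain V μ δ N := fun e he => hV.domain_le_formDomain (hE e he).1
  set S : Set ℝ := {q | ∃ u ∈ formDomain V μ δ N, (∀ e ∈ E, inner ℂ e u = 0) ∧ ‖u‖ = 1 ∧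
    energy V μ u = q} with hS
  have hbd : ∀ u ∈ formDomain V μ δ N, -(B * ‖u‖ ^ 2) ≤ energy V μ u := by
    intro u hu
    have h2 := (memLp_two_iff_integrable_sq_norm (val_continuous u).aestronglyMeasurable).1
      (memLp_val u)
    have h1 : ∫ z, well V μ δ z * ‖val u z‖ ^ 2 ∂gam ≤ B * ‖u‖ ^ 2 := by
      rw [norm_sq_eq_integral, ← integral_const_mul]
      exact integral_mono (hV.integrable_well_mul u) (h2.const_mul B) fun z =>
        mul_le_mul_of_nonneg_right (hB z) (by positivity)
    have h3 := hV.norm_sq_le_integral_truncation hu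
    have h4 : 0 ≤ δ * ‖u‖ ^ 2 := mul_nonneg hV.pos.le (by positivity)
    rw [hV.energy_eq hu]
    linarith
  have hnormalize : ∀ u ∈ formDomain V μ δ N, u ≠ 0 → (∀ e ∈ E, inner ℂ e u = 0) →
      (‖u‖ ^ 2)⁻¹ * energy V μ u ∈ S := by
    intro u hu hu0 huE
    have hn := norm_pos_iff.2 hu0
    refine ⟨((‖u‖⁻¹ : ℝ) : ℂ) • u, Submodule.smul_mem _ _ hu, fun e he => ?_, ?_, ?_⟩
    · rw [inner_smul_fock, huE e he, mul_zero]
    · rw [norm_smul, Complex.norm_real, norm_inv, norm_norm, inv_mul_cancel₀ hn.ne']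
    · rw [energy_smul, Complex.norm_real, norm_inv, norm_norm, inv_pow]
  have hSb : BddBelow S := by
    refine ⟨-B, ?_⟩
    rintro _ ⟨u, hu, -, h1, rfl⟩
    have := hbd u hu
    rwa [h1, one_pow, mul_one] at this
  have hSne := hnormalize u₀ hu₀ hne hort
  -- The infimum of the energy over unit vectors orthogonal to `E`. A minimizing sequence will
  -- produce an eigenvector with eigenvalue `μ + m ≤ μ`.
  set m := sInf S with hm
  have hm0 : m ≤ 0 := (csInf_le hSb hSne).trans
    (mul_nonpos_of_nonneg_of_nonpos (by positivity) hle)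
  have hmin : ∀ u ∈ formDomain V μ δ N, (∀ e ∈ E, inner ℂ e u = 0) →
      0 ≤ energy V (μ + m) u := by
    intro u hu huE
    rw [hV.energy_eq_sub hu, sub_nonneg]
    rcases eq_or_ne u 0 with rfl | hu0
    · simp [energy, val_zero]
    · have h1 := csInf_le hSb (hnormalize u hu hu0 huE)
      have hn := norm_pos_iff.2 hu0
      rwa [le_inv_mul_iff₀ (by positivity), mul_comm] at h1
  obtain ⟨q, -, hqlim, hqS⟩ := exists_seq_tendsto_sInf ⟨_, hSne⟩ hSb
  choose u huF huE hu1 huq using hqS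
  obtain ⟨w, φ, hφ, hw1, hw⟩ := exists_weak_limit (fun n => (hu1 n).le)
  have hlim : Tendsto (fun n => energy V μ (u (φ n))) atTop (𝓝 m) := by
    simp only [huq]
    exact hqlim.comp hφ.tendsto_atTop
  obtain ⟨hwF, hwe, hwδ⟩ := hV.energy_weak_limit hN (fun n => huF (φ n)) (fun n => hu1 (φ n))
    hw hlim
  have hw0 : w ≠ 0 := by
    rintro rfl
    simp only [val_zero, norm_zero] at hwδ
    norm_num at hwδ
    linarith [hV.pos]
  have hwE : ∀ e ∈ E, inner ℂ e w = 0 := fun e he =>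
    tendsto_nhds_unique (hw e) (by simp only [huE _ e he]; exact tendsto_const_nhds)
  -- The weak limit may have norm less than one, but `m ≤ 0` gives `m ≤ m ‖w‖²`. Hence no
  -- normalization is needed.
  have hwm : energy V (μ + m) w ≤ 0 := by
    rw [hV.energy_eq_sub hwF]
    have : ‖w‖ ^ 2 ≤ 1 := pow_le_one₀ (norm_nonneg _) hw1
    nlinarith
  obtain ⟨C, hC⟩ := hV.abs_le_truncation_add (μ + m)
  have hcont : Continuous fun z => V z - (μ + m) := hV.continuous.sub continuous_const
  -- The Euler-Lagrange equation, so far only against test vectors orthogonal to `E`.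
  have hEL : ∀ v ∈ formDomain V μ δ N, (∀ e ∈ E, inner ℂ e v = 0) →
      ∫ z, conj (val v z) * ((V z - (μ + m) : ℝ) * val w z) ∂gam = 0 := by
    intro v hv hvE
    refine eq_zero_of_quadratic_nonneg hwm (d := energy V (μ + m) v) fun t => ?_
    rw [← hV.energy_add_smul hwF hv (μ + m) t rfl]
    refine hmin _ (Submodule.add_mem _ hwF (Submodule.smul_mem _ _ hv)) fun e he => ?_
    rw [inner_add_right, inner_smul_fock, hwE e he, hvE e he, mul_zero, add_zero]
  -- Against `E` itself the equation follows from invariance: both `e` and `H_N e` lie in `E`, hence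
  -- are orthogonal to `w`.
  have hEw : ∀ e ∈ E, ∫ z, conj (val e z) * ((V z - (μ + m) : ℝ) * val w z) ∂gam = 0 := by
    intro e he
    obtain ⟨hed, heE, -⟩ := hE e he
    have h1 := hV.inner_sub_eq hN hwF ⟨e, hed⟩ (μ + m)
    rw [inner_eq_zero_symm.1 (hwE _ heE), inner_eq_zero_symm.1 (hwE e he), mul_zero,
      sub_zero] at h1
    have h2 := congrArg conj h1
    rw [← integral_conj, map_zero] at h2
    rw [h2]
    refine integral_congr_ae (Eventually.of_forall fun z => ?_)
    simp only [map_mul, Complex.conj_conj, Complex.conj_ofReal]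
    ring
  -- Testing against `k_x`, split along `E` and its complement, turns the weak equation into the
  -- pointwise identity `P_N (V w) = (μ + m) w`.
  have hcoh : ∀ x, ∫ z, bargmannKernel N x z * ((V z - (μ + m) : ℝ) * val w z) ∂gam = 0 := by
    intro x
    set k := coherent hN x with hk
    have hkF := hV.coherent_mem_formDomain hN x
    have hPE := E.starProjection_apply_mem k
    have h1 := hEL (k - E.starProjection k) (Submodule.sub_mem _ hkF (hEF _ hPE)) fun e he =>
      E.sub_starProjection_mem_orthogonal k e he
    have h2 := hEw _ hPE
    have h3 : ∫ z, conj (val k z) * ((V z - (μ + m) : ℝ) * val w z) ∂gam = 0 := by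
      refine Eq.trans ?_ ((congrArg₂ (· + ·) h1 h2).trans (add_zero (0 : ℂ)))
      rw [← integral_add
        (hV.integrable_weight_mul hcont hC (Submodule.sub_mem _ hkF (hEF _ hPE)) hwF)
        (hV.integrable_weight_mul hcont hC (hEF _ hPE) hwF)]
      refine integral_congr_ae (Eventually.of_forall fun z => ?_)
      simp only [val_sub, map_sub]
      ring
    simpa only [hk, val_coherent, conj_bargmannKernel] using h3
  have hval : ∀ x, val (((μ + m : ℝ) : ℂ) • w) x
      = ∫ z, bargmannKernel N x z * (V z * val w z) ∂gam := by
    intro x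
    obtain ⟨C', -, hC'⟩ := hV.abs_le_mul_truncation
    have hi := hV.integrable_weight_mul hV.continuous hC' (hV.coherent_mem_formDomain hN x) hwF
    simp only [val_coherent, conj_bargmannKernel] at hi
    have h1 := hcoh x
    have e : ∀ z, bargmannKernel N x z * ((V z - (μ + m) : ℝ) * val w z)
        = bargmannKernel N x z * (V z * val w z)
          - ((μ + m : ℝ) : ℂ) * (bargmannKernel N x z * val w z) := fun z => by
      push_cast; ring
    simp only [e] at h1
    rw [integral_sub hi ((integrable_bargmannKernel_mul hN x (memLp_val w)).const_mul _),
      integral_const_mul, integral_bargmannKernel_mul_val hN, sub_eq_zero] at h1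
    rw [h1, val_smul]
  obtain ⟨hd, hT⟩ := hV.mem_domain_of_formDomain hN hwF hval
  exact ⟨⟨w, hd⟩, hw0, hwE, μ + m, by linarith, hT⟩

theorem exists_spectralProjection (hV : PotentialAssumption V μ δ) (hN : 0 < N) :
    ∃ P : fock N →L[ℂ] fock N, IsSpectralProjection (toeplitz N V) μ P ∧
      ∃ E : Submodule ℂ (fock N), FiniteDimensional ℂ E ∧ IsLowSubspace (toeplitz N V) μ E ∧
        LinearMap.range (P : fock N →ₗ[ℂ] fock N) = E := by
  refine exists_isSpectralProjection (hV.toeplitz_symmetric hN)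
    (n := ⌊N * (∫ z, well V μ δ z ∂gam) / δ⌋₊) (fun E hfd hE => ?_) (fun E hfd hE u hu hort h => ?_)
  · refine Nat.le_floor ?_
    rw [le_div_iff₀ hV.pos, mul_comm]
    refine hV.mul_finrank_le hN hfd (fun e he => hV.domain_le_formDomain (hE e he).1)
      fun e he => ?_
    obtain ⟨hd, -, hle⟩ := hE e he
    rw [← hV.re_inner_toeplitz hN ⟨e, hd⟩]
    linarith
  · refine hV.exists_eigenvector hN hfd hE (hV.domain_le_formDomain u.2) hu hort ?_
    rw [← hV.re_inner_toeplitz hN u]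
    linarith

theorem existsUnique_spectralProjection (hV : PotentialAssumption V μ δ) (hN : 0 < N) :
    ∃! P : fock N →L[ℂ] fock N, IsSpectralProjection (toeplitz N V) μ P := by
  obtain ⟨P, hP, E, hfd, hE, hPE⟩ := hV.exists_spectralProjection hN
  exact ⟨P, hP, fun P' hP' => hP.unique (hV.dense_domain hN) hP' hE hPE⟩

theorem fermiProjection_spec (hV : PotentialAssumption V μ δ) (hN : 0 < N) :
    IsSpectralProjection (toeplitz N V) μ (fermiProjection V μ N) := by
  have h := (hV.existsUnique_spectralProjection hN).exists
  rw [fermiProjection, spectralProjection, dif_pos h]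
  exact h.choose_spec

theorem finiteDimensional_fermiSpace (hV : PotentialAssumption V μ δ) (hN : 0 < N) :
    FiniteDimensional ℂ (fermiSpace V μ N) := by
  obtain ⟨P, hP, E, hfd, hE, hPE⟩ := hV.exists_spectralProjection hN
  rw [fermiSpace, (hV.existsUnique_spectralProjection hN).unique (hV.fermiProjection_spec hN) hP,
    hPE]
  exact hfd

end PotentialAssumption

end

section

/-! ### Exponential decay of the density away from the edge -/

variable {V : ℂ → ℝ} {μ δ N : ℝ}

/-- The change of variables `s = √N (x - z)` removes both `N` and `x`; this is why weights `exp (b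
√N ‖x - z‖)` cost only a constant. -/
theorem integral_scaled_gaussian (b : ℝ) (hN : 0 < N) (x : ℂ) :
    ∫ z, N * Real.exp (b * Real.sqrt N * ‖x - z‖ - N / 2 * ‖x - z‖ ^ 2) ∂gam
      = ∫ s : ℂ, Real.exp (b * ‖s‖ - 1 / 2 * ‖s‖ ^ 2) ∂gam := by
  rw [integral_sub_left_eq_self
    (fun y : ℂ => N * Real.exp (b * Real.sqrt N * ‖y‖ - N / 2 * ‖y‖ ^ 2)) gam x]
  have hs : 0 < Real.sqrt N := Real.sqrt_pos.2 hN
  have h := Measure.integral_comp_smul gam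
    (fun s : ℂ => Real.exp (b * ‖s‖ - 1 / 2 * ‖s‖ ^ 2)) (Real.sqrt N)
  rw [Complex.finrank_real_complex, Real.sq_sqrt hN.le, smul_eq_mul,
    abs_of_pos (inv_pos.2 hN), eq_inv_mul_iff_mul_eq₀ hN.ne'] at h
  rw [← h, integral_const_mul]
  congr 1
  refine integral_congr_ae (Eventually.of_forall fun y => ?_)
  simp only [norm_smul, Real.norm_of_nonneg hs.le, mul_pow, Real.sq_sqrt hN.le]
  ring_nf

theorem integrable_scaled_gaussian (b : ℝ) (hN : 0 < N) (x : ℂ) :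
    Integrable (fun z => N * Real.exp (b * Real.sqrt N * ‖x - z‖ - N / 2 * ‖x - z‖ ^ 2)) gam :=
  (integrable_exp_translate _ (half_pos hN) x).const_mul N

namespace PotentialAssumption

/-- Away from the level set the truncated potential is at most `(1 + δ / c) |V - μ|`, so the modulus
of continuity can be measured in units of `|V x - μ|`. This keeps the estimates uniform where `V` is
unbounded. -/
theorem exists_relative_modulus (hV : PotentialAssumption V μ δ) {c : ℝ} (hc : 0 < c) :
    ∃ K : ℝ, 0 ≤ K ∧ ∀ ε : ℝ, 0 < ε → ∃ C : ℝ, 0 ≤ C ∧ ∀ x, c ≤ |V x - μ| → ∀ z,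
      |V z - V x| ≤ |V x - μ| * (ε + C * (‖x - z‖ * Real.exp (K * ‖x - z‖))) := by
  obtain ⟨K, hK0, hK⟩ := hV.exists_modulus
  refine ⟨K, hK0, fun ε hε => ?_⟩
  obtain ⟨C, hC0, hC⟩ := hK (ε * c) (by positivity)
  refine ⟨(1 + δ / c) * K + C / c, by have := hV.pos; positivity, fun x hx z => ?_⟩
  rw [abs_sub_comm]
  refine (hC x z).trans ?_
  have hδ := hV.pos
  have hW : truncation V μ δ x ≤ |V x - μ| * (1 + δ / c) := by
    have h1 : δ ≤ |V x - μ| * (δ / c) := by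
      rw [mul_div_assoc', le_div_iff₀ hc, mul_comm]
      exact mul_le_mul_of_nonneg_right hx hδ.le
    rw [mul_add, mul_one]
    exact max_le ((le_abs_self _).trans (by linarith)) (by linarith [abs_nonneg (V x - μ)])
  set t := ‖x - z‖ with ht
  have ht0 : 0 ≤ t := norm_nonneg _
  have hE : 1 ≤ Real.exp (K * t) := Real.one_le_exp (by positivity)
  have h1 : truncation V μ δ x * (K * t * Real.exp (K * t))
      ≤ |V x - μ| * (1 + δ / c) * (K * t * Real.exp (K * t)) :=
    mul_le_mul_of_nonneg_right hW (by positivity)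
  have h2 : ε * c ≤ |V x - μ| * ε := by
    rw [mul_comm]; exact mul_le_mul_of_nonneg_right hx hε.le
  have h3 : C * t ≤ |V x - μ| * (C / c * (t * Real.exp (K * t))) := by
    have h4 : C ≤ |V x - μ| * (C / c) := by
      rw [mul_div_assoc', le_div_iff₀ hc, mul_comm]
      exact mul_le_mul_of_nonneg_right hx hC0
    calc C * t ≤ (|V x - μ| * (C / c)) * t := mul_le_mul_of_nonneg_right h4 ht0
      _ ≤ (|V x - μ| * (C / c)) * (t * Real.exp (K * t)) :=
        mul_le_mul_of_nonneg_left (le_mul_of_one_le_right ht0 hE) (by positivity)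
      _ = _ := by ring
  calc _ ≤ |V x - μ| * (1 + δ / c) * (K * t * Real.exp (K * t)) + |V x - μ| * ε
        + |V x - μ| * (C / c * (t * Real.exp (K * t))) := by linarith
    _ = _ := by ring

/-- The oscillation of the potential at the scale of the kernel is small. -/
theorem exists_integral_oscillation_le (hV : PotentialAssumption V μ δ) {c : ℝ} (hc : 0 < c)
    (β : ℝ) : ∃ N₀ : ℝ, 1 ≤ N₀ ∧ ∀ N, N₀ ≤ N → ∀ x, c ≤ |V x - μ| →
      Integrable (fun z => |V z - V x| * ‖bargmannKernel N x z‖ *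
        Real.exp (β * Real.sqrt N * ‖x - z‖)) gam ∧
      ∫ z, |V z - V x| * ‖bargmannKernel N x z‖ * Real.exp (β * Real.sqrt N * ‖x - z‖) ∂gam
        ≤ |V x - μ| / 2 := by
  obtain ⟨K, hK0, hK⟩ := hV.exists_relative_modulus hc
  set J : ℝ → ℝ := fun b => ∫ s : ℂ, Real.exp (b * ‖s‖ - 1 / 2 * ‖s‖ ^ 2) ∂gam with hJ
  have hJ0 : ∀ b, 0 ≤ J b := fun b => integral_nonneg fun s => (Real.exp_pos _).le
  -- The two error terms will be `ε J β` and `C J b / √N`; this `ε` and the threshold on `N` below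
  -- make each at most `1 / 4`.
  set ε : ℝ := (4 * (J β + 1))⁻¹ with hε
  have hε0 : 0 < ε := by have := hJ0 β; positivity
  obtain ⟨C, hC0, hC⟩ := hK ε hε0
  -- The extra `K` absorbs `exp (K t)`, and the extra `1` absorbs the factor `√N t ≤ exp (√N t)`,
  -- which yields the gain `1 / √N`.
  set b := β + K + 1 with hb
  refine ⟨max 1 ((4 * C * J b) ^ 2), le_max_left _ _, fun N hN x hx => ?_⟩
  have hN1 : 1 ≤ N := (le_max_left _ _).trans hN
  have hN0 : 0 < N := by linarith
  set r := Real.sqrt N with hr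
  have hr1 : 1 ≤ r := Real.one_le_sqrt.2 hN1
  have hrC : 4 * C * J b ≤ r := Real.le_sqrt_of_sq_le ((le_max_right _ _).trans hN)
  have hbound : ∀ z, |V z - V x| * ‖bargmannKernel N x z‖ * Real.exp (β * r * ‖x - z‖)
      ≤ |V x - μ| * (ε * (N * Real.exp (β * r * ‖x - z‖ - N / 2 * ‖x - z‖ ^ 2))
        + C / r * (N * Real.exp (b * r * ‖x - z‖ - N / 2 * ‖x - z‖ ^ 2))) := by
    intro z
    set t := ‖x - z‖ with ht
    have ht0 : 0 ≤ t := norm_nonneg _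
    have e1 : ∀ a : ℝ, Real.exp (a - N / 2 * t ^ 2)
        = Real.exp (-(N / 2 * t ^ 2)) * Real.exp a := fun a => by
      rw [← Real.exp_add]; congr 1; ring
    rw [norm_bargmannKernel hN0.le, e1, e1]
    set E := Real.exp (-(N / 2 * t ^ 2))
    have hE : 0 < E := Real.exp_pos _
    have h1 : t * Real.exp (K * t) * Real.exp (β * r * t) ≤ r⁻¹ * Real.exp (b * r * t) := by
      have h2 : r * t ≤ Real.exp (r * t) := by linarith [Real.add_one_le_exp (r * t)]
      have h3 : Real.exp (K * t) ≤ Real.exp (K * (r * t)) :=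
        Real.exp_le_exp.2 (mul_le_mul_of_nonneg_left (le_mul_of_one_le_left ht0 hr1) hK0)
      have e2 : Real.exp (b * r * t)
          = Real.exp (r * t) * Real.exp (K * (r * t)) * Real.exp (β * r * t) := by
        rw [← Real.exp_add, ← Real.exp_add]; congr 1; rw [hb]; ring
      rw [e2, le_inv_mul_iff₀ (by linarith)]
      calc r * (t * Real.exp (K * t) * Real.exp (β * r * t))
          = (r * t) * Real.exp (K * t) * Real.exp (β * r * t) := by ring
        _ ≤ Real.exp (r * t) * Real.exp (K * (r * t)) * Real.exp (β * r * t) := by gcongr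
    calc |V z - V x| * (N * E) * Real.exp (β * r * t)
        ≤ |V x - μ| * (ε + C * (t * Real.exp (K * t))) * (N * E) * Real.exp (β * r * t) := by
          gcongr
          exact hC x hx z
      _ = |V x - μ| * (ε * (N * (E * Real.exp (β * r * t)))
          + C * N * E * (t * Real.exp (K * t) * Real.exp (β * r * t))) := by ring
      _ ≤ |V x - μ| * (ε * (N * (E * Real.exp (β * r * t)))
          + C * N * E * (r⁻¹ * Real.exp (b * r * t))) := by gcongr
      _ = _ := by ring
  have hi1 := (integrable_scaled_gaussian β hN0 x).const_mul ε
  have hi2 := (integrable_scaled_gaussian b hN0 x).const_mul (C / r)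
  have hint := (hi1.add hi2).const_mul |V x - μ|
  have hcont : Continuous fun z =>
      |V z - V x| * ‖bargmannKernel N x z‖ * Real.exp (β * r * ‖x - z‖) := by
    have h1 : Continuous fun z => bargmannKernel N x z := by unfold bargmannKernel; fun_prop
    exact ((hV.continuous.sub continuous_const).abs.mul h1.norm).mul (by fun_prop)
  have hi : Integrable (fun z => |V z - V x| * ‖bargmannKernel N x z‖ *
      Real.exp (β * r * ‖x - z‖)) gam := by
    refine hint.mono' hcont.aestronglyMeasurable (Eventually.of_forall fun z => ?_)
    rw [Real.norm_of_nonneg (by positivity)]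
    exact hbound z
  refine ⟨hi, (integral_mono hi hint hbound).trans ?_⟩
  simp only [Pi.add_apply]
  rw [integral_const_mul, integral_add hi1 hi2, integral_const_mul ε, integral_const_mul (C / r),
    integral_scaled_gaussian β hN0 x, integral_scaled_gaussian b hN0 x]
  change |V x - μ| * (ε * J β + C / r * J b) ≤ |V x - μ| / 2
  have h1 : ε * J β ≤ 1 / 4 := by
    rw [hε, inv_mul_le_iff₀ (by have := hJ0 β; positivity)]
    linarith
  have h2 : C / r * J b ≤ 1 / 4 := by
    rw [div_mul_eq_mul_div, div_le_iff₀ (by linarith)]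
    linarith
  have h3 : ε * J β + C / r * J b ≤ 1 / 2 := by linarith
  have h4 := mul_le_mul_of_nonneg_left h3 (abs_nonneg (V x - μ))
  linarith

/-- The local inequality satisfied by `x ↦ ‖R k_x‖` for a projection `R` that commutes with the
Berezin-Toeplitz operator and on whose range the operator is on one side of `μ`. -/
theorem mul_norm_apply_coherent_le (hV : PotentialAssumption V μ δ) (hN : 0 < N)
    {R : fock N →L[ℂ] fock N} (hRR : ∀ u, R (R u) = R u)
    (hsym : ∀ u v, inner ℂ (R u) v = inner ℂ u (R v))
    (hcomm : ∀ u : (toeplitz N V).domain, ∃ h : R u ∈ (toeplitz N V).domain,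
      toeplitz N V ⟨R u, h⟩ = R (toeplitz N V u)) {s : ℝ} (hs : |s| = 1)
    (hle : ∀ u : (toeplitz N V).domain, R u = u → s * energy V μ (u : fock N) ≤ 0)
    {ρ : ℂ → ℝ} (hρ : ∀ z, ‖R (coherent hN z)‖ ≤ ρ z) (x : ℂ)
    (hi : Integrable (fun z => |V z - V x| * ‖bargmannKernel N x z‖ * ρ z) gam) :
    s * (V x - μ) * ‖R (coherent hN x)‖
      ≤ ∫ z, |V z - V x| * ‖bargmannKernel N x z‖ * ρ z ∂gam := by
  set I := ∫ z, |V z - V x| * ‖bargmannKernel N x z‖ * ρ z ∂gam with hI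
  have hρ0 : ∀ z, 0 ≤ ρ z := fun z => (norm_nonneg _).trans (hρ z)
  have hI0 : 0 ≤ I := integral_nonneg fun z => mul_nonneg (by positivity) (hρ0 z)
  set k := coherent hN x with hk
  set a := ‖R k‖ with ha
  obtain ⟨hkd, hkT⟩ := hV.coherent_mem_domain hN x
  obtain ⟨hRd, hRT⟩ := hcomm ⟨k, hkd⟩
  simp only at hRd hRT
  -- Commutation and idempotence remove one `R`, so that the explicit function `V k_x` appears on
  -- the right.
  have h1 : inner ℂ (R k) (toeplitz N V ⟨R k, hRd⟩) = inner ℂ (R k) (toeplitz N V ⟨k, hkd⟩) := by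
    rw [hRT, ← hsym, hRR]
  have h2 : (inner ℂ (R k) k).re = a ^ 2 := by
    rw [ha, ← re_inner_self, hsym (k) (R k), hRR, hsym]
  have h3 := hV.inner_sub_eq hN (hV.domain_le_formDomain hRd) ⟨k, hkd⟩ (V x)
  have h4 : ‖∫ z, conj (val (R k) z) * ((V z - V x : ℝ) * val k z) ∂gam‖ ≤ a * I := by
    rw [hI, ← integral_const_mul]
    refine norm_integral_le_of_norm_le (hi.const_mul a) (Eventually.of_forall fun z => ?_)
    have hkz : ‖val k z‖ = ‖bargmannKernel N x z‖ := by
      rw [hk, val_coherent, ← conj_bargmannKernel, RCLike.norm_conj]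
    rw [norm_mul, norm_mul, RCLike.norm_conj, Complex.norm_real, Real.norm_eq_abs, hkz]
    -- `(R k_x)(z) = ⟨k_z, R k_x⟩ = ⟨R k_z, R k_x⟩`: the same quantity at `z` reappears, and the
    -- inequality closes on itself.
    have h5 : ‖val (R k) z‖ ≤ a * ρ z := by
      rw [← inner_coherent hN, ← hRR, ← hsym, mul_comm]
      exact (norm_inner_le_norm (𝕜 := ℂ) _ _).trans
        (mul_le_mul_of_nonneg_right (hρ z) (norm_nonneg _))
    calc _ ≤ a * ρ z * (|V z - V x| * ‖bargmannKernel N x z‖) :=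
        mul_le_mul_of_nonneg_right h5 (by positivity)
      _ = _ := by ring
  have h6 : s * energy V μ (R k) ≤ 0 := hle ⟨R k, hRd⟩ (hRR k)
  rw [← hV.re_inner_toeplitz hN ⟨R k, hRd⟩] at h6
  simp only at h6
  rw [h1] at h6
  have h7 : (inner ℂ (R k) (toeplitz N V ⟨k, hkd⟩) - V x * inner ℂ (R k) k).re
      = (inner ℂ (R k) (toeplitz N V ⟨k, hkd⟩)).re - V x * a ^ 2 := by
    rw [Complex.sub_re, Complex.re_ofReal_mul, h2]
  have h8 : |(inner ℂ (R k) (toeplitz N V ⟨k, hkd⟩)).re - V x * a ^ 2| ≤ a * I := by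
    rw [← h7]
    refine (Complex.abs_re_le_norm _).trans ?_
    rw [h3]
    exact h4
  have h9 : s * (V x - μ) * a ^ 2 ≤ a * I := by
    have h10 : -(s * ((inner ℂ (R k) (toeplitz N V ⟨k, hkd⟩)).re - V x * a ^ 2)) ≤ a * I := by
      refine (neg_le_abs _).trans ?_
      rw [abs_mul, hs, one_mul]
      exact h8
    linarith
  rcases (norm_nonneg (R k)).eq_or_lt with h0 | h0
  · rw [ha, ← h0, mul_zero]
    exact hI0
  · refine le_of_mul_le_mul_left ?_ h0
    linarith

/-- Exponential decay of `x ↦ ‖R k_x‖` in the region where the potential is on the wrong side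
of `μ`. -/
theorem norm_apply_coherent_le (hV : PotentialAssumption V μ δ) (hN : 0 < N)
    {R : fock N →L[ℂ] fock N} (hRR : ∀ u, R (R u) = R u)
    (hsym : ∀ u v, inner ℂ (R u) v = inner ℂ u (R v))
    (hcomm : ∀ u : (toeplitz N V).domain, ∃ h : R u ∈ (toeplitz N V).domain,
      toeplitz N V ⟨R u, h⟩ = R (toeplitz N V u)) {s : ℝ} (hs : |s| = 1)
    (hle : ∀ u : (toeplitz N V).domain, R u = u → s * energy V μ (u : fock N) ≤ 0)
    {σ c : ℝ} (hσ : 0 ≤ σ) (hc : 0 < c)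
    (hosc : ∀ x, c ≤ s * (V x - μ) → Integrable (fun z => |V z - V x| * ‖bargmannKernel N x z‖ *
        Real.exp (σ * ‖x - z‖)) gam ∧
      ∫ z, |V z - V x| * ‖bargmannKernel N x z‖ * Real.exp (σ * ‖x - z‖) ∂gam
        ≤ s * (V x - μ) / 2) (x₀ : ℂ) :
    ‖R (coherent hN x₀)‖
      ≤ Real.sqrt N * Real.exp (-(σ * Metric.infDist x₀ {z | s * (V z - μ) < c})) := by
  set D : Set ℂ := {z | s * (V z - μ) < c} with hD
  -- Capping the distance keeps the weight bounded, so that the supremum `S` below is finite,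
  -- without changing its value at `x₀`.
  set w : ℂ → ℝ := fun x => min (Metric.infDist x D) (Metric.infDist x₀ D) with hw
  have hw0 : ∀ x, 0 ≤ w x := fun x => le_min Metric.infDist_nonneg Metric.infDist_nonneg
  have hwlip : ∀ x z, w x ≤ w z + ‖x - z‖ := by
    intro x z
    have h1 : Metric.infDist x D ≤ Metric.infDist z D + dist x z := Metric.infDist_le_infDist_add_dist
    rw [dist_eq_norm] at h1
    rcases min_cases (Metric.infDist z D) (Metric.infDist x₀ D) with ⟨h2, -⟩ | ⟨h2, -⟩
    · have : w x ≤ Metric.infDist x D := min_le_left _ _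
      simp only [hw] at *
      linarith
    · have : w x ≤ Metric.infDist x₀ D := min_le_right _ _
      simp only [hw] at *
      linarith [norm_nonneg (x - z)]
  have hR1 : ∀ u, ‖R u‖ ≤ ‖u‖ := by
    intro u
    rcases (norm_nonneg (R u)).eq_or_lt with h0 | h0
    · rw [← h0]; exact norm_nonneg _
    · refine le_of_mul_le_mul_left ?_ h0
      rw [← sq, ← re_inner_self, hsym, hRR, ← hsym]
      exact (Complex.re_le_norm _).trans (norm_inner_le_norm (𝕜 := ℂ) _ _)
  have hρ1 : ∀ x, ‖R (coherent hN x)‖ ≤ Real.sqrt N := fun x =>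
    (hR1 _).trans (norm_coherent hN x).le
  set f : ℂ → ℝ := fun x => ‖R (coherent hN x)‖ * Real.exp (σ * w x) with hf
  have hfb : BddAbove (Set.range f) := by
    refine ⟨Real.sqrt N * Real.exp (σ * Metric.infDist x₀ D), ?_⟩
    rintro _ ⟨x, rfl⟩
    refine mul_le_mul (hρ1 x) (Real.exp_le_exp.2 ?_) (Real.exp_pos _).le (Real.sqrt_nonneg _)
    exact mul_le_mul_of_nonneg_left (min_le_right _ _) hσ
  set S := ⨆ x, f x with hS
  have hfS : ∀ x, f x ≤ S := fun x => le_ciSup hfb x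
  have hS0 : 0 ≤ S := le_trans (by positivity) (hfS x₀)
  have hρS : ∀ z, ‖R (coherent hN z)‖ ≤ S * Real.exp (-(σ * w z)) := by
    intro z
    rw [Real.exp_neg, ← div_eq_mul_inv, le_div_iff₀ (Real.exp_pos _)]
    exact hfS z
  -- On `D` the weight is one and the trivial bound applies. Elsewhere, inserting the bound by `S`
  -- in the local inequality gains a factor `1 / 2`, because `w` is 1-Lipschitz. Hence `S ≤ √N`.
  have hstep : ∀ x, f x ≤ max (Real.sqrt N) (S / 2) := by
    intro x
    rcases lt_or_ge (s * (V x - μ)) c with hx | hx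
    · refine le_max_of_le_left ?_
      have h1 : Metric.infDist x D = 0 := Metric.infDist_zero_of_mem hx
      have h2 : w x = 0 := le_antisymm ((min_le_left _ _).trans h1.le) (hw0 x)
      simp only [hf, h2, mul_zero, Real.exp_zero, mul_one]
      exact hρ1 x
    · refine le_max_of_le_right ?_
      obtain ⟨hi, hi2⟩ := hosc x hx
      have h1 := hV.mul_norm_apply_coherent_le hN hRR hsym hcomm hs hle
        (ρ := fun z => S * Real.exp (-(σ * w x)) * Real.exp (σ * ‖x - z‖)) (fun z => by
          refine (hρS z).trans ?_
          rw [mul_assoc, ← Real.exp_add]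
          refine mul_le_mul_of_nonneg_left (Real.exp_le_exp.2 ?_) hS0
          have := mul_le_mul_of_nonneg_left (hwlip x z) hσ
          linarith) x ((hi.const_mul (S * Real.exp (-(σ * w x)))).congr
            (Eventually.of_forall fun z => by ring))
      have e : ∀ z, |V z - V x| * ‖bargmannKernel N x z‖ *
          (S * Real.exp (-(σ * w x)) * Real.exp (σ * ‖x - z‖)) = S * Real.exp (-(σ * w x)) *
          (|V z - V x| * ‖bargmannKernel N x z‖ * Real.exp (σ * ‖x - z‖)) := fun z => by ring
      simp only [e, integral_const_mul] at h1
      have hpos : 0 < s * (V x - μ) := hc.trans_le hx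
      have h2 : s * (V x - μ) * ‖R (coherent hN x)‖
          ≤ s * (V x - μ) * (S / 2 * Real.exp (-(σ * w x))) := by
        refine h1.trans ((mul_le_mul_of_nonneg_left hi2 (by positivity)).trans (le_of_eq ?_))
        ring
      have h3 := le_of_mul_le_mul_left h2 hpos
      rwa [Real.exp_neg, ← div_eq_mul_inv, le_div_iff₀ (Real.exp_pos _)] at h3
  have hSN : S ≤ Real.sqrt N := by
    have h1 : S ≤ max (Real.sqrt N) (S / 2) := ciSup_le hstep
    rcases le_max_iff.1 h1 with h | h
    · exact h
    · have : S ≤ 0 := by linarith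
      exact this.trans (Real.sqrt_nonneg _)
  have h1 := hρS x₀
  have h2 : w x₀ = Metric.infDist x₀ D := min_self _
  rw [h2] at h1
  exact h1.trans (mul_le_mul_of_nonneg_right hSN (Real.exp_pos _).le)

end PotentialAssumption

end

section

/-! ### The density of the spectral projection -/

variable {V : ℂ → ℝ} {μ δ N : ℝ}

/-- The diagonal of the kernel of the spectral projection. -/
def fermiDensity (V : ℂ → ℝ) (μ N : ℝ) (x : ℂ) : ℝ := (fermiKernel V μ N x x).re

namespace PotentialAssumption

theorem fermiKernel_eq_sum (hV : PotentialAssumption V μ δ) (hN : 0 < N) (x z : ℂ) :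
    have := hV.finiteDimensional_fermiSpace hN
    fermiKernel V μ N x z = ∑ k, val (stdOrthonormalBasis ℂ (fermiSpace V μ N) k : fock N) x *
      conj (val (stdOrthonormalBasis ℂ (fermiSpace V μ N) k : fock N) z) := by
  rw [fermiKernel, dif_pos (hV.finiteDimensional_fermiSpace hN)]

/-- Parseval in the range of `Π_N`: the coefficients of `Π_N k_x` are the conjugates of the point
values of the basis at `x`. -/
theorem fermiKernel_self (hV : PotentialAssumption V μ δ) (hN : 0 < N) (x : ℂ) :
    fermiKernel V μ N x x = ((‖fermiProjection V μ N (coherent hN x)‖ ^ 2 : ℝ) : ℂ) := by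
  have := hV.finiteDimensional_fermiSpace hN
  have hP := hV.fermiProjection_spec hN
  set P := fermiProjection V μ N with hPdef
  set b := stdOrthonormalBasis ℂ (fermiSpace V μ N) with hb
  have hmem : P (coherent hN x) ∈ fermiSpace V μ N :=
    LinearMap.mem_range_self (P : fock N →ₗ[ℂ] fock N) _
  have hfix : ∀ k, P (b k : fock N) = b k := by
    intro k
    obtain ⟨u, hu⟩ := (b k).2
    rw [← hu]
    exact hP.apply_apply u
  have h1 := b.sum_sq_norm_inner_right ⟨P (coherent hN x), hmem⟩
  rw [hV.fermiKernel_eq_sum hN]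
  have e : ‖P (coherent hN x)‖ ^ 2 = ∑ k, ‖val (b k : fock N) x‖ ^ 2 := by
    refine Eq.trans h1.symm (Finset.sum_congr rfl fun k _ => ?_)
    have h2 : inner ℂ (b k) (⟨P (coherent hN x), hmem⟩ : fermiSpace V μ N)
        = inner ℂ (b k : fock N) (coherent hN x) := by
      rw [← hfix k, hP.inner_apply]
      rfl
    rw [h2, norm_inner_symm, inner_coherent]
  rw [e]
  push_cast
  exact Finset.sum_congr rfl fun k _ => Complex.mul_conj' _

theorem fermiDensity_eq (hV : PotentialAssumption V μ δ) (hN : 0 < N) (x : ℂ) :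
    fermiDensity V μ N x = ‖fermiProjection V μ N (coherent hN x)‖ ^ 2 := by
  rw [fermiDensity, hV.fermiKernel_self hN, Complex.ofReal_re]

theorem fermiKernel_self_eq (hV : PotentialAssumption V μ δ) (hN : 0 < N) (x : ℂ) :
    fermiKernel V μ N x x = (fermiDensity V μ N x : ℂ) := by
  rw [hV.fermiDensity_eq hN, hV.fermiKernel_self hN]

theorem fermiDensity_nonneg (hV : PotentialAssumption V μ δ) (hN : 0 < N) (x : ℂ) :
    0 ≤ fermiDensity V μ N x := by
  rw [hV.fermiDensity_eq hN]
  positivity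

theorem sub_fermiDensity_eq (hV : PotentialAssumption V μ δ) (hN : 0 < N) (x : ℂ) :
    N - fermiDensity V μ N x = ‖coherent hN x - fermiProjection V μ N (coherent hN x)‖ ^ 2 := by
  have hP := hV.fermiProjection_spec hN
  set P := fermiProjection V μ N with hPdef
  set k := coherent hN x with hk
  have h1 : inner ℂ (P k) (k - P k) = 0 := by
    rw [inner_sub_right, hP.inner_apply, hP.inner_apply, hP.apply_apply, sub_self]
  have h2 := norm_add_sq_eq_norm_sq_add_norm_sq_of_inner_eq_zero (𝕜 := ℂ) _ _ h1
  rw [add_sub_cancel] at h2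
  have h3 : ‖k‖ ^ 2 = N := norm_sq_coherent hN x
  rw [hV.fermiDensity_eq hN]
  linarith

/-- The level sets of `V` are at positive distance from each other. -/
theorem exists_le_infDist (hV : PotentialAssumption V μ δ) {s c : ℝ} (hs : |s| = 1) (hc : 0 < c) :
    ∃ r : ℝ, 0 < r ∧ ∀ x, 2 * c ≤ s * (V x - μ) →
      r ≤ Metric.infDist x {z | s * (V z - μ) < c} := by
  obtain ⟨K, hK0, hK⟩ := hV.exists_relative_modulus hc
  obtain ⟨C, hC0, hC⟩ := hK (1 / 4) (by norm_num)
  -- At distance less than this `r ≤ 1`, the relative oscillation is at most `1 / 4 + 1 / 4`, so `s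
  -- (V z - μ)` keeps at least half of its value at `x` and cannot fall below `c`.
  refine ⟨(4 * C * Real.exp K + 5)⁻¹, by positivity, fun x hx => ?_⟩
  set r := (4 * C * Real.exp K + 5)⁻¹ with hr
  have hr0 : 0 < r := by positivity
  have hr1 : r ≤ 1 := by
    rw [hr]
    exact inv_le_one_of_one_le₀ (by nlinarith [mul_nonneg hC0 (Real.exp_pos K).le])
  obtain ⟨z₀, hz₀⟩ := hV.connected_level.nonempty
  -- Non-emptiness matters because `Metric.infDist` to the empty set is `0` by convention.
  have hne : {z | s * (V z - μ) < c}.Nonempty := ⟨z₀, by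
    have : V z₀ = μ := hz₀
    simpa [this] using hc⟩
  refine (Metric.le_infDist hne).2 fun z hz => ?_
  have hz' : s * (V z - μ) < c := hz
  by_contra! hlt
  rw [dist_eq_norm] at hlt
  have habs : |V x - μ| = s * (V x - μ) := by
    rw [← abs_of_pos (show 0 < s * (V x - μ) by linarith), abs_mul, hs, one_mul]
  have h1 := hC x (by rw [habs]; linarith) z
  have h2 : s * (V x - μ) - c < |V z - V x| := by
    have h3 : s * (V x - V z) ≤ |V z - V x| := by
      refine (le_abs_self _).trans ?_
      rw [abs_mul, hs, one_mul, abs_sub_comm]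
    linarith
  set t := ‖x - z‖ with ht
  have ht0 : 0 ≤ t := norm_nonneg _
  have h4 : C * (t * Real.exp (K * t)) ≤ 1 / 4 := by
    have h5 : Real.exp (K * t) ≤ Real.exp K :=
      Real.exp_le_exp.2 (mul_le_of_le_one_right hK0 (hlt.le.trans hr1))
    calc C * (t * Real.exp (K * t)) ≤ C * (r * Real.exp K) := by gcongr
      _ ≤ 1 / 4 := by
        rw [hr, inv_mul_eq_div, mul_div_assoc', div_le_iff₀ (by positivity)]
        linarith
  have h6 : |V x - μ| * (1 / 4 + C * (t * Real.exp (K * t))) ≤ |V x - μ| * (1 / 2) :=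
    mul_le_mul_of_nonneg_left (by linarith) (abs_nonneg _)
  rw [habs] at h6 h1
  linarith

theorem exists_norm_fermiProjection_le (hV : PotentialAssumption V μ δ) {c β : ℝ} (hc : 0 < c)
    (hβ : 0 ≤ β) : ∃ N₀ : ℝ, 1 ≤ N₀ ∧ ∀ N, N₀ ≤ N → ∀ (hN : 0 < N) (x : ℂ),
      ‖fermiProjection V μ N (coherent hN x)‖ ≤ Real.sqrt N *
        Real.exp (-(β * Real.sqrt N * Metric.infDist x {z | 1 * (V z - μ) < c})) := by
  obtain ⟨N₀, hN₀, h⟩ := hV.exists_integral_oscillation_le hc β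
  refine ⟨N₀, hN₀, fun N hNN hN x => ?_⟩
  have hP := hV.fermiProjection_spec hN
  refine hV.norm_apply_coherent_le hN hP.apply_apply hP.inner_apply hP.commutes (s := 1)
    (by norm_num) (fun u hu => ?_) (by positivity) hc (fun x hx => ?_) x
  · have := hP.le_on_range u hu
    rw [one_mul, ← hV.re_inner_toeplitz hN u]
    linarith
  · have habs : |V x - μ| = 1 * (V x - μ) := by
      rw [one_mul] at hx ⊢
      exact abs_of_pos (hc.trans_le hx)
    rw [← habs] at hx ⊢
    exact h N hNN x hx

theorem exists_norm_sub_fermiProjection_le (hV : PotentialAssumption V μ δ) {c β : ℝ}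
    (hc : 0 < c) (hβ : 0 ≤ β) : ∃ N₀ : ℝ, 1 ≤ N₀ ∧ ∀ N, N₀ ≤ N → ∀ (hN : 0 < N) (x : ℂ),
      ‖coherent hN x - fermiProjection V μ N (coherent hN x)‖ ≤ Real.sqrt N *
        Real.exp (-(β * Real.sqrt N * Metric.infDist x {z | -1 * (V z - μ) < c})) := by
  obtain ⟨N₀, hN₀, h⟩ := hV.exists_integral_oscillation_le hc β
  refine ⟨N₀, hN₀, fun N hNN hN x => ?_⟩
  have hP := hV.fermiProjection_spec hN
  obtain ⟨R, hR⟩ : ∃ R : fock N →L[ℂ] fock N, ∀ u, R u = u - fermiProjection V μ N u :=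
    ⟨ContinuousLinearMap.id ℂ _ - fermiProjection V μ N, fun u => rfl⟩
  rw [← hR]
  refine hV.norm_apply_coherent_le hN (R := R) (fun u => ?_) (fun u v => ?_) (fun u => ?_)
    (s := -1) (by norm_num) (fun u hu => ?_) (by positivity) hc (fun x hx => ?_) x
  · rw [hR, hR, map_sub, hP.apply_apply, sub_self, sub_zero]
  · rw [hR, hR, inner_sub_left, inner_sub_right, hP.inner_apply]
  · simp only [hR]
    exact hP.sub_commutes u
  · have hu' : fermiProjection V μ N (u : fock N) = 0 := by simpa [hR] using hu
    rw [← hV.re_inner_toeplitz hN u]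
    rcases eq_or_ne (u : fock N) 0 with h0 | h0
    · simp [h0]
    · have := hP.gt_on_ker u hu' h0
      linarith
  · have habs : |V x - μ| = -1 * (V x - μ) := by
      rw [neg_one_mul] at hx ⊢
      exact abs_of_neg (by linarith)
    rw [← habs] at hx ⊢
    exact h N hNN x hx

/-- The rate is taken one unit larger than needed, and the surplus `exp (-√N)` absorbs the prefactor
`N ≤ 2 exp √N`. -/
theorem sq_mul_exp_le {β r d a : ℝ} (hN : 0 < N) (hr : r ≤ d) (h : 2 * (β * r) = a + 1)
    (hβ : 0 ≤ β) :
    (Real.sqrt N * Real.exp (-(β * Real.sqrt N * d))) ^ 2 ≤ 2 * Real.exp (-(a * Real.sqrt N)) := by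
  have hs := Real.sqrt_nonneg N
  have h1 : Real.sqrt N ^ 2 ≤ 2 * Real.exp (Real.sqrt N) := by
    have := Real.quadratic_le_exp_of_nonneg hs
    linarith
  rw [mul_pow, ← Real.exp_nat_mul]
  calc Real.sqrt N ^ 2 * Real.exp ((2 : ℕ) * -(β * Real.sqrt N * d))
      ≤ 2 * Real.exp (Real.sqrt N) * Real.exp (-((a + 1) * Real.sqrt N)) := by
        gcongr
        rw [← h]
        push_cast
        have : β * Real.sqrt N * r ≤ β * Real.sqrt N * d :=
          mul_le_mul_of_nonneg_left hr (by positivity)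
        linarith
    _ = _ := by rw [mul_assoc, ← Real.exp_add]; congr 2; ring

/-- Uniform asymptotics of the density away from the edge. -/
theorem exists_fermiDensity_sub_le (hV : PotentialAssumption V μ δ) {c α : ℝ} (hc : 0 < c)
    (hα : 0 < α) : ∃ N₀ : ℝ, 1 ≤ N₀ ∧ ∀ N, N₀ ≤ N → ∀ x, c ≤ |V x - μ| →
      |fermiDensity V μ N x - N * (droplet V μ).indicator (fun _ => (1 : ℝ)) x|
        ≤ 2 * Real.exp (-(α * Real.sqrt N)) := by
  -- The decay is measured from the region at level `c / 2`, which the points at level `c` stay away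
  -- from by a fixed distance.
  have hc2 : 0 < c / 2 := half_pos hc
  obtain ⟨r₁, hr₁, h₁⟩ := hV.exists_le_infDist (s := 1) (by norm_num) hc2
  obtain ⟨r₂, hr₂, h₂⟩ := hV.exists_le_infDist (s := -1) (by norm_num) hc2
  obtain ⟨N₁, hN₁, h₃⟩ := hV.exists_norm_fermiProjection_le hc2
    (show 0 ≤ (α + 1) / (2 * r₁) by positivity)
  obtain ⟨N₂, hN₂, h₄⟩ := hV.exists_norm_sub_fermiProjection_le hc2
    (show 0 ≤ (α + 1) / (2 * r₂) by positivity)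
  refine ⟨max N₁ N₂, le_max_of_le_left hN₁, fun N hN x hx => ?_⟩
  have hN1 : N₁ ≤ N := (le_max_left _ _).trans hN
  have hN2 : N₂ ≤ N := (le_max_right _ _).trans hN
  have hN0 : 0 < N := by linarith
  rcases lt_or_ge (V x) μ with hlt | hge
  · rw [abs_of_neg (by linarith)] at hx
    have hmem : x ∈ droplet V μ := hlt
    rw [Set.indicator_of_mem hmem, mul_one, abs_sub_comm, hV.sub_fermiDensity_eq hN0,
      abs_of_nonneg (by positivity)]
    refine (pow_le_pow_left₀ (norm_nonneg _) (h₄ N hN2 hN0 x) 2).trans ?_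
    exact sq_mul_exp_le hN0 (h₂ x (by linarith)) (by field_simp) (by positivity)
  · rw [abs_of_nonneg (by linarith)] at hx
    have hmem : x ∉ droplet V μ := fun h => absurd hge (not_le.2 h)
    rw [Set.indicator_of_notMem hmem, mul_zero, sub_zero, hV.fermiDensity_eq hN0,
      abs_of_nonneg (by positivity)]
    refine (pow_le_pow_left₀ (norm_nonneg _) (h₃ N hN1 hN0 x) 2).trans ?_
    exact sq_mul_exp_le hN0 (h₁ x (by linarith)) (by field_simp) (by positivity)

/-- Domination of the density by an exponential. -/
theorem exists_fermiDensity_le_exp (hV : PotentialAssumption V μ δ) {a : ℝ} (ha : 0 ≤ a) :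
    ∃ C N₀ : ℝ, 0 ≤ C ∧ 1 ≤ N₀ ∧ ∀ N, N₀ ≤ N → ∀ x,
      fermiDensity V μ N x ≤ N * (C * Real.exp (-(a * ‖x‖))) := by
  obtain ⟨R, hR⟩ := hV.compact_sublevel.isBounded.exists_norm_le
  obtain ⟨N₁, hN₁, h⟩ := hV.exists_norm_fermiProjection_le hV.pos zero_le_one
  -- The set `{V < μ + δ}` lies in the ball of radius `R`, so the distance to it is at least `‖x‖ -
  -- R`; for `√N ≥ a` the decay rate is at least `a`.
  refine ⟨Real.exp (a * R), max N₁ (a ^ 2), (Real.exp_pos _).le, le_max_of_le_left hN₁,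
    fun N hN x => ?_⟩
  have hN1 : N₁ ≤ N := (le_max_left _ _).trans hN
  have hN0 : 0 < N := by linarith
  have hsq : a ≤ Real.sqrt N := Real.le_sqrt_of_sq_le ((le_max_right _ _).trans hN)
  obtain ⟨z₀, hz₀⟩ := hV.connected_level.nonempty
  set D : Set ℂ := {z | 1 * (V z - μ) < δ} with hD
  have hne : D.Nonempty := ⟨z₀, by
    have : V z₀ = μ := hz₀
    simpa [hD, this] using hV.pos⟩
  have hdist : ‖x‖ - R ≤ Metric.infDist x D := by
    refine (Metric.le_infDist hne).2 fun z hz => ?_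
    have hz' : 1 * (V z - μ) < δ := hz
    have h1 : ‖z‖ ≤ R := hR z (show V z ≤ μ + δ by linarith)
    rw [dist_eq_norm]
    have := norm_sub_norm_le x z
    linarith
  rw [hV.fermiDensity_eq hN0]
  refine (pow_le_pow_left₀ (norm_nonneg _) (h N hN1 hN0 x) 2).trans ?_
  rw [mul_pow, Real.sq_sqrt hN0.le, ← Real.exp_nat_mul, ← Real.exp_add]
  refine mul_le_mul_of_nonneg_left (Real.exp_le_exp.2 ?_) hN0.le
  have hd0 : 0 ≤ Metric.infDist x D := Metric.infDist_nonneg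
  have h1 : a * Metric.infDist x D ≤ Real.sqrt N * Metric.infDist x D :=
    mul_le_mul_of_nonneg_right hsq hd0
  have h2 := mul_le_mul_of_nonneg_left hdist ha
  have h3 : 0 ≤ Real.sqrt N * Metric.infDist x D := by positivity
  push_cast
  linarith

end PotentialAssumption

end

section

/-! ### Determinantal densities -/

section Determinantal

/-- The determinant of a matrix that differs from the identity in a few rows. -/
theorem det_rows_eq_det_submatrix {ι κ : Type*} [Fintype ι] [DecidableEq ι] [Fintype κ]
    [DecidableEq κ] (G : Matrix ι ι ℂ) {s : κ → ι} (hs : Function.Injective s) :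
    (Matrix.of fun j k => if j ∈ Finset.univ.image s then G j k
      else (1 : Matrix ι ι ℂ) j k).det = (G.submatrix s s).det := by
  set U : Matrix ι κ ℂ := Matrix.of fun j c => if j = s c then 1 else 0 with hU
  set W : Matrix κ ι ℂ := Matrix.of fun c k => G (s c) k - (1 : Matrix ι ι ℂ) (s c) k with hW
  -- The matrix is a perturbation `1 + U W` of the identity through the smaller index set, and
  -- Sylvester's identity exchanges the two factors.
  have h1 : (Matrix.of fun j k => if j ∈ Finset.univ.image s then G j k
      else (1 : Matrix ι ι ℂ) j k) = 1 + U * W := by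
    ext j k
    rw [Matrix.add_apply, Matrix.mul_apply]
    simp only [hU, hW, Matrix.of_apply, ite_mul, one_mul, zero_mul]
    by_cases hj : j ∈ Finset.univ.image s
    · obtain ⟨c, -, rfl⟩ := Finset.mem_image.1 hj
      simp [hs.eq_iff]
    · rw [if_neg hj]
      have : ∀ c, j ≠ s c := fun c h => hj (h ▸ Finset.mem_image_of_mem s (Finset.mem_univ c))
      simp [this]
  have h2 : G.submatrix s s = 1 + W * U := by
    ext c c'
    rw [Matrix.add_apply, Matrix.mul_apply]
    simp [hU, hW, Matrix.one_apply, hs.eq_iff]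
  rw [h1, h2, Matrix.det_one_add_mul_comm]

variable {X : Type*} {n : ℕ}

/-- The square modulus of a Slater determinant, normalized to a probability density. -/
def slaterDensity (φ : Fin n → X → ℂ) (x : Fin n → X) : ℝ :=
  ‖(Matrix.of fun i k => φ k (x i)).det‖ ^ 2 / n.factorial

theorem slaterDensity_nonneg (φ : Fin n → X → ℂ) (x : Fin n → X) : 0 ≤ slaterDensity φ x := by
  unfold slaterDensity
  positivity

/-- The kernel matrix factors as `A Aᴴ` with `A` the Slater matrix; in particular its determinant is
real and non-negative. -/
theorem det_kernel_eq (φ : Fin n → X → ℂ) (x : Fin n → X) :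
    (Matrix.of fun i j => ∑ k, φ k (x i) * conj (φ k (x j))).det
      = ((‖(Matrix.of fun i k => φ k (x i)).det‖ ^ 2 : ℝ) : ℂ) := by
  set A : Matrix (Fin n) (Fin n) ℂ := Matrix.of fun i k => φ k (x i) with hA
  have h : (Matrix.of fun i j => ∑ k, φ k (x i) * conj (φ k (x j))) = A * A.conjTranspose := by
    ext i j
    simp [Matrix.mul_apply, hA]
  rw [h, Matrix.det_mul, Matrix.det_conjTranspose, Complex.star_def, Complex.mul_conj']
  push_cast
  rfl

/-- Two Leibniz expansions separate the variables, so that Fubini applies to each term. -/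
theorem norm_sq_det_eq_sum (φ : Fin n → X → ℂ) (h : Fin n → X → ℂ) (x : Fin n → X) :
    (∏ j, h j (x j)) * ((‖(Matrix.of fun i k => φ k (x i)).det‖ ^ 2 : ℝ) : ℂ)
      = ∑ σ : Equiv.Perm (Fin n), ∑ τ : Equiv.Perm (Fin n),
        ((Equiv.Perm.sign σ : ℤ) : ℂ) * ((Equiv.Perm.sign τ : ℤ) : ℂ) *
          ∏ j, (h j (x j) * (φ (σ j) (x j) * conj (φ (τ j) (x j)))) := by
  have h1 : (Matrix.of fun i k => φ k (x i)).det
      = ∑ σ : Equiv.Perm (Fin n), ((Equiv.Perm.sign σ : ℤ) : ℂ) * ∏ j, φ (σ j) (x j) := by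
    rw [← Matrix.det_transpose, Matrix.det_apply']
    rfl
  have h2 : conj (Matrix.of fun i k => φ k (x i)).det
      = ∑ σ : Equiv.Perm (Fin n), ((Equiv.Perm.sign σ : ℤ) : ℂ) * ∏ j, conj (φ (σ j) (x j)) := by
    rw [h1]
    simp [map_sum, map_prod]
  have h3 : ((‖(Matrix.of fun i k => φ k (x i)).det‖ ^ 2 : ℝ) : ℂ)
      = (Matrix.of fun i k => φ k (x i)).det * conj (Matrix.of fun i k => φ k (x i)).det := by
    rw [Complex.mul_conj']; push_cast; rfl
  rw [h3, h2, h1, Finset.sum_mul_sum, Finset.mul_sum]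
  refine Finset.sum_congr rfl fun σ _ => ?_
  rw [Finset.mul_sum]
  refine Finset.sum_congr rfl fun τ _ => ?_
  simp only [Finset.prod_mul_distrib]
  ring

variable [MeasurableSpace X] {ν : Measure X} [SigmaFinite ν] {φ : Fin n → X → ℂ}

/-- A version of the Andréief identity. -/
theorem integral_prod_mul_norm_sq_det (h : Fin n → X → ℂ)
    (hi : ∀ j k l, Integrable (fun y => h j y * (φ k y * conj (φ l y))) ν) :
    Integrable (fun x : Fin n → X => (∏ j, h j (x j)) *
      ((‖(Matrix.of fun i k => φ k (x i)).det‖ ^ 2 : ℝ) : ℂ)) (Measure.pi fun _ => ν) ∧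
    ∫ x : Fin n → X, (∏ j, h j (x j)) *
      ((‖(Matrix.of fun i k => φ k (x i)).det‖ ^ 2 : ℝ) : ℂ) ∂(Measure.pi fun _ => ν)
      = ∑ σ : Equiv.Perm (Fin n), (Matrix.of fun j k =>
        ∫ y, h j y * (φ (σ j) y * conj (φ (σ k) y)) ∂ν).det := by
  have hprod : ∀ σ τ : Equiv.Perm (Fin n), Integrable (fun x : Fin n → X =>
      ∏ j, (h j (x j) * (φ (σ j) (x j) * conj (φ (τ j) (x j))))) (Measure.pi fun _ => ν) :=
    fun σ τ => Integrable.fintype_prod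
      (f := fun j y => h j y * (φ (σ j) y * conj (φ (τ j) y))) fun j => hi j (σ j) (τ j)
  simp only [norm_sq_det_eq_sum]
  refine ⟨integrable_finsetSum _ fun σ _ => integrable_finsetSum _ fun τ _ =>
    (hprod σ τ).const_mul _, ?_⟩
  rw [integral_finsetSum _ fun σ _ => integrable_finsetSum _ fun τ _ => (hprod σ τ).const_mul _]
  refine Finset.sum_congr rfl fun σ _ => ?_
  -- Reindexing by `τ = σ π` leaves the sign of `π` alone, and the sum over `π` is the Leibniz
  -- expansion of the determinant.
  rw [integral_finsetSum _ fun τ _ => (hprod σ τ).const_mul _, ← Matrix.det_transpose,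
    Matrix.det_apply', ← Equiv.sum_comp (Equiv.mulLeft σ)]
  refine Finset.sum_congr rfl fun π _ => ?_
  rw [integral_const_mul, integral_fintype_prod_eq_prod
    (f := fun j y => h j y * (φ (σ j) y * conj (φ (Equiv.mulLeft σ π j) y)))]
  have hsign : ((Equiv.Perm.sign σ : ℤ) : ℂ) * ((Equiv.Perm.sign (Equiv.mulLeft σ π) : ℤ) : ℂ)
      = ((Equiv.Perm.sign π : ℤ) : ℂ) := by
    rw [Equiv.coe_mulLeft, Equiv.Perm.sign_mul, ← Int.cast_mul, ← Units.val_mul, ← mul_assoc,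
      Int.units_mul_self, one_mul]
  rw [hsign]
  rfl

end Determinantal

end

section

/-! ### Linear statistics of determinantal processes -/

section LinearStatistics

variable {X : Type*} {n : ℕ} [MeasurableSpace X] {ν : Measure X} {φ : Fin n → X → ℂ} {f : X → ℝ}

/-- The matrix of the multiplication by `f` in the system `φ`. -/
def multiplicationMatrix (ν : Measure X) (φ : Fin n → X → ℂ) (f : X → ℝ) :
    Matrix (Fin n) (Fin n) ℂ :=
  Matrix.of fun k l => ∫ y, (f y : ℂ) * (φ k y * conj (φ l y)) ∂ν

theorem integrable_mul_mul_conj (hφ : ∀ k, AEStronglyMeasurable (φ k) ν)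
    (hf : AEStronglyMeasurable f ν) (hi : Integrable (fun y => f y * ∑ k, ‖φ k y‖ ^ 2) ν)
    (k l : Fin n) : Integrable (fun y => (f y : ℂ) * (φ k y * conj (φ l y))) ν := by
  have hf' : AEStronglyMeasurable (fun y => (f y : ℂ)) ν :=
    Complex.continuous_ofReal.comp_aestronglyMeasurable hf
  have hl : AEStronglyMeasurable (fun y => conj (φ l y)) ν :=
    Complex.continuous_conj.comp_aestronglyMeasurable (hφ l)
  refine hi.mono (hf'.mul ((hφ k).mul hl)) (Eventually.of_forall fun y => ?_)
  have h1 : ∀ j, ‖φ j y‖ ^ 2 ≤ ∑ k, ‖φ k y‖ ^ 2 := fun j =>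
    Finset.single_le_sum (f := fun k => ‖φ k y‖ ^ 2) (fun _ _ => by positivity)
      (Finset.mem_univ j)
  rw [norm_mul, norm_mul, norm_mul, Complex.norm_real, RCLike.norm_conj]
  refine mul_le_mul_of_nonneg_left ((le_of_eq rfl).trans ?_) (norm_nonneg _)
  rw [Real.norm_of_nonneg (Finset.sum_nonneg fun _ _ => by positivity)]
  nlinarith [h1 k, h1 l, sq_nonneg (‖φ k y‖ - ‖φ l y‖)]

theorem multiplicationMatrix_self (k : Fin n) :
    multiplicationMatrix ν φ f k k = ((∫ y, f y * ‖φ k y‖ ^ 2 ∂ν : ℝ) : ℂ) := by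
  rw [← integral_complex_ofReal]
  refine integral_congr_ae (Eventually.of_forall fun y => ?_)
  simp only [Complex.mul_conj']
  push_cast
  rfl

theorem multiplicationMatrix_conj (k l : Fin n) :
    multiplicationMatrix ν φ f l k = conj (multiplicationMatrix ν φ f k l) := by
  simp only [multiplicationMatrix, Matrix.of_apply]
  rw [← integral_conj]
  refine integral_congr_ae (Eventually.of_forall fun y => ?_)
  simp only [map_mul, Complex.conj_ofReal, Complex.conj_conj]
  ring

theorem sum_re_multiplicationMatrix (hφ : ∀ k, AEStronglyMeasurable (φ k) ν)
    (hf : AEStronglyMeasurable f ν) (hi : Integrable (fun y => f y * ∑ k, ‖φ k y‖ ^ 2) ν) :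
    ∑ k, (multiplicationMatrix ν φ f k k).re = ∫ y, f y * ∑ k, ‖φ k y‖ ^ 2 ∂ν := by
  simp only [multiplicationMatrix_self, Complex.ofReal_re, Finset.mul_sum]
  rw [integral_finsetSum]
  intro k _
  have h := (integrable_mul_mul_conj hφ hf hi k k).re
  refine h.congr (Eventually.of_forall fun y => ?_)
  simp only [Complex.mul_conj']
  exact_mod_cast rfl

variable [SigmaFinite ν]

/-- The correlation functions of a determinantal density. -/
theorem integral_prod_comp_mul_slaterDensity
    (ho : ∀ k l, ∫ y, φ k y * conj (φ l y) ∂ν = (1 : Matrix (Fin n) (Fin n) ℂ) k l)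
    (h2 : ∀ k l, Integrable (fun y => φ k y * conj (φ l y)) ν)
    (hi : ∀ k l, Integrable (fun y => (f y : ℂ) * (φ k y * conj (φ l y))) ν)
    {m : ℕ} {s : Fin m → Fin n} (hs : Function.Injective s) :
    Integrable (fun x => (∏ c, f (x (s c))) * slaterDensity φ x) (Measure.pi fun _ => ν) ∧
    ∫ x, (∏ c, f (x (s c))) * slaterDensity φ x ∂(Measure.pi fun _ => ν)
      = (∑ σ : Equiv.Perm (Fin n), ((multiplicationMatrix ν φ f).submatrix
          (fun c => σ (s c)) (fun c => σ (s c))).det.re) / n.factorial := by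
  -- Where `h j = 1`, orthonormality makes the corresponding row of the Andréief determinant a row
  -- of the identity; only the minor on the selected indices survives.
  set h : Fin n → X → ℂ := fun j y => if j ∈ Finset.univ.image s then (f y : ℂ) else 1 with hh
  have hint : ∀ j k l, Integrable (fun y => h j y * (φ k y * conj (φ l y))) ν := by
    intro j k l
    by_cases hj : j ∈ Finset.univ.image s
    · simpa only [hh, if_pos hj] using hi k l
    · simpa only [hh, if_neg hj, one_mul] using h2 k l
  obtain ⟨hI, hE⟩ := integral_prod_mul_norm_sq_det h hint
  have hprod : ∀ x : Fin n → X, ∏ j, h j (x j) = ((∏ c, f (x (s c)) : ℝ) : ℂ) := by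
    intro x
    simp only [hh]
    rw [Finset.prod_ite_mem, Finset.univ_inter, Finset.prod_image fun a _ b _ hab => hs hab]
    push_cast
    rfl
  have hval : ∀ x : Fin n → X, (∏ c, f (x (s c))) * slaterDensity φ x
      = ((∏ j, h j (x j)) * ((‖(Matrix.of fun i k => φ k (x i)).det‖ ^ 2 : ℝ) : ℂ)).re
        * (n.factorial : ℝ)⁻¹ := by
    intro x
    rw [hprod, ← Complex.ofReal_mul, Complex.ofReal_re, slaterDensity, div_eq_mul_inv, mul_assoc]
  simp only [hval]
  refine ⟨hI.re.mul_const _, ?_⟩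
  rw [integral_mul_const, ← div_eq_mul_inv]
  congr 1
  refine (integral_re hI).trans ?_
  rw [hE]
  refine (Complex.re_sum _ _).trans (Finset.sum_congr rfl fun σ _ => congrArg Complex.re ?_)
  have := det_rows_eq_det_submatrix ((multiplicationMatrix ν φ f).submatrix σ σ) hs
  rw [Matrix.submatrix_submatrix] at this
  refine Eq.trans (congrArg Matrix.det ?_) this
  ext j k
  simp only [Matrix.of_apply, hh]
  by_cases hj : j ∈ Finset.univ.image s
  · simp only [if_pos hj]
    rfl
  · simp only [if_neg hj, one_mul, ho, Matrix.one_apply, σ.injective.eq_iff]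

theorem integral_slaterDensity
    (ho : ∀ k l, ∫ y, φ k y * conj (φ l y) ∂ν = (1 : Matrix (Fin n) (Fin n) ℂ) k l)
    (h2 : ∀ k l, Integrable (fun y => φ k y * conj (φ l y)) ν) :
    Integrable (slaterDensity φ) (Measure.pi fun _ => ν) ∧
      ∫ x, slaterDensity φ x ∂(Measure.pi fun _ => ν) = 1 := by
  have h := integral_prod_comp_mul_slaterDensity (f := fun _ => 1) ho h2
    -- The correlation formula with no point: each of the `n!` empty minors equals `1`.
    (fun k l => by simpa using h2 k l) (s := (Fin.elim0 : Fin 0 → Fin n))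
    (fun a => a.elim0)
  simp only [Finset.univ_eq_empty, Finset.prod_empty, one_mul, Matrix.det_isEmpty, Complex.one_re,
    Finset.sum_const, Finset.card_univ, Fintype.card_perm, Fintype.card_fin, nsmul_eq_mul,
    mul_one] at h
  rwa [div_self (by positivity)] at h

theorem sum_perm_div_factorial (c : ℝ) :
    (∑ _σ : Equiv.Perm (Fin n), c) / n.factorial = c := by
  rw [Finset.sum_const, Finset.card_univ, Fintype.card_perm, Fintype.card_fin, nsmul_eq_mul]
  field_simp

/-- The expectation of a linear statistic. -/
theorem integral_sum_mul_slaterDensity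
    (ho : ∀ k l, ∫ y, φ k y * conj (φ l y) ∂ν = (1 : Matrix (Fin n) (Fin n) ℂ) k l)
    (h2 : ∀ k l, Integrable (fun y => φ k y * conj (φ l y)) ν)
    (hφ : ∀ k, AEStronglyMeasurable (φ k) ν) (hf : AEStronglyMeasurable f ν)
    (hi : Integrable (fun y => f y * ∑ k, ‖φ k y‖ ^ 2) ν) :
    Integrable (fun x => (∑ a, f (x a)) * slaterDensity φ x) (Measure.pi fun _ => ν) ∧
      ∫ x, (∑ a, f (x a)) * slaterDensity φ x ∂(Measure.pi fun _ => ν)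
        = ∫ y, f y * ∑ k, ‖φ k y‖ ^ 2 ∂ν := by
  have h : ∀ a : Fin n, _ := fun a => integral_prod_comp_mul_slaterDensity ho h2
    (integrable_mul_mul_conj hφ hf hi) (s := fun _ : Fin 1 => a)
    (Function.injective_of_subsingleton _)
  simp only [Finset.univ_unique, Finset.prod_singleton, Matrix.det_fin_one,
    Matrix.submatrix_apply] at h
  simp only [Finset.sum_mul]
  refine ⟨integrable_finsetSum _ fun a _ => (h a).1, ?_⟩
  rw [integral_finsetSum _ fun a _ => (h a).1, Finset.sum_congr rfl fun a _ => (h a).2,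
    ← Finset.sum_div, Finset.sum_comm, ← sum_re_multiplicationMatrix hφ hf hi]
  refine Eq.trans ?_ (sum_perm_div_factorial (n := n) (∑ k, (multiplicationMatrix ν φ f k k).re))
  congr 1
  exact Finset.sum_congr rfl fun σ _ =>
    Equiv.sum_comp σ fun k => (multiplicationMatrix ν φ f k k).re

/-- Negative correlations: a bound on the second moment of a linear statistic. -/
theorem integral_sum_sq_mul_slaterDensity_le
    (ho : ∀ k l, ∫ y, φ k y * conj (φ l y) ∂ν = (1 : Matrix (Fin n) (Fin n) ℂ) k l)
    (h2 : ∀ k l, Integrable (fun y => φ k y * conj (φ l y)) ν)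
    (hφ : ∀ k, AEStronglyMeasurable (φ k) ν) (hf : AEStronglyMeasurable f ν) (hf0 : ∀ y, 0 ≤ f y)
    (hi : Integrable (fun y => f y * ∑ k, ‖φ k y‖ ^ 2) ν)
    (hi2 : Integrable (fun y => f y ^ 2 * ∑ k, ‖φ k y‖ ^ 2) ν) :
    Integrable (fun x => (∑ a, f (x a)) ^ 2 * slaterDensity φ x) (Measure.pi fun _ => ν) ∧
      ∫ x, (∑ a, f (x a)) ^ 2 * slaterDensity φ x ∂(Measure.pi fun _ => ν)
        ≤ ∫ y, f y ^ 2 * ∑ k, ‖φ k y‖ ^ 2 ∂ν + (∫ y, f y * ∑ k, ‖φ k y‖ ^ 2 ∂ν) ^ 2 := by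
  set F := multiplicationMatrix ν φ f with hF
  have hF0 : ∀ k, 0 ≤ (F k k).re := fun k => by
    rw [hF, multiplicationMatrix_self, Complex.ofReal_re]
    exact integral_nonneg fun y => mul_nonneg (hf0 y) (by positivity)
  obtain ⟨hd, hd'⟩ := integral_sum_mul_slaterDensity ho h2 hφ (hf.pow 2) hi2
  have hpair : ∀ a b : Fin n, a ≠ b →
      Integrable (fun x => f (x a) * f (x b) * slaterDensity φ x) (Measure.pi fun _ => ν) ∧
      ∫ x, f (x a) * f (x b) * slaterDensity φ x ∂(Measure.pi fun _ => ν)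
        ≤ (∑ σ : Equiv.Perm (Fin n), (F (σ a) (σ a)).re * (F (σ b) (σ b)).re) / n.factorial := by
    intro a b hab
    have hs : Function.Injective ![a, b] := by
      intro i j hij
      fin_cases i <;> fin_cases j <;> simp_all [eq_comm]
    have h := integral_prod_comp_mul_slaterDensity ho h2 (integrable_mul_mul_conj hφ hf hi) hs
    simp only [Fin.prod_univ_two, Matrix.det_fin_two, Matrix.submatrix_apply, Matrix.cons_val_zero,
      Matrix.cons_val_one] at h
    refine ⟨h.1, h.2.le.trans ?_⟩
    -- The minor is `F_aa F_bb - |F_ab|²`, since the matrix is Hermitian; dropping the last term is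
    -- the negative correlation bound.
    gcongr with σ
    have e1 : F (σ b) (σ a) = conj (F (σ a) (σ b)) := multiplicationMatrix_conj (σ a) (σ b)
    have e2 : (F (σ a) (σ a)).im = 0 := by
      rw [hF, multiplicationMatrix_self, Complex.ofReal_im]
    have e3 := Complex.normSq_nonneg (F (σ a) (σ b))
    rw [← hF, e1, Complex.mul_conj, Complex.sub_re, Complex.ofReal_re, Complex.mul_re, e2]
    linarith
  have hexp : ∀ x : Fin n → X, (∑ a, f (x a)) ^ 2 * slaterDensity φ x
      = (∑ a, f (x a) ^ 2) * slaterDensity φ x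
        + ∑ a, ∑ b, if a ≠ b then f (x a) * f (x b) * slaterDensity φ x else 0 := by
    intro x
    rw [sq, Finset.sum_mul_sum, Finset.sum_mul, Finset.sum_mul, ← Finset.sum_add_distrib]
    refine Finset.sum_congr rfl fun a _ => ?_
    have e : ∀ b, f (x a) * f (x b) * slaterDensity φ x
        = (if a = b then f (x a) ^ 2 * slaterDensity φ x else 0)
          + if a ≠ b then f (x a) * f (x b) * slaterDensity φ x else 0 := by
      intro b
      by_cases hab : a = b
      · simp [hab, sq]
      · simp [hab]
    rw [Finset.sum_mul, Finset.sum_congr rfl fun b _ => e b, Finset.sum_add_distrib]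
    simp
  have hpi : ∀ a b : Fin n, Integrable (fun x => if a ≠ b then
      f (x a) * f (x b) * slaterDensity φ x else 0) (Measure.pi fun _ => ν) := by
    intro a b
    by_cases hab : a = b
    · simp [hab]
    · simpa only [ne_eq, hab, not_false_eq_true, if_true] using (hpair a b hab).1
  have hpi' : ∀ a : Fin n, Integrable (fun x => ∑ b, if a ≠ b then
      f (x a) * f (x b) * slaterDensity φ x else 0) (Measure.pi fun _ => ν) :=
    fun a => integrable_finsetSum _ fun b _ => hpi a b
  simp only [hexp]
  simp only [Pi.pow_apply] at hd hd'
  refine ⟨hd.add (integrable_finsetSum _ fun a _ => hpi' a), ?_⟩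
  rw [integral_add hd (integrable_finsetSum _ fun a _ => hpi' a), integral_finsetSum _ fun a _ =>
    hpi' a, ← sum_re_multiplicationMatrix hφ hf hi]
  refine add_le_add hd'.le ?_
  rw [← hF, ← sum_perm_div_factorial (n := n) ((∑ k, (F k k).re) ^ 2)]
  have hsq : ∀ σ : Equiv.Perm (Fin n), (∑ k, (F k k).re) ^ 2
      = ∑ a, ∑ b, (F (σ a) (σ a)).re * (F (σ b) (σ b)).re := by
    intro σ
    rw [← Equiv.sum_comp σ fun k => (F k k).re, sq, Finset.sum_mul_sum]
  rw [Finset.sum_congr rfl fun σ _ => hsq σ, Finset.sum_comm, Finset.sum_div]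
  refine Finset.sum_le_sum fun a _ => ?_
  rw [integral_finsetSum _ fun b _ => hpi a b, Finset.sum_comm, Finset.sum_div]
  refine Finset.sum_le_sum fun b _ => ?_
  -- The diagonal terms, absent on the left, are added on the right; they are non-negative because
  -- `f ≥ 0`.
  by_cases hab : a = b
  · simp only [ne_eq, hab, not_true_eq_false, if_false, integral_zero]
    exact div_nonneg (Finset.sum_nonneg fun σ _ => mul_nonneg (hF0 _) (hF0 _)) (by positivity)
  · simpa only [ne_eq, hab, not_false_eq_true, if_true] using (hpair a b hab).2

/-- Expanding the square, the mean is exact and the second moment is bounded by negative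
correlations: a variance term `c² ∫ f² ρ` and a squared bias remain. -/
theorem integral_linearStatistic_sub_sq_le
    (ho : ∀ k l, ∫ y, φ k y * conj (φ l y) ∂ν = (1 : Matrix (Fin n) (Fin n) ℂ) k l)
    (h2 : ∀ k l, Integrable (fun y => φ k y * conj (φ l y)) ν)
    (hφ : ∀ k, AEStronglyMeasurable (φ k) ν) (hf : AEStronglyMeasurable f ν) (hf0 : ∀ y, 0 ≤ f y)
    (hi : Integrable (fun y => f y * ∑ k, ‖φ k y‖ ^ 2) ν)
    (hi2 : Integrable (fun y => f y ^ 2 * ∑ k, ‖φ k y‖ ^ 2) ν) (c m : ℝ) :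
    Integrable (fun x => (c * ∑ a, f (x a) - m) ^ 2 * slaterDensity φ x) (Measure.pi fun _ => ν) ∧
      ∫ x, (c * ∑ a, f (x a) - m) ^ 2 * slaterDensity φ x ∂(Measure.pi fun _ => ν)
        ≤ c ^ 2 * ∫ y, f y ^ 2 * ∑ k, ‖φ k y‖ ^ 2 ∂ν
          + (c * ∫ y, f y * ∑ k, ‖φ k y‖ ^ 2 ∂ν - m) ^ 2 := by
  obtain ⟨i0, e0⟩ := integral_slaterDensity ho h2
  obtain ⟨i1, e1⟩ := integral_sum_mul_slaterDensity ho h2 hφ hf hi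
  obtain ⟨i2, e2⟩ := integral_sum_sq_mul_slaterDensity_le ho h2 hφ hf hf0 hi hi2
  have hexp : ∀ x : Fin n → X, (c * ∑ a, f (x a) - m) ^ 2 * slaterDensity φ x
      = c ^ 2 * ((∑ a, f (x a)) ^ 2 * slaterDensity φ x)
        + ((-2 * c * m) * ((∑ a, f (x a)) * slaterDensity φ x) + m ^ 2 * slaterDensity φ x) :=
    fun x => by ring
  simp only [hexp]
  have j1 : Integrable (fun x : Fin n → X => (-2 * c * m) * ((∑ a, f (x a)) * slaterDensity φ x)
      + m ^ 2 * slaterDensity φ x) (Measure.pi fun _ => ν) :=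
    (i1.const_mul (-2 * c * m)).add (i0.const_mul (m ^ 2))
  refine ⟨(i2.const_mul (c ^ 2)).add j1, ?_⟩
  rw [integral_add (i2.const_mul (c ^ 2)) j1,
    integral_add (i1.const_mul (-2 * c * m)) (i0.const_mul (m ^ 2)), integral_const_mul,
    integral_const_mul, integral_const_mul, e0, e1]
  nlinarith [mul_le_mul_of_nonneg_left e2 (sq_nonneg c)]

end LinearStatistics

end

section

/-! ### The law of the process -/

variable {V : ℂ → ℝ} {μ δ N : ℝ}

instance gam_sigmaFinite : SigmaFinite gam := inferInstance

namespace PotentialAssumption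

theorem exists_orbitals (hV : PotentialAssumption V μ δ) (hN : 0 < N) :
    ∃ φ : Fin (particleNumber V μ N) → ℂ → ℂ, (∀ k, Continuous (φ k)) ∧
      (∀ k, MemLp (φ k) 2 gam) ∧
      (∀ k l, ∫ y, φ k y * conj (φ l y) ∂gam
        = (1 : Matrix (Fin (particleNumber V μ N)) (Fin (particleNumber V μ N)) ℂ) k l) ∧
      ∀ x z, fermiKernel V μ N x z = ∑ k, φ k x * conj (φ k z) := by
  have := hV.finiteDimensional_fermiSpace hN
  set b := stdOrthonormalBasis ℂ (fermiSpace V μ N) with hb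
  refine ⟨fun k => val (b k : fock N), fun k => val_continuous _, fun k => memLp_val _,
    fun k l => ?_, fun x z => hV.fermiKernel_eq_sum hN x z⟩
  have h1 := inner_eq_integral (b l : fock N) (b k : fock N)
  have h2 := orthonormal_iff_ite.1 b.orthonormal l k
  have h3 : inner ℂ (b l : fock N) (b k : fock N) = if l = k then 1 else 0 := h2
  rw [Matrix.one_apply, integral_congr_ae (Eventually.of_forall fun y => mul_comm _ _), ← h1, h3]
  simp only [eq_comm]

theorem fermiDensity_eq_sum {φ : Fin (particleNumber V μ N) → ℂ → ℂ}
    (h : ∀ x z, fermiKernel V μ N x z = ∑ k, φ k x * conj (φ k z)) (x : ℂ) :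
    fermiDensity V μ N x = ∑ k, ‖φ k x‖ ^ 2 := by
  rw [fermiDensity, h]
  simp only [Complex.mul_conj']
  norm_cast

theorem processLaw_eq {φ : Fin (particleNumber V μ N) → ℂ → ℂ}
    (h : ∀ x z, fermiKernel V μ N x z = ∑ k, φ k x * conj (φ k z)) :
    processLaw V μ N = (Measure.pi fun _ => gam).withDensity
      fun x => ENNReal.ofReal (slaterDensity φ x) := by
  simp only [processLaw, h, det_kernel_eq, Complex.ofReal_re, slaterDensity]

theorem continuous_slaterDensity {n : ℕ} {φ : Fin n → ℂ → ℂ} (hφ : ∀ k, Continuous (φ k)) :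
    Continuous (slaterDensity φ) := by
  unfold slaterDensity
  have h : Continuous fun x : Fin n → ℂ => Matrix.of fun i k => φ k (x i) :=
    continuous_matrix fun i k => (hφ k).comp (continuous_apply i)
  exact (h.matrix_det.norm.pow 2).div_const _

theorem integrable_mul_conj {φ : Fin (particleNumber V μ N) → ℂ → ℂ}
    (hm : ∀ k, MemLp (φ k) 2 gam) (k l : Fin (particleNumber V μ N)) :
    Integrable (fun y => φ k y * conj (φ l y)) gam := by
  simpa only [mul_comm] using integrable_conj_mul (hm l) (hm k)

theorem isProbabilityMeasure_processLaw (hV : PotentialAssumption V μ δ) (hN : 0 < N) :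
    IsProbabilityMeasure (processLaw V μ N) := by
  obtain ⟨φ, -, hm, ho, hk⟩ := hV.exists_orbitals hN
  obtain ⟨h1, h2⟩ := integral_slaterDensity ho (integrable_mul_conj hm)
  refine ⟨?_⟩
  rw [processLaw_eq hk, withDensity_apply _ MeasurableSet.univ, Measure.restrict_univ,
    ← ofReal_integral_eq_lintegral_ofReal h1 (Eventually.of_forall (slaterDensity_nonneg φ)), h2,
    ENNReal.ofReal_one]

theorem integral_fermiDensity (hV : PotentialAssumption V μ δ) (hN : 0 < N) :
    ∫ x, fermiDensity V μ N x ∂gam = particleNumber V μ N := by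
  obtain ⟨φ, -, hm, ho, hk⟩ := hV.exists_orbitals hN
  have h : ∀ k, ∫ x, ‖φ k x‖ ^ 2 ∂gam = 1 := by
    intro k
    have h1 := ho k k
    simp only [Complex.mul_conj', Matrix.one_apply_eq] at h1
    have h2 : ∫ x, ((‖φ k x‖ ^ 2 : ℝ) : ℂ) ∂gam = 1 := by
      push_cast
      exact h1
    rw [integral_complex_ofReal] at h2
    exact_mod_cast h2
  simp only [fermiDensity_eq_sum hk]
  rw [integral_finsetSum _ fun k _ => (hm k).integrable_norm_pow (by norm_num)]
  simp [h]

theorem continuous_fermiDensity (hV : PotentialAssumption V μ δ) (hN : 0 < N) :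
    Continuous (fermiDensity V μ N) := by
  obtain ⟨φ, hc, -, -, hk⟩ := hV.exists_orbitals hN
  rw [show fermiDensity V μ N = _ from funext (fermiDensity_eq_sum hk)]
  exact continuous_finsetSum _ fun k _ => (hc k).norm.pow 2

/-- A bound on the mean square deviation of a linear statistic. -/
theorem eLpNorm_linearStatistic_sub_le (hV : PotentialAssumption V μ δ) (hN : 0 < N) {f : ℂ → ℝ}
    (hf : AEMeasurable f gam) (hf0 : ∀ x, 0 ≤ f x)
    (hi : Integrable (fun x => f x * fermiDensity V μ N x) gam)
    (hi2 : Integrable (fun x => f x ^ 2 * fermiDensity V μ N x) gam) (c m : ℝ) :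
    eLpNorm (fun x => c * linearStatistic f x - m) 2 (processLaw V μ N)
      ≤ ENNReal.ofReal (Real.sqrt (c ^ 2 * ∫ x, f x ^ 2 * fermiDensity V μ N x ∂gam
          + (c * ∫ x, f x * fermiDensity V μ N x ∂gam - m) ^ 2)) := by
  obtain ⟨φ, hc, hm, ho, hk⟩ := hV.exists_orbitals hN
  simp only [fermiDensity_eq_sum hk] at hi hi2 ⊢
  obtain ⟨h1, h2⟩ := integral_linearStatistic_sub_sq_le ho (integrable_mul_conj hm)
    (fun k => (hc k).aestronglyMeasurable) hf.aestronglyMeasurable hf0 hi hi2 c m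
  set B := c ^ 2 * ∫ x, f x ^ 2 * ∑ k, ‖φ k x‖ ^ 2 ∂gam
          + (c * ∫ x, f x * ∑ k, ‖φ k x‖ ^ 2 ∂gam - m) ^ 2 with hB
  have hB0 : 0 ≤ B := add_nonneg (mul_nonneg (sq_nonneg c) (integral_nonneg fun x =>
    mul_nonneg (sq_nonneg _) (Finset.sum_nonneg fun _ _ => by positivity))) (sq_nonneg _)
  have hlin : AEMeasurable (fun x : Fin (particleNumber V μ N) → ℂ => linearStatistic f x)
      (Measure.pi fun _ => gam) :=
    Finset.aemeasurable_fun_sum _ fun i _ =>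
      hf.comp_quasiMeasurePreserving (Measure.quasiMeasurePreserving_eval (fun _ => gam) i)
  have hsl : AEMeasurable (fun x => ENNReal.ofReal (slaterDensity φ x))
      (Measure.pi fun _ => gam) := (continuous_slaterDensity hc).measurable.ennreal_ofReal.aemeasurable
  rw [eLpNorm_eq_lintegral_rpow_enorm_toReal (by norm_num) (by norm_num), processLaw_eq hk,
    lintegral_withDensity_eq_lintegral_mul₀ hsl
      ((((hlin.const_mul c).sub_const m).enorm.pow_const _))]
  have e : ∀ x : Fin (particleNumber V μ N) → ℂ,
      ENNReal.ofReal (slaterDensity φ x) * ‖c * linearStatistic f x - m‖ₑ ^ (2 : ℝ≥0∞).toReal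
      = ENNReal.ofReal ((c * ∑ a, f (x a) - m) ^ 2 * slaterDensity φ x) := by
    intro x
    rw [mul_comm, ENNReal.ofReal_mul (sq_nonneg _), ENNReal.toReal_ofNat,
      ENNReal.rpow_ofNat, ← ofReal_norm, ← ENNReal.ofReal_pow (norm_nonneg _),
      Real.norm_eq_abs, sq_abs]
    rfl
  simp only [Pi.mul_apply]
  rw [lintegral_congr e, ← ofReal_integral_eq_lintegral_ofReal h1 (Eventually.of_forall fun x =>
    mul_nonneg (sq_nonneg _) (slaterDensity_nonneg φ x)), ENNReal.toReal_ofNat,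
    ENNReal.ofReal_rpow_of_nonneg (integral_nonneg fun x => mul_nonneg (sq_nonneg _)
      (slaterDensity_nonneg φ x)) (by norm_num), ← Real.sqrt_eq_rpow]
  exact ENNReal.ofReal_le_ofReal (Real.sqrt_le_sqrt h2)

end PotentialAssumption

end

section

/-! ### Asymptotics -/

variable {V : ℂ → ℝ} {μ δ N : ℝ}

/-- A regular level set is negligible. -/
theorem gam_level_eq_zero (hV : ∀ z, V z = μ → fderiv ℝ V z ≠ 0) : gam {z | V z = μ} = 0 := by
  have hv : ∀ z, ∃ v : ℂ, V z = μ → fderiv ℝ V z v = 1 := by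
    intro z
    by_cases hz : V z = μ
    · obtain ⟨w, hw⟩ : ∃ w, fderiv ℝ V z w ≠ 0 := by
        by_contra! h
        exact hV z hz (ContinuousLinearMap.ext h)
      refine ⟨(fderiv ℝ V z w)⁻¹ • w, fun _ => ?_⟩
      rw [map_smul, smul_eq_mul, inv_mul_cancel₀ hw]
    · exact ⟨0, fun h => absurd h hz⟩
  choose v hv using hv
  -- On the level set, the identity coincides with `y ↦ y - (V y - μ) v(z)`, so `1 - dV_z ⊗ v(z)` is
  -- one of its derivatives within that set. It kills `v(z)`, hence has zero determinant, and the
  -- image, which is the level set itself, is null.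
  have h := addHaar_image_eq_zero_of_det_fderivWithin_eq_zero gam (s := {z | V z = μ})
    (f := fun z => z)
    (f' := fun z => ContinuousLinearMap.id ℝ ℂ - (fderiv ℝ V z).smulRight (v z)) ?_ ?_
  · simpa using h
  · intro z hz
    have hz' : V z = μ := hz
    have hd : HasFDerivAt V (fderiv ℝ V z) z :=
      (not_imp_comm.1 fderiv_zero_of_not_differentiableAt (hV z hz')).hasFDerivAt
    have h1 := (((hasFDerivAt_id (𝕜 := ℝ) z).sub (hd.smul_const (v z))).add_const
      (μ • v z)).hasFDerivWithinAt (s := {z | V z = μ})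
    refine h1.congr (fun y hy => ?_) ?_
    · have hy' : V y = μ := hy
      simp [hy']
    · simp [hz']
  · intro z hz
    have h1 := hv z hz
    have hne : v z ≠ 0 := fun h0 => by simp [h0] at h1
    refine LinearMap.det_eq_zero_iff_ker_ne_bot.2 fun hk => hne ?_
    refine LinearMap.ker_eq_bot'.1 hk (v z) ?_
    simp [h1]

theorem integrable_exp_neg_norm : Integrable (fun z : ℂ => Real.exp (-‖z‖)) gam := by
  have h := integrable_gam (integrable_one_add_norm (E := ℂ) (μ := volume) (r := 3)
    (by rw [Complex.finrank_real_complex]; norm_num))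
  -- The constant comes from `(1 + ‖z‖)³ / 3! ≤ exp (1 + ‖z‖)`.
  refine (h.const_mul (6 * Real.exp 1)).mono' (by fun_prop) (Eventually.of_forall fun z => ?_)
  rw [Real.norm_eq_abs, abs_of_pos (Real.exp_pos _), Real.exp_neg, Real.rpow_neg (by positivity)]
  have h1 := Real.pow_div_factorial_le_exp (1 + ‖z‖) (by positivity) 3
  have h2 : (1 + ‖z‖) ^ (3 : ℝ) = (1 + ‖z‖) ^ 3 := by norm_cast
  rw [Real.exp_add] at h1
  rw [h2, ← div_eq_mul_inv, ← one_div, div_le_div_iff₀ (Real.exp_pos _) (by positivity)]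
  have h3 : ((3 : ℕ).factorial : ℝ) = 6 := by norm_num [Nat.factorial]
  rw [h3, div_le_iff₀ (by norm_num)] at h1
  linarith

namespace PotentialAssumption

theorem isOpen_droplet (hV : PotentialAssumption V μ δ) : IsOpen (droplet V μ) :=
  isOpen_lt hV.continuous continuous_const

/-- If `V ≥ μ` everywhere, a point of the level set would be a minimum of `V`, where the
differential vanishes. -/
theorem droplet_nonempty (hV : PotentialAssumption V μ δ) : (droplet V μ).Nonempty := by
  by_contra h
  rw [Set.not_nonempty_iff_eq_empty, Set.eq_empty_iff_forall_notMem] at h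
  obtain ⟨z, hz⟩ := hV.connected_level.nonempty
  have hz' : V z = μ := hz
  refine hV.regular_level z hz' (IsLocalMin.fderiv_eq_zero (Eventually.of_forall fun y => ?_))
  rw [hz']
  exact not_lt.1 (h y)

theorem gam_droplet_pos (hV : PotentialAssumption V μ δ) : 0 < gam.real (droplet V μ) := by
  refine ENNReal.toReal_pos (hV.isOpen_droplet.measure_pos gam hV.droplet_nonempty).ne'
    (ne_top_of_le_ne_top (hV.compact_sublevel.measure_lt_top (μ := gam)).ne
      (measure_mono fun z hz => ?_))
  have hz' : V z < μ := hz
  have := hV.pos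
  change V z ≤ μ + δ
  linarith

theorem tendsto_fermiDensity_div (hV : PotentialAssumption V μ δ) {x : ℂ} (hx : V x ≠ μ) :
    Tendsto (fun N : ℝ => fermiDensity V μ N x / N) atTop
      (𝓝 ((droplet V μ).indicator (fun _ => 1) x)) := by
  obtain ⟨N₀, hN₀, h⟩ := hV.exists_fermiDensity_sub_le
    (abs_pos.2 (sub_ne_zero.2 hx)) zero_lt_one
  rw [tendsto_iff_norm_sub_tendsto_zero]
  refine squeeze_zero' (Eventually.of_forall fun N => norm_nonneg _) (g := fun N : ℝ => 2 * N⁻¹) ?_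
    (by simpa using tendsto_inv_atTop_zero.const_mul (2 : ℝ))
  filter_upwards [eventually_ge_atTop N₀] with N hN
  have hN0 : 0 < N := by linarith
  have h1 := h N hN x le_rfl
  have h2 : Real.exp (-(1 * Real.sqrt N)) ≤ 1 := Real.exp_le_one_iff.2 (by
    have := Real.sqrt_nonneg N
    linarith)
  have h3 : fermiDensity V μ N x / N - (droplet V μ).indicator (fun _ => (1 : ℝ)) x
      = (fermiDensity V μ N x - N * (droplet V μ).indicator (fun _ => (1 : ℝ)) x) * N⁻¹ := by
    field_simp
  rw [h3, norm_mul, Real.norm_eq_abs, Real.norm_eq_abs, abs_of_pos (inv_pos.2 hN0)]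
  exact mul_le_mul_of_nonneg_right (by linarith) (inv_pos.2 hN0).le

/-- The density integrates functions of at most exponential growth, and converges weakly to
the indicator of the droplet. -/
theorem tendsto_integral_mul_fermiDensity (hV : PotentialAssumption V μ δ) {f : ℂ → ℝ}
    (hf : AEMeasurable f gam) (hf0 : ∀ x, 0 ≤ f x) {C : ℝ} (hC : 0 ≤ C)
    (hfC : ∀ x, f x ≤ Real.exp (C * ‖x‖)) :
    (∀ᶠ N in atTop, Integrable (fun x => f x * fermiDensity V μ N x) gam) ∧
      Tendsto (fun N : ℝ => N⁻¹ * ∫ x, f x * fermiDensity V μ N x ∂gam) atTop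
        (𝓝 (∫ x in droplet V μ, f x ∂gam)) := by
  -- One unit of decay more than the growth of `f` leaves the integrable majorant `K exp (-‖x‖)`,
  -- uniform in `N`.
  obtain ⟨K, N₀, hK, hN₀, h⟩ := hV.exists_fermiDensity_le_exp (a := C + 1) (by linarith)
  have hmeas : ∀ N, N₀ ≤ N → AEStronglyMeasurable
      (fun x => N⁻¹ * (f x * fermiDensity V μ N x)) gam := fun N hN =>
    ((hf.mul (hV.continuous_fermiDensity (by linarith)).measurable.aemeasurable).const_mul
      _).aestronglyMeasurable
  have hbound : ∀ N, N₀ ≤ N → ∀ x,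
      ‖N⁻¹ * (f x * fermiDensity V μ N x)‖ ≤ K * Real.exp (-‖x‖) := by
    intro N hN x
    have hN0 : 0 < N := by linarith
    have h0 := hV.fermiDensity_nonneg hN0 x
    rw [Real.norm_of_nonneg (mul_nonneg (inv_pos.2 hN0).le (mul_nonneg (hf0 x) h0))]
    calc N⁻¹ * (f x * fermiDensity V μ N x)
        ≤ N⁻¹ * (Real.exp (C * ‖x‖) * (N * (K * Real.exp (-((C + 1) * ‖x‖))))) := by
          gcongr
          · exact hfC x
          · exact h N hN x
      _ = K * (Real.exp (C * ‖x‖) * Real.exp (-((C + 1) * ‖x‖))) := by field_simp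
      _ = K * Real.exp (-‖x‖) := by
          rw [← Real.exp_add]
          congr 2
          ring
  have hint : Integrable (fun x : ℂ => K * Real.exp (-‖x‖)) gam :=
    integrable_exp_neg_norm.const_mul K
  refine ⟨?_, ?_⟩
  · filter_upwards [eventually_ge_atTop N₀] with N hN
    have hN0 : N ≠ 0 := by linarith
    have h1 := (hint.mono' (hmeas N hN) (Eventually.of_forall (hbound N hN))).const_mul N
    refine h1.congr (Eventually.of_forall fun x => ?_)
    change N * (N⁻¹ * _) = _
    rw [mul_inv_cancel_left₀ hN0]
  · simp only [← integral_const_mul]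
    rw [← integral_indicator hV.isOpen_droplet.measurableSet]
    refine tendsto_integral_filter_of_dominated_convergence (fun x => K * Real.exp (-‖x‖))
      ?_ ?_ hint ?_
    · filter_upwards [eventually_ge_atTop N₀] with N hN using hmeas N hN
    · filter_upwards [eventually_ge_atTop N₀] with N hN using
        Eventually.of_forall (hbound N hN)
    · have hae : ∀ᵐ x ∂gam, V x ≠ μ := by
        rw [ae_iff]
        simpa using gam_level_eq_zero hV.regular_level
      filter_upwards [hae] with x hx
      have h1 := (hV.tendsto_fermiDensity_div hx).const_mul (f x)
      have e : f x * (droplet V μ).indicator (fun _ => (1 : ℝ)) x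
          = (droplet V μ).indicator f x := by
        by_cases hm : x ∈ droplet V μ <;> simp [hm]
      rw [e] at h1
      refine h1.congr fun N => ?_
      rw [div_eq_inv_mul]
      ring

theorem isEquivalent_particleNumber (hV : PotentialAssumption V μ δ) :
    (fun N : ℝ => (particleNumber V μ N : ℝ)) ~[atTop] fun N : ℝ => N * gam.real (droplet V μ) := by
  have hD := hV.gam_droplet_pos
  have h := (hV.tendsto_integral_mul_fermiDensity (f := fun _ => 1) aemeasurable_const
    (fun _ => zero_le_one) le_rfl (fun x => by simp)).2
  simp only [one_mul, setIntegral_const, smul_eq_mul, mul_one] at h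
  refine isEquivalent_of_tendsto_one ?_
  have h2 := h.div_const (gam.real (droplet V μ))
  rw [div_self hD.ne'] at h2
  refine h2.congr' ?_
  filter_upwards [eventually_gt_atTop 0] with N hN
  rw [hV.integral_fermiDensity hN, Pi.div_apply]
  field_simp

/-- Both `f` and `f²` grow at most exponentially, so the previous limit applies to each: the bias
tends to zero, and the variance bound is `N⁻¹` times a convergent quantity. -/
theorem tendsto_eLpNorm_linearStatistic (hV : PotentialAssumption V μ δ) {f : ℂ → ℝ}
    (hf : AEMeasurable f gam) (hf0 : ∀ x, 0 ≤ f x) {C : ℝ} (hC : 0 ≤ C)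
    (hfC : ∀ x, f x ≤ Real.exp (C * ‖x‖)) :
    Tendsto (fun N : ℝ => eLpNorm
      (fun x => N⁻¹ * linearStatistic f x - ∫ z in droplet V μ, f z ∂gam) 2 (processLaw V μ N))
      atTop (𝓝 0) := by
  obtain ⟨i1, t1⟩ := hV.tendsto_integral_mul_fermiDensity hf hf0 hC hfC
  obtain ⟨i2, t2⟩ := hV.tendsto_integral_mul_fermiDensity (hf.pow_const 2)
    (fun x => sq_nonneg (f x)) (C := 2 * C) (by linarith) (fun x => by
      refine (pow_le_pow_left₀ (hf0 x) (hfC x) 2).trans (le_of_eq ?_)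
      rw [← Real.exp_nat_mul]
      push_cast
      ring_nf)
  have t3 := ((tendsto_inv_atTop_zero (𝕜 := ℝ)).mul t2).add
    ((t1.sub_const (∫ x in droplet V μ, f x ∂gam)).pow 2)
  rw [zero_mul, sub_self, zero_pow two_ne_zero, add_zero] at t3
  have t4 := ENNReal.tendsto_ofReal (Real.continuous_sqrt.tendsto _ |>.comp t3)
  rw [Real.sqrt_zero, ENNReal.ofReal_zero] at t4
  refine tendsto_of_tendsto_of_tendsto_of_le_of_le' tendsto_const_nhds t4
    (Eventually.of_forall fun N => zero_le) ?_
  filter_upwards [eventually_gt_atTop 0, i1, i2] with N hN j1 j2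
  refine (hV.eLpNorm_linearStatistic_sub_le hN hf hf0 j1 j2 _ _).trans (le_of_eq ?_)
  simp only [Function.comp_apply]
  rw [sq N⁻¹, mul_assoc]

end PotentialAssumption

end

end BerezinToeplitz

end

/-! ### Assembly of the proposition -/

open BerezinToeplitz in
theorem proposition1p1 (V : ℂ → ℝ) (μ δ₀ : ℝ) (hV : PotentialAssumption V μ δ₀) :
    -- the objects exist: spectral projection, of finite rank, and probability law of the process
    (∀ N : ℝ, 1 ≤ N →
      (∃! P, IsSpectralProjection (toeplitz N V) μ P) ∧
      FiniteDimensional ℂ (fermiSpace V μ N) ∧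
      IsProbabilityMeasure (processLaw V μ N)) ∧
    -- pointwise asymptotics of the density
    (∀ x : ℂ, V x ≠ μ →
      Tendsto (fun N : ℝ => fermiKernel V μ N x x / N) atTop
        (𝓝 ((droplet V μ).indicator (fun _ => 1) x))) ∧
    -- uniform asymptotics away from the edge
    (∀ δ : ℝ, 0 < δ → ∀ α : ℝ, 0 < α → ∃ C N₀ : ℝ, ∀ N : ℝ, N₀ ≤ N → ∀ x : ℂ,
      δ ≤ |V x - μ| →
      ‖fermiKernel V μ N x x - N * (droplet V μ).indicator (fun _ => (1 : ℂ)) x‖ ≤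
        C * Real.exp (-(α * Real.sqrt N))) ∧
    -- particle number
    ((fun N : ℝ => (particleNumber V μ N : ℝ)) ~[atTop] fun N : ℝ => N * gam.real (droplet V μ)) ∧
    -- law of large numbers in `L²`
    (∀ f : ℂ → ℝ, AEMeasurable f gam → (∀ x, 0 ≤ f x) →
      (∃ C : ℝ, 0 ≤ C ∧ ∀ x, f x ≤ Real.exp (C * ‖x‖)) →
      Tendsto (fun N : ℝ => eLpNorm
          (fun x => N⁻¹ * linearStatistic f x - ∫ z in droplet V μ, f z ∂gam) 2
          (processLaw V μ N))
        atTop (𝓝 0)) := by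
  refine ⟨fun N hN => ?_, fun x hx => ?_, fun δ hδ α hα => ?_, hV.isEquivalent_particleNumber,
    fun f hf hf0 ⟨C, hC, hfC⟩ => hV.tendsto_eLpNorm_linearStatistic hf hf0 hC hfC⟩
  · have hN0 : 0 < N := by linarith
    exact ⟨hV.existsUnique_spectralProjection hN0, hV.finiteDimensional_fermiSpace hN0,
      hV.isProbabilityMeasure_processLaw hN0⟩
  · have h := (Complex.continuous_ofReal.tendsto _).comp (hV.tendsto_fermiDensity_div hx)
    have e : (((droplet V μ).indicator (fun _ => (1 : ℝ)) x : ℝ) : ℂ)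
        = (droplet V μ).indicator (fun _ => (1 : ℂ)) x := by
      by_cases hm : x ∈ droplet V μ <;> simp [hm]
    rw [e] at h
    refine h.congr' ?_
    filter_upwards [eventually_gt_atTop 0] with N hN
    rw [Function.comp_apply, hV.fermiKernel_self_eq hN, Complex.ofReal_div]
  · obtain ⟨N₀, hN₀, h⟩ := hV.exists_fermiDensity_sub_le hδ hα
    refine ⟨2, N₀, fun N hN x hx => ?_⟩
    have e : fermiKernel V μ N x x - N * (droplet V μ).indicator (fun _ => (1 : ℂ)) x
        = ((fermiDensity V μ N x - N * (droplet V μ).indicator (fun _ => (1 : ℝ)) x : ℝ) : ℂ) := by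
      rw [hV.fermiKernel_self_eq (by linarith)]
      by_cases hm : x ∈ droplet V μ <;> simp [hm]
    rw [e, Complex.norm_real]
    exact h N hN x hx
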